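/- **Setting.** Let $\mathcal B$ be a unital $C^*$-algebra and $\mathcal B\langle X\rangle$ the $*$-algebra of non-commutative polynomials in $X=X^*$ over $\mathcal B$ ($X$ algebraically free from $\mathcal B$). $\Sigma_0$ is the set of unital, completely positive $\mathcal B$-bimodule maps $\mu:\mathcal B\langle X\rangle\to\mathcal B$ for which there is $M>0$ with $\|\mu(Xb_1X\cdots b_nX)\|\le M^{n+1}\|b_1\|\cdots\|b_n\|$ for all $n\ge 0$ and $b_i\in\mathcal B$ (exponentially bounded with constant $M$). For $\mu\in\Sigma_0$ and $n\in\mathbb N$ let $G^{(n)}_\mu(b)=(\mu\otimes 1_n)[(b-X\otimes 1_n)^{-1}]$ be its Cauchy transform on $H^+(M_n(\mathcal B))=\{b:\operatorname{Im}b>0\}$, i.e. the analytic map there that equals $\sum_{k\ge0}(\mu\otimes1_n)[(b^{-1}(X\otimes 1_n))^kb^{-1}]$ for small $\|b^{-1}\|$. A path $t\mapsto\mu_t\in\Sigma_0$, $t\in[0,1]$, is *differentiable* if for all $n$ and all $b\in H^+(M_n(\mathcal B))$ the map $t\mapsto G^{(n)}_{\mu_t}(b)$ is norm differentiable on $[0,1]$.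 For a linear map $\mu:\mathcal B\langle X\rangle\to\mathcal B$ and small $b\in\mathcal B$ put $$\psi_\mu(b)=\sum_{n\ge1}\mu((bX)^n),\qquad \widetilde\psi_\mu(b)=\sum_{n\ge0}\mu(X(bX)^n)\ \bigl(=b^{-1}\psi_\mu(b)\text{ for invertible }b\bigr),\qquad \varrho_\mu(b)=\sum_{n\ge1}\mu((Xb)^n),$$ $$\eta_\mu=\widetilde\psi_\mu(1+\psi_\mu)^{-1},\qquad \kappa_\mu=(1+\psi_\mu)^{-1}\psi_\mu,\qquad \rho_\mu=\varrho_\mu(1+\varrho_\mu)^{-1},$$ and, if $\mu(X)$ is invertible, let $S_\mu(w)=w^{-1}(1+w)\psi_\mu^{\langle-1\rangle}(w)$, where $\psi_\mu^{\langle -1\rangle}$ is the analytic inverse of $\psi_\mu$ around $0$ (extended analytically to non-invertible small $w$ as $(1+w)\,\widetilde\psi_\mu(\psi_\mu^{\langle-1\rangle}(w))^{-1}$), and $T_\mu(w)=S_\mu(w)^{-1}$. A prime denotes the Fréchet derivative, and $\partial F_t(b)$ the derivative of $t\mapsto F_t(b)$ on $[0,1]$. A $C^*$-operator-valued probability space $(\mathcal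 A,\mathcal B,E)$ is a unital $C^*$-algebra $\mathcal A$ containing $\mathcal B$ as a unital $C^*$-subalgebra with a unital completely positive $\mathcal B$-bimodule map $E:\mathcal A\to\mathcal B$; $x\sim\mu$ means that $\mu$ is the $\mathcal B$-valued distribution of $x$, i.e. $\mu(p)=E(p(x))$. Free independence over $\mathcal B$ of elements is that of the unital algebras they generate with $\mathcal B$; Boolean and monotone independence are those of the non-unital $\mathcal B$-bimodule algebras they generate. Monotone independence of an ordered pair $(a_1,a_2)$ means that, in products of elements of the two algebras, a factor from the algebra of $a_2$ all of whose (at most two) neighbours lie in that of $a_1$ may be replaced under $E$ by its expectation. **Theorem.** Let $\mu_t,\nu_t$ $(t\in[0,1])$ be differentiable paths in $\Sigma_0$ which are regular at the origin: each path is exponentially bounded with a constant independent of $t$, and for every $t\in[0,1]$ the derivatives $\partial\widetilde\psi_{\mu_t}(b)$, $\partial\widetilde\psi_{\nu_t}(b)$ exist for all $b$ in a neighbourhood of $0$. Then for every $t\in[0,1]$ all derivatives below exist and the formulas hold on a neighbourhood of the origin of $\mathcal B$. 1. (Free.) Suppose $\mu_t(X)$ and $\nu_t(X)$ are invertible for all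 $t$, and $\mu_t\boxtimes\nu_t$ is the distribution of $xy$, where $x\sim\mu_t$, $y\sim\nu_t$ are self-adjoint elements of a $C^*$-operator-valued probability space, free over $\mathcal B$, with $x\ge0$. With $s=S_{\nu_t}(w)$, $\partial s=\partial S_{\nu_t}(w)$, $q=T_{\nu_t}(w)$, $\partial q=\partial T_{\nu_t}(w)$, $$\partial S_{\mu_t\boxtimes\nu_t}(w)=\partial s\,S_{\mu_t}(s^{-1}ws)+s\,\partial S_{\mu_t}(s^{-1}ws)+s\,S_{\mu_t}'(s^{-1}ws)\bigl(s^{-1}w\,\partial s-s^{-1}\,\partial s\,s^{-1}ws\bigr),$$ $$\partial T_{\mu_t\boxtimes\nu_t}(w)=T_{\mu_t}(qwq^{-1})\,\partial q+\partial T_{\mu_t}(qwq^{-1})\,q+T_{\mu_t}'(qwq^{-1})\bigl(\partial q\,wq^{-1}-qwq^{-1}\,\partial q\,q^{-1}\bigr)\,q.$$ 2. (Boolean.) If $\tau_t$ is the distribution of $xy$, where $x\sim\mu_t$, $y\sim\nu_t$ are self-adjoint and $x-1$, $y-1$ are Boolean independent over $\mathcal B$, then $$\partial\eta_{\tau_t}(b)=\eta_{\mu_t}(b)\,\partial\eta_{\nu_t}(b)+\partial\eta_{\mu_t}(b)\,\eta_{\nu_t}(b).$$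 3. (Monotone.) Let $x\sim\mu_t$, $y\sim\nu_t$ be self-adjoint with $(x-1,y)$ monotone independent over $\mathcal B$. If $\sigma_t$ is the distribution of $yx$ and $\tau_t$ that of $xy$, then $$\partial\kappa_{\sigma_t}(b)=\kappa_{\mu_t}'(\kappa_{\nu_t}(b))\bigl(\partial\kappa_{\nu_t}(b)\bigr)+\partial\kappa_{\mu_t}(\kappa_{\nu_t}(b)),$$ $$\partial\rho_{\tau_t}(b)=\rho_{\mu_t}'(\rho_{\nu_t}(b))\bigl(\partial\rho_{\nu_t}(b)\bigr)+\partial\rho_{\mu_t}(\rho_{\nu_t}(b)).$$ -/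

import Mathlib

open Set Filter Topology
open scoped ComplexStarModule

universe u v

namespace OVP

noncomputable section

/-! ### The star-algebra `B⟨X⟩` of non-commutative polynomials with coefficients in `B` -/

/-- The relations that identify the letters `some b` of a free algebra with the elements of `B`;
the letter `none` is the indeterminate and satisfies no relation. -/
inductive NCRel (B : Type u) [CStarAlgebra B] :
    FreeAlgebra ℂ (Option B) → FreeAlgebra ℂ (Option B) → Prop
  | add (a b : B) : NCRel B (FreeAlgebra.ι ℂ (some (a + b)))
      (FreeAlgebra.ι ℂ (some a) + FreeAlgebra.ι ℂ (some b))
  | mul (a b : B) : NCRel B (FreeAlgebra.ι ℂ (some (a * b)))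
      (FreeAlgebra.ι ℂ (some a) * FreeAlgebra.ι ℂ (some b))
  | scalar (c : ℂ) : NCRel B (FreeAlgebra.ι ℂ (some (algebraMap ℂ B c)))
      (algebraMap ℂ (FreeAlgebra ℂ (Option B)) c)

/-- `B⟨X⟩`: the unital complex algebra generated by `B` and an indeterminate `X` that is
algebraically free from `B` (the free product of `B` and `ℂ[X]`). -/
def NCPoly (B : Type u) [CStarAlgebra B] : Type u := RingQuot (NCRel B)

instance (B : Type u) [CStarAlgebra B] : Ring (NCPoly B) :=
  inferInstanceAs (Ring (RingQuot (NCRel B)))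

instance (B : Type u) [CStarAlgebra B] : Algebra ℂ (NCPoly B) :=
  inferInstanceAs (Algebra ℂ (RingQuot (NCRel B)))

namespace NCPoly

/-- The quotient map from the free algebra. -/
def mk (B : Type u) [CStarAlgebra B] : FreeAlgebra ℂ (Option B) →ₐ[ℂ] NCPoly B :=
  RingQuot.mkAlgHom ℂ (NCRel B)

/-- The indeterminate. -/
def X (B : Type u) [CStarAlgebra B] : NCPoly B := mk B (FreeAlgebra.ι ℂ none)

/-- The inclusion of `B` into `B⟨X⟩`. -/
def C (B : Type u) [CStarAlgebra B] : B →ₐ[ℂ] NCPoly B :=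
  AlgHom.ofLinearMap
    { toFun := fun b => mk B (FreeAlgebra.ι ℂ (some b))
      map_add' := fun a b => by
        rw [← map_add]; exact RingQuot.mkAlgHom_rel ℂ (NCRel.add a b)
      map_smul' := fun c b => by
        rw [Algebra.smul_def c b, Algebra.smul_def]
        have h1 : mk B (FreeAlgebra.ι ℂ (some (algebraMap ℂ B c * b))) =
            mk B (FreeAlgebra.ι ℂ (some (algebraMap ℂ B c)) * FreeAlgebra.ι ℂ (some b)) :=
          RingQuot.mkAlgHom_rel ℂ (NCRel.mul _ _)
        have h2 : mk B (FreeAlgebra.ι ℂ (some (algebraMap ℂ B c))) =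
            mk B (algebraMap ℂ (FreeAlgebra ℂ (Option B)) c) :=
          RingQuot.mkAlgHom_rel ℂ (NCRel.scalar c)
        rw [h1, map_mul, h2, AlgHom.commutes]; rfl }
    (by
      have h2 : mk B (FreeAlgebra.ι ℂ (some (algebraMap ℂ B 1))) =
          mk B (algebraMap ℂ (FreeAlgebra ℂ (Option B)) 1) :=
        RingQuot.mkAlgHom_rel ℂ (NCRel.scalar 1)
      simpa using h2)
    (fun a b => by
      have h1 : mk B (FreeAlgebra.ι ℂ (some (a * b))) =
          mk B (FreeAlgebra.ι ℂ (some a) * FreeAlgebra.ι ℂ (some b)) :=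
        RingQuot.mkAlgHom_rel ℂ (NCRel.mul _ _)
      simpa using h1)

/-- Evaluation: the unital homomorphism `B⟨X⟩ → A` which is `f` on `B` and sends `X` to `a`. -/
def eval {B : Type u} [CStarAlgebra B] {A : Type v} [Ring A] [Algebra ℂ A]
    (f : B →ₐ[ℂ] A) (a : A) : NCPoly B →ₐ[ℂ] A :=
  RingQuot.liftAlgHom ℂ
    ⟨FreeAlgebra.lift ℂ (fun o : Option B => o.elim a f), by
      intro p q h
      cases h <;> simp⟩

theorem eval_mk {B : Type u} [CStarAlgebra B] {A : Type v} [Ring A] [Algebra ℂ A]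
    (f : B →ₐ[ℂ] A) (a : A) (p : FreeAlgebra ℂ (Option B)) :
    eval f a (mk B p) = FreeAlgebra.lift ℂ (fun o : Option B => o.elim a f) p :=
  RingQuot.liftAlgHom_mkAlgHom_apply ℂ _ _ p

theorem eval_C {B : Type u} [CStarAlgebra B] {A : Type v} [Ring A] [Algebra ℂ A]
    (f : B →ₐ[ℂ] A) (a : A) (b : B) : eval f a (C B b) = f b := by
  change eval f a (mk B (FreeAlgebra.ι ℂ (some b))) = f b
  rw [eval_mk]; simp

theorem eval_X {B : Type u} [CStarAlgebra B] {A : Type v} [Ring A] [Algebra ℂ A]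
    (f : B →ₐ[ℂ] A) (a : A) : eval f a (X B) = a := by
  change eval f a (mk B (FreeAlgebra.ι ℂ none)) = a
  rw [eval_mk]; simp

theorem induct {B : Type u} [CStarAlgebra B] {P : NCPoly B → Prop}
    (hC : ∀ b, P (C B b)) (hX : P (X B)) (hmul : ∀ p q, P p → P q → P (p * q))
    (hadd : ∀ p q, P p → P q → P (p + q)) (p : NCPoly B) : P p := by
  obtain ⟨q, rfl⟩ : ∃ q, mk B q = p := RingQuot.mkAlgHom_surjective ℂ (NCRel B) p
  induction q using FreeAlgebra.induction with
  | grade0 r =>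
    have := hC (algebraMap ℂ B r)
    rwa [AlgHom.commutes, ← AlgHom.commutes (mk B)] at this
  | grade1 x =>
    cases x with
    | none => exact hX
    | some b => exact hC b
  | mul a b ha hb => rw [map_mul]; exact hmul _ _ ha hb
  | add a b ha hb => rw [map_add]; exact hadd _ _ ha hb

/-- The opposite ring with conjugated scalars; it turns the antilinear antiautomorphism `*` into
a homomorphism of complex algebras. -/
def ConjOp (R : Type u) : Type u := Rᵐᵒᵖ

instance (R : Type u) [Ring R] : Ring (ConjOp R) := inferInstanceAs (Ring Rᵐᵒᵖ)

instance (R : Type u) [Ring R] [Algebra ℂ R] : Algebra ℂ (ConjOp R) :=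
  RingHom.toAlgebra' (S := ConjOp R)
    ((algebraMap ℂ Rᵐᵒᵖ).comp (starRingEnd ℂ) : ℂ →+* Rᵐᵒᵖ)
    (fun c x => Algebra.commutes (A := Rᵐᵒᵖ) (starRingEnd ℂ c) x)

/-- `b ↦ b*` on coefficients. -/
def starC (B : Type u) [CStarAlgebra B] : B →ₐ[ℂ] ConjOp (NCPoly B) where
  toFun b := (MulOpposite.op (C B (star b)) : (NCPoly B)ᵐᵒᵖ)
  map_one' := by simp; rfl
  map_mul' a b := by simp; rfl
  map_zero' := by simp; rfl
  map_add' a b := by simp; rfl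
  commutes' c := by
    rw [← algebraMap_star_comm, AlgHom.commutes]; rfl

/-- The star operation of `B⟨X⟩` as a homomorphism into the conjugate opposite. -/
def starHom (B : Type u) [CStarAlgebra B] : NCPoly B →ₐ[ℂ] ConjOp (NCPoly B) :=
  eval (starC B) (MulOpposite.op (X B) : (NCPoly B)ᵐᵒᵖ)

/-- The involution of `B⟨X⟩`: it extends that of `B`, and `X* = X`. -/
instance (B : Type u) [CStarAlgebra B] : Star (NCPoly B) where
  star p := MulOpposite.unop (starHom B p : (NCPoly B)ᵐᵒᵖ)

theorem star_C {B : Type u} [CStarAlgebra B] (b : B) : star (C B b) = C B (star b) :=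
  congrArg (MulOpposite.unop (α := NCPoly B)) (eval_C (starC B) _ b)

theorem star_X {B : Type u} [CStarAlgebra B] : star (X B) = X B :=
  congrArg (MulOpposite.unop (α := NCPoly B)) (eval_X (starC B) _)

theorem star_mul_aux {B : Type u} [CStarAlgebra B] (p q : NCPoly B) :
    star (p * q) = star q * star p := by
  change MulOpposite.unop (starHom B (p * q) : (NCPoly B)ᵐᵒᵖ) = _
  rw [map_mul]; rfl

theorem star_add_aux {B : Type u} [CStarAlgebra B] (p q : NCPoly B) :
    star (p + q) = star p + star q := by
  change MulOpposite.unop (starHom B (p + q) : (NCPoly B)ᵐᵒᵖ) = _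
  rw [map_add]; rfl

instance (B : Type u) [CStarAlgebra B] : StarRing (NCPoly B) where
  star_involutive p := by
    induction p using induct with
    | hC b => simp [star_C]
    | hX => simp [star_X]
    | hmul p q hp hq => rw [star_mul_aux, star_mul_aux, hp, hq]
    | hadd p q hp hq => rw [star_add_aux, star_add_aux, hp, hq]
  star_mul := star_mul_aux
  star_add := star_add_aux

/-- The monomial `X b₁ X b₂ X ⋯ bₙ X` (which is `X` for `n = 0`). -/
def word {B : Type u} [CStarAlgebra B] (l : List B) : NCPoly B :=
  X B * (l.map fun b => C B b * X B).prod

end NCPoly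

open NCPoly

/-! ### `B`-valued distributions -/

/-- `μ` belongs to `Σ`: it is a unital completely positive `B`-bimodule map `B⟨X⟩ → B`. -/
structure IsDistribution {B : Type u} [CStarAlgebra B] [PartialOrder B] [StarOrderedRing B]
    (μ : NCPoly B →ₗ[ℂ] B) : Prop where
  map_one : μ 1 = 1
  bimodule : ∀ (b c : B) (p : NCPoly B), μ (C B b * p * C B c) = b * μ p * c
  completely_positive : ∀ (n : ℕ) (p : Fin n → NCPoly B) (b : Fin n → B),
    0 ≤ ∑ i, ∑ j, star (b i) * μ (star (p i) * p j) * b j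

/-- `μ` is exponentially bounded with constant `M`. -/
def ExpBoundedBy {B : Type u} [CStarAlgebra B] (M : ℝ) (μ : NCPoly B →ₗ[ℂ] B) : Prop :=
  ∀ l : List B, ‖μ (word l)‖ ≤ M ^ (l.length + 1) * (l.map fun b => ‖b‖).prod

/-- `μ` belongs to `Σ₀`: it is an exponentially bounded distribution. -/
def IsBoundedDistribution {B : Type u} [CStarAlgebra B] [PartialOrder B] [StarOrderedRing B]
    (μ : NCPoly B →ₗ[ℂ] B) : Prop :=
  IsDistribution μ ∧ ∃ M > 0, ExpBoundedBy M μ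

/-! ### Cauchy transforms and differentiable paths -/

/-- The operator upper half plane `{b | Im b > 0}`: the imaginary part is positive and
invertible. -/
def upperHalf (D : Type u) [CStarAlgebra D] : Set D :=
  {b | ∀ r ∈ spectrum ℝ ((ℑ b : selfAdjoint D) : D), 0 < r}

/-- The `k`-th term `(μ ⊗ 1ₙ)[(b⁻¹ (X ⊗ 1ₙ))ᵏ b⁻¹]` of the expansion of the Cauchy transform,
with `c = b⁻¹`. -/
def cauchyTerm {B : Type u} [CStarAlgebra B] (n : ℕ) (μ : NCPoly B →ₗ[ℂ] B)
    (c : CStarMatrix (Fin n) (Fin n) B) (k : ℕ) : CStarMatrix (Fin n) (Fin n) B :=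
  CStarMatrix.ofMatrix
    ((((CStarMatrix.ofMatrix.symm c).map (C B) * Matrix.diagonal (fun _ => X B)) ^ k *
      (CStarMatrix.ofMatrix.symm c).map (C B)).map μ)

/-- `G` is the `n`-th level Cauchy transform `G_μ⁽ⁿ⁾(b) = (μ ⊗ 1ₙ)[(b - X ⊗ 1ₙ)⁻¹]` on
`H⁺(Mₙ(B))`: it is analytic there and has the expansion
`∑ₖ (μ ⊗ 1ₙ)[(b⁻¹ (X ⊗ 1ₙ))ᵏ b⁻¹]` where `‖b⁻¹‖` is small. As `H⁺(Mₙ(B))` is convex, these two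
conditions determine `G` on `H⁺(Mₙ(B))`. -/
def IsCauchyTransform {B : Type u} [CStarAlgebra B] [PartialOrder B] [StarOrderedRing B]
    (n : ℕ) (μ : NCPoly B →ₗ[ℂ] B)
    (G : CStarMatrix (Fin n) (Fin n) B → CStarMatrix (Fin n) (Fin n) B) : Prop :=
  DifferentiableOn ℂ G (upperHalf (CStarMatrix (Fin n) (Fin n) B)) ∧
  ∃ ε > 0, ∀ b ∈ upperHalf (CStarMatrix (Fin n) (Fin n) B), ‖Ring.inverse b‖ < ε →
    HasSum (cauchyTerm n μ (Ring.inverse b)) (G b)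

/-- `μ : [0,1] → Σ₀` is a differentiable path: at every matrix level `n`, the Cauchy transform
`t ↦ G⁽ⁿ⁾_{μ_t}(b)` is differentiable in norm on `[0,1]` for every `b ∈ H⁺(Mₙ(B))`.
(Only the values of `μ` on `[0,1]` matter.) -/
structure IsDifferentiablePath {B : Type u} [CStarAlgebra B] [PartialOrder B]
    [StarOrderedRing B] (μ : ℝ → NCPoly B →ₗ[ℂ] B) : Prop where
  bounded : ∀ t ∈ Icc (0 : ℝ) 1, IsBoundedDistribution (μ t)
  differentiable : ∀ n : ℕ,
    ∃ G : ℝ → CStarMatrix (Fin n) (Fin n) B → CStarMatrix (Fin n) (Fin n) B,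
      (∀ t ∈ Icc (0 : ℝ) 1, IsCauchyTransform n (μ t) (G t)) ∧
      ∀ t ∈ Icc (0 : ℝ) 1, ∀ b ∈ upperHalf (CStarMatrix (Fin n) (Fin n) B),
        DifferentiableWithinAt ℝ (fun s => G s b) (Icc 0 1) t

/-! ### Transforms

They are defined for every linear map `μ : B⟨X⟩ → B` through the expansions in powers of `X`. -/

section Transforms

variable {B : Type u} [CStarAlgebra B]

/-- `ψ_μ(b) = μ((1 - bX)⁻¹ - 1) = ∑_{n ≥ 1} μ((bX)ⁿ)`. -/
def psi (μ : NCPoly B →ₗ[ℂ] B) (b : B) : B := ∑' n : ℕ, μ ((C B b * X B) ^ (n + 1))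

/-- `ψ̃_μ(b) = b⁻¹ ψ_μ(b) = ∑_{n ≥ 0} μ(X (bX)ⁿ)`; the series also makes sense where `b` is not
invertible. -/
def psiTilde (μ : NCPoly B →ₗ[ℂ] B) (b : B) : B := ∑' n : ℕ, μ (X B * (C B b * X B) ^ n)

/-- `η_μ(b) = ψ̃_μ(b) (1 + ψ_μ(b))⁻¹`. -/
def eta (μ : NCPoly B →ₗ[ℂ] B) (b : B) : B := psiTilde μ b * Ring.inverse (psi μ b + 1)

/-- `ϑ_μ(b) = μ((1 - bX)⁻¹ bX)`. -/
def vartheta (μ : NCPoly B →ₗ[ℂ] B) (b : B) : B :=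
  ∑' n : ℕ, μ ((C B b * X B) ^ n * (C B b * X B))

/-- `κ_μ(b) = (1 + ϑ_μ(b))⁻¹ ϑ_μ(b)`. -/
def kappa (μ : NCPoly B →ₗ[ℂ] B) (b : B) : B :=
  Ring.inverse (1 + vartheta μ b) * vartheta μ b

/-- `ϱ_μ(b) = μ(Xb (1 - Xb)⁻¹)`. -/
def varrho (μ : NCPoly B →ₗ[ℂ] B) (b : B) : B :=
  ∑' n : ℕ, μ (X B * C B b * (X B * C B b) ^ n)

/-- `ρ_μ(b) = ϱ_μ(b) (1 + ϱ_μ(b))⁻¹`. -/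
def rho (μ : NCPoly B →ₗ[ℂ] B) (b : B) : B :=
  varrho μ b * Ring.inverse (1 + varrho μ b)

/-- `g` is an analytic right inverse of `ψ_μ` on the ball of radius `r`, with `g(0) = 0`. If
`μ(X)` is invertible, `ψ_μ` is invertible around `0`, so two such `g` agree on the smaller of the
two balls. -/
def IsPsiInverse (μ : NCPoly B →ₗ[ℂ] B) (r : ℝ) (g : B → B) : Prop :=
  DifferentiableOn ℂ g (Metric.ball 0 r) ∧ g 0 = 0 ∧ ∀ w ∈ Metric.ball (0 : B) r, psi μ (g w) = w

open Classical in
/-- The inverse `ψ_μ^{⟨-1⟩}` around the origin. -/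
def psiInv (μ : NCPoly B →ₗ[ℂ] B) (w : B) : B :=
  if h : ∃ p : ℝ × (B → B), IsPsiInverse μ p.1 p.2 ∧ ‖w‖ < p.1 then h.choose.2 w else 0

/-- The `S`-transform `S_μ(w) = w⁻¹ (1 + w) ψ_μ^{⟨-1⟩}(w)`. With `u = ψ_μ^{⟨-1⟩}(w)` one has
`w = u ψ̃_μ(u)`, hence `w⁻¹ u = ψ̃_μ(u)⁻¹`; this gives the analytic extension to all small `w`,
invertible or not. See `sTransform_eq`. -/
def sTransform (μ : NCPoly B →ₗ[ℂ] B) (w : B) : B :=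
  (1 + w) * Ring.inverse (psiTilde μ (psiInv μ w))

/-- The `T`-transform `T_μ(w) = S_μ(w)⁻¹`. -/
def tTransform (μ : NCPoly B →ₗ[ℂ] B) (w : B) : B := Ring.inverse (sTransform μ w)

/-- For invertible `w` the `S`-transform is given by the usual formula. -/
theorem sTransform_eq (μ : NCPoly B →ₗ[ℂ] B) (hμ : ∀ (b : B) p, μ (C B b * p) = b * μ p) (w : B)
    (hw : IsUnit w) (h : psi μ (psiInv μ w) = w)
    (hs : Summable fun n : ℕ => μ (X B * (C B (psiInv μ w) * X B) ^ n))
    (hu : IsUnit (psiTilde μ (psiInv μ w))) :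
    sTransform μ w = Ring.inverse w * (1 + w) * psiInv μ w := by
  have h1 : psi μ (psiInv μ w) = psiInv μ w * psiTilde μ (psiInv μ w) := by
    rw [psi, psiTilde, ← hs.tsum_mul_left]
    refine tsum_congr fun n => ?_
    rw [← hμ, pow_succ', mul_assoc]
  rw [h] at h1
  have h2 : psiInv μ w = w * Ring.inverse (psiTilde μ (psiInv μ w)) := by
    conv_rhs => rw [h1]
    rw [mul_assoc, ← h1, Ring.mul_inverse_cancel _ hu, mul_one]
  rw [sTransform]
  generalize Ring.inverse (psiTilde μ (psiInv μ w)) = z at h2 ⊢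
  have h3 : (1 + w) * (w * z) = w * ((1 + w) * z) := by noncomm_ring
  rw [h2, mul_assoc, h3, ← mul_assoc, Ring.inverse_mul_cancel _ hw, one_mul]

/-- The derivative in the path parameter, `∂F_t(b)`, over the interval `[0,1]`. -/
def pathDeriv (F : ℝ → B → B) (t : ℝ) (b : B) : B := derivWithin (fun s => F s b) (Icc 0 1) t

/-- `s ↦ F_s(b)` is differentiable at `t`, so that `∂F_t(b)` exists. -/
def PathDifferentiableAt (F : ℝ → B → B) (t : ℝ) (b : B) : Prop :=
  DifferentiableWithinAt ℝ (fun s => F s b) (Icc 0 1) t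

/-- The path is regular at the origin: its members are exponentially bounded with a common
constant, and the moment generating function `ψ̃_{μ_t}` has a derivative in `t` on a neighbourhood
of the origin. -/
structure IsRegularAtOrigin (μ : ℝ → NCPoly B →ₗ[ℂ] B) : Prop where
  bounded : ∃ M > 0, ∀ t ∈ Icc (0 : ℝ) 1, ExpBoundedBy M (μ t)
  differentiable : ∀ t ∈ Icc (0 : ℝ) 1, ∀ᶠ b in 𝓝 (0 : B),
    PathDifferentiableAt (fun s => psiTilde (μ s)) t b

end Transforms

/-! ### Operator-valued probability spaces and independence -/

/-- The structure of a `C*`-operator-valued probability space `(A, B, E)` on a unital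
`C*`-algebra `A`: a unital embedding of `B` into `A` (injective by `bimodule` and `unital`) and a
completely positive conditional expectation `E : A → B`. -/
structure OVSpace (A : Type v) (B : Type u) [CStarAlgebra A] [CStarAlgebra B] [PartialOrder B]
    [StarOrderedRing B] where
  incl : B →⋆ₐ[ℂ] A
  E : A →ₗ[ℂ] B
  unital : E 1 = 1
  bimodule : ∀ (b c : B) (a : A), E (incl b * a * incl c) = b * E a * c
  completely_positive : ∀ (n : ℕ) (a : Fin n → A) (b : Fin n → B),
    0 ≤ ∑ i, ∑ j, star (b i) * E (star (a i) * a j) * b j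

namespace OVSpace

variable {A : Type v} {B : Type u} [CStarAlgebra A] [CStarAlgebra B] [PartialOrder B]
  [StarOrderedRing B] (V : OVSpace A B)

/-- The `B`-valued distribution of `a`: the map `X b₁ X ⋯ bₙ X ↦ E(a b₁ a ⋯ bₙ a)`. -/
def dist (a : A) : NCPoly B →ₗ[ℂ] B :=
  V.E ∘ₗ (eval (V.incl : B →ₐ[ℂ] A) a).toLinearMap

/-- The unital algebra generated by `B` and `a`. -/
def unitalAlg (a : A) : Subalgebra ℂ A := Algebra.adjoin ℂ (insert a (range V.incl))

/-- The possibly non-unital `B`-bimodule algebra generated by `a`, the span of the products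
`b₀ a b₁ a ⋯ a bₙ` with `n ≥ 1`. -/
def bimoduleAlg (a : A) : NonUnitalSubalgebra ℂ A :=
  NonUnitalAlgebra.adjoin ℂ {z | ∃ b c : B, z = V.incl b * a * V.incl c}

/-- Free independence over `B` of a family of subalgebras that contain `B`. A list
`[(i₁, a₁), …, (iₙ, aₙ)]` encodes the elements `a_j ∈ S i_j`. -/
def Free {I : Type*} (S : I → Subalgebra ℂ A) : Prop :=
  (∀ i b, V.incl b ∈ S i) ∧
  ∀ l : List (I × A), l ≠ [] → (∀ p ∈ l, p.2 ∈ S p.1 ∧ V.E p.2 = 0) →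
    (l.map Prod.fst).IsChain (· ≠ ·) → V.E (l.map Prod.snd).prod = 0

/-- Boolean independence over `B` of a family of `B`-bimodule subalgebras. -/
def BooleanIndep {I : Type*} (S : I → NonUnitalSubalgebra ℂ A) : Prop :=
  ∀ l : List (I × A), l ≠ [] → (∀ p ∈ l, p.2 ∈ S p.1) →
    (l.map Prod.fst).IsChain (· ≠ ·) →
    V.E (l.map Prod.snd).prod = (l.map fun p => V.E p.2).prod

/-- Monotone independence over `B` of an ordered family of `B`-bimodule subalgebras: a factor
whose index is a strict local maximum may be replaced by its expectation. -/
def MonotoneIndep {I : Type*} [LinearOrder I] (S : I → NonUnitalSubalgebra ℂ A) : Prop :=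
  ∀ (l₁ l₂ : List (I × A)) (i : I) (a : A), a ∈ S i →
    (∀ p ∈ l₁, p.2 ∈ S p.1) → (∀ p ∈ l₂, p.2 ∈ S p.1) →
    (∀ p ∈ l₁.getLast?, p.1 < i) → (∀ p ∈ l₂.head?, p.1 < i) →
    V.E ((l₁.map Prod.snd).prod * a * (l₂.map Prod.snd).prod) =
      V.E ((l₁.map Prod.snd).prod * V.incl (V.E a) * (l₂.map Prod.snd).prod)

end OVSpace

/-! ### Multiplicative convolutions -/

section Convolutions

variable {B : Type u} [CStarAlgebra B] [PartialOrder B] [StarOrderedRing B]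

/-- `τ = μ ⊠ ν`: the distribution of `xy`, where `x ∼ μ` and `y ∼ ν` are self-adjoint and free
over `B`, and `x ≥ 0`. -/
def IsFreeConv (μ ν τ : NCPoly B →ₗ[ℂ] B) : Prop :=
  ∃ (A : Type v) (_ : CStarAlgebra A) (_ : PartialOrder A) (_ : StarOrderedRing A)
    (V : OVSpace A B) (x y : A), 0 ≤ x ∧ IsSelfAdjoint y ∧ V.dist x = μ ∧ V.dist y = ν ∧
      V.Free ![V.unitalAlg x, V.unitalAlg y] ∧ τ = V.dist (x * y)

/-- The Boolean multiplicative convolution of `μ` and `ν` is `τ`: the distribution of `xy`, where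
`x ∼ μ` and `y ∼ ν` are self-adjoint and `x - 1`, `y - 1` are Boolean independent over `B`. -/
def IsBooleanConv (μ ν τ : NCPoly B →ₗ[ℂ] B) : Prop :=
  ∃ (A : Type v) (_ : CStarAlgebra A) (V : OVSpace A B) (x y : A),
    IsSelfAdjoint x ∧ IsSelfAdjoint y ∧ V.dist x = μ ∧ V.dist y = ν ∧
      V.BooleanIndep ![V.bimoduleAlg (x - 1), V.bimoduleAlg (y - 1)] ∧ τ = V.dist (x * y)

/-- `τ = μ ↻ ν`: the distribution of `xy`, where `x ∼ μ` and `y ∼ ν` are self-adjoint and the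
ordered pair `x - 1`, `y` is monotone independent over `B`. -/
def IsMonotoneConv (μ ν τ : NCPoly B →ₗ[ℂ] B) : Prop :=
  ∃ (A : Type v) (_ : CStarAlgebra A) (V : OVSpace A B) (x y : A),
    IsSelfAdjoint x ∧ IsSelfAdjoint y ∧ V.dist x = μ ∧ V.dist y = ν ∧
      V.MonotoneIndep ![V.bimoduleAlg (x - 1), V.bimoduleAlg y] ∧ τ = V.dist (x * y)

/-- The monotone convolution with the factors in the other order: `τ` is the distribution of
`yx`, where `x ∼ μ` and `y ∼ ν` are self-adjoint and the ordered pair `x - 1`, `y` is monotone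
independent over `B`. -/
def IsMonotoneConvRev (μ ν τ : NCPoly B →ₗ[ℂ] B) : Prop :=
  ∃ (A : Type v) (_ : CStarAlgebra A) (V : OVSpace A B) (x y : A),
    IsSelfAdjoint x ∧ IsSelfAdjoint y ∧ V.dist x = μ ∧ V.dist y = ν ∧
      V.MonotoneIndep ![V.bimoduleAlg (x - 1), V.bimoduleAlg y] ∧ τ = V.dist (y * x)

end Convolutions

end

end OVP

open OVP

/-! For each fixed parameter the convolutions satisfy exact product formulas: `S_τ(w) = S_ν(w)
S_μ(S_ν(w)⁻¹ w S_ν(w))` in the free case, `η_τ = η_μ η_ν` in the Boolean case, and `κ_τ = κ_μ ∘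
κ_ν`, `ρ_τ = ρ_μ ∘ ρ_ν` in the monotone cases. The theorem is the derivative of these identities in
the parameter. Three points need proof.

Product formulas. The resolvent of the product is factored as `(r + y)(1 - p q)⁻¹(1 + p)`, or a
one-sided analogue, with `p`, `q`, `y` in the closed algebras of the two variables
(`boolean_resolvent`, `free_resolvent`). Its geometric series consists of alternating words, whose
expectations are dictated by independence: all centred words vanish in the free case, expectations
factor in the Boolean case, and the upper variable is replaced by its mean in the monotone case.
This gives `BooleanIndep.psi_mul`, `MonotoneIndep.psi_mul` and `Free.psi_mul`. The formula for `ρ`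
follows from that for `κ` by taking adjoints.

Calculus in the parameter. The moment series are differentiable in `t` only pointwise, but they are
holomorphic and bounded on a ball that does not depend on `t`. Cauchy estimates then bound the
Taylor remainders uniformly in the parameter. Consequently families of this kind (`PathRegularAt`)
obey the chain rule `PathRegularAt.hasDerivWithinAt_comp` and are closed under products, inverses,
composition and the local inversion `PathRegularAt.exists_inverse_id_mul`. The last one provides
`ψ⁻¹`, and with it the `S`-transform.

Uniform neighbourhoods. The variables realising `τ_s` may change with `s`, so each product formula
is at first known only on a neighbourhood of `0` depending on `s`, which is useless for
differentiation in `s`. However, the candidate for the moment series of `τ_s`, built from `μ_s` and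
`ν_s`, is holomorphic on a fixed ball. Since the moments of `τ_s` are homogeneous in `b`, they are
the Taylor coefficients of the candidate on complex lines through `0`, and the series converges to
it on the whole fixed ball (`hasSum_of_eventually_hasSum`, `eventually_hasSum_pathNhds`). Identities
obtained by cancelling a factor `b` hold first for invertible `b` and extend by
`eventuallyEq_of_eq_on_units`. -/

namespace OVP

noncomputable section

open NCPoly

/-! ### Families of holomorphic maps over the interval `[0,1]` -/

section PathNhds

variable {E : Type*} [NormedAddCommGroup E]

/-- The neighbourhoods of `(t, b)` in `[0,1] × E`. -/
abbrev pathNhds (t : ℝ) (b : E) : Filter (ℝ × E) := 𝓝[Icc 0 1] t ×ˢ 𝓝 b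

theorem eventually_pathNhds_iff {t : ℝ} {b : E} {P : ℝ × E → Prop} :
    (∀ᶠ p in pathNhds t b, P p) ↔
      ∃ r > 0, ∀ᶠ s in 𝓝[Icc 0 1] t, ∀ x ∈ Metric.ball b r, P (s, x) := by
  constructor
  · intro h
    obtain ⟨pa, ha, pb, hb, hab⟩ := eventually_prod_iff.1 h
    obtain ⟨r, hr, hb⟩ := Metric.eventually_nhds_iff_ball.1 hb
    exact ⟨r, hr, ha.mono fun s hs x hx => hab hs (hb x hx)⟩
  · rintro ⟨r, hr, h⟩
    exact eventually_prod_iff.2 ⟨_, h, fun x => x ∈ Metric.ball b r, Metric.ball_mem_nhds b hr,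
      fun {s} hs {x} hx => hs x hx⟩

theorem eventually_of_pathNhds {t : ℝ} (ht : t ∈ Icc (0 : ℝ) 1) {b : E} {P : ℝ × E → Prop}
    (h : ∀ᶠ p in pathNhds t b, P p) : ∀ᶠ x in 𝓝 b, P (t, x) ∧ ∀ᶠ s in 𝓝[Icc 0 1] t, P (s, x) := by
  obtain ⟨r, hr, h⟩ := eventually_pathNhds_iff.1 h
  filter_upwards [Metric.ball_mem_nhds b hr] with x hx
  exact ⟨h.self_of_nhdsWithin ht x hx, h.mono fun s hs => hs x hx⟩

theorem eventually_pathNhds_of_nhds {t : ℝ} {b : E} {P : E → Prop} (h : ∀ᶠ x in 𝓝 b, P x) :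
    ∀ᶠ p in pathNhds t b, P p.2 := tendsto_snd.eventually h

theorem eventually_pathNhds_of_nhdsWithin {t : ℝ} {b : E} {P : ℝ → Prop}
    (h : ∀ᶠ s in 𝓝[Icc 0 1] t, P s) : ∀ᶠ p in pathNhds t b, P p.1 := tendsto_fst.eventually h

end PathNhds

section PathRegular

variable {E F G : Type*} [NormedAddCommGroup E] [NormedSpace ℂ E] [NormedAddCommGroup F]
  [NormedSpace ℂ F] [NormedAddCommGroup G] [NormedSpace ℂ G]

/-- The family `f s` is holomorphic and bounded on a neighbourhood of `b`, uniformly for `s ∈ [0,1]`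
near `t`, and is differentiable in the parameter at `t`. -/
structure PathRegularAt (f : ℝ → E → F) (t : ℝ) (b : E) : Prop where
  differentiableAt : ∀ᶠ p in pathNhds t b, DifferentiableAt ℂ (f p.1) p.2
  bounded : ∃ K : ℝ, ∀ᶠ p in pathNhds t b, ‖f p.1 p.2‖ ≤ K
  path : ∀ᶠ x in 𝓝 b, DifferentiableWithinAt ℝ (fun s => f s x) (Icc 0 1) t

/-- Schwarz lemmas: the bound `K` forces `f` to map the ball into the closed ball of radius `2K`
about `f u`. The constants depend only on `K` and `r`, so they are uniform over any family sharing
these. -/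
theorem taylor_estimate {f : E → F} {u : E} {r K : ℝ} (hr : 0 < r)
    (hd : DifferentiableOn ℂ f (Metric.ball u r)) (hb : ∀ x ∈ Metric.ball u r, ‖f x‖ ≤ K) :
    ‖fderiv ℂ f u‖ ≤ 2 * K / r ∧ ∀ x ∈ Metric.ball u r,
      ‖f x - f u‖ ≤ 2 * K / r * ‖x - u‖ ∧
      ‖f x - f u - fderiv ℂ f u (x - u)‖ ≤ 4 * K / r ^ 2 * ‖x - u‖ ^ 2 := by
  have hu : u ∈ Metric.ball u r := Metric.mem_ball_self hr
  have hmaps : MapsTo f (Metric.ball u r) (Metric.closedBall (f u) (2 * K)) := by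
    intro x hx
    rw [mem_closedBall_iff_norm]
    linarith [norm_sub_le (f x) (f u), hb x hx, hb u hu]
  have h1 := Complex.norm_fderiv_le_div_of_mapsTo_ball hd hmaps hr
  refine ⟨h1, fun x hx => ⟨?_, ?_⟩⟩
  · simpa [dist_eq_norm] using Complex.dist_le_div_mul_dist_of_mapsTo_ball hd hmaps hx
  · have hdu : DifferentiableAt ℂ f u := hd.differentiableAt (Metric.ball_mem_nhds u hr)
    -- With the linear part removed, `g - g u` vanishes to second order at `u`, so the higher-order
    -- Schwarz lemma yields the quadratic bound. The linear part itself is at most `2K` on the ball,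
    -- whence `4K`.
    set g : E → F := fun x => f x - fderiv ℂ f u (x - u) with hg
    have hgu : g u = f u := by simp [hg]
    have hgd : DifferentiableOn ℂ g (Metric.ball u r) := by
      refine hd.sub ?_
      exact ((fderiv ℂ f u).differentiable.comp
        (differentiable_id.sub_const u)).differentiableOn
    have hgm : MapsTo g (Metric.ball u r) (Metric.closedBall (g u) (4 * K)) := by
      intro y hy
      rw [mem_closedBall_iff_norm, hgu]
      have h2 : ‖fderiv ℂ f u (y - u)‖ ≤ 2 * K := by
        refine ((fderiv ℂ f u).le_opNorm _).trans ?_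
        have hy' : ‖y - u‖ ≤ r := (mem_ball_iff_norm.1 hy).le
        calc _ ≤ 2 * K / r * r := by
              gcongr
              exact (norm_nonneg _).trans h1
          _ = 2 * K := by field_simp
      have h3 : g y - f u = f y - f u - fderiv ℂ f u (y - u) := by simp only [hg]; abel
      rw [h3]
      linarith [norm_sub_le (f y - f u) (fderiv ℂ f u (y - u)), norm_sub_le (f y) (f u),
        hb y hy, hb u hu]
    have hlo : (fun x => g x - g u) =o[𝓝 u] (fun w => ‖w - u‖ ^ 1) := by
      have := hdu.hasFDerivAt.isLittleO
      simp only [pow_one]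
      refine (this.norm_right).congr_left fun x => ?_
      rw [hgu]; simp only [hg]; abel
    have := Complex.dist_le_mul_div_pow_of_mapsTo_ball_of_isLittleO hgd hgm hlo hx
    rw [dist_eq_norm, hgu, dist_eq_norm] at this
    calc _ = ‖g x - f u‖ := by simp only [hg]; congr 1; abel
      _ ≤ _ := this
      _ = _ := by rw [div_pow]; ring

namespace PathRegularAt

variable {f : ℝ → E → F} {t : ℝ} {b : E}

theorem eventually_nhds (hf : PathRegularAt f t b) : ∀ᶠ x in 𝓝 b, PathRegularAt f t x := by
  obtain ⟨r, hr, h1⟩ := eventually_pathNhds_iff.1 hf.differentiableAt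
  obtain ⟨K, hK⟩ := hf.bounded
  obtain ⟨r', hr', h2⟩ := eventually_pathNhds_iff.1 hK
  filter_upwards [hf.path.eventually_nhds, Metric.ball_mem_nhds b hr,
    Metric.ball_mem_nhds b hr'] with x hx hxr hxr'
  refine ⟨?_, ⟨K, ?_⟩, hx⟩
  · exact eventually_prod_iff.2 ⟨_, h1, fun y => y ∈ Metric.ball b r,
      Metric.isOpen_ball.mem_nhds hxr, fun {s} hs {y} hy => hs y hy⟩
  · exact eventually_prod_iff.2 ⟨_, h2, fun y => y ∈ Metric.ball b r',
      Metric.isOpen_ball.mem_nhds hxr', fun {s} hs {y} hy => hs y hy⟩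

theorem exists_ball (hf : PathRegularAt f t b) : ∃ r > 0, ∃ K > 0,
    (∀ᶠ s in 𝓝[Icc 0 1] t, DifferentiableOn ℂ (f s) (Metric.ball b r) ∧
      ∀ x ∈ Metric.ball b r, ‖f s x‖ ≤ K) ∧
    ∀ x ∈ Metric.ball b r, DifferentiableWithinAt ℝ (fun s => f s x) (Icc 0 1) t := by
  obtain ⟨r₁, hr₁, h1⟩ := eventually_pathNhds_iff.1 hf.differentiableAt
  obtain ⟨K, hK⟩ := hf.bounded
  obtain ⟨r₂, hr₂, h2⟩ := eventually_pathNhds_iff.1 hK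
  obtain ⟨r₃, hr₃, h3⟩ := Metric.eventually_nhds_iff_ball.1 hf.path
  refine ⟨min r₁ (min r₂ r₃), by positivity, max K 1, by positivity, ?_, fun x hx => h3 x ?_⟩
  · filter_upwards [h1, h2] with s hs1 hs2
    refine ⟨fun x hx => (hs1 x ?_).differentiableWithinAt, fun x hx =>
      (hs2 x ?_).trans (le_max_left _ _)⟩
    · exact Metric.ball_subset_ball (min_le_left _ _) hx
    · exact Metric.ball_subset_ball ((min_le_right _ _).trans (min_le_left _ _)) hx
  · exact Metric.ball_subset_ball ((min_le_right _ _).trans (min_le_right _ _)) hx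

theorem of_ball {r K : ℝ} (hr : 0 < r)
    (h : ∀ᶠ s in 𝓝[Icc 0 1] t, DifferentiableOn ℂ (f s) (Metric.ball b r) ∧
      ∀ x ∈ Metric.ball b r, ‖f s x‖ ≤ K)
    (h' : ∀ᶠ x in 𝓝 b, DifferentiableWithinAt ℝ (fun s => f s x) (Icc 0 1) t) :
    PathRegularAt f t b :=
  ⟨eventually_pathNhds_iff.2 ⟨r, hr, h.mono fun _ hs _ hx =>
      hs.1.differentiableAt (Metric.isOpen_ball.mem_nhds hx)⟩,
    ⟨K, eventually_pathNhds_iff.2 ⟨r, hr, h.mono fun _ hs => hs.2⟩⟩, h'⟩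

/-- Uniform Taylor estimates around points close to `b`. -/
theorem exists_taylor (hf : PathRegularAt f t b) : ∃ r > 0, ∃ C > 0,
    ∀ᶠ s in 𝓝[Icc 0 1] t, ∀ u ∈ Metric.ball b r, ‖fderiv ℂ (f s) u‖ ≤ C ∧
      DifferentiableAt ℂ (f s) u ∧ ∀ x ∈ Metric.ball b r,
      ‖f s x - f s u‖ ≤ C * ‖x - u‖ ∧
      ‖f s x - f s u - fderiv ℂ (f s) u (x - u)‖ ≤ C * ‖x - u‖ ^ 2 := by
  obtain ⟨r, hr, K, hK, h, -⟩ := hf.exists_ball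
  -- For `u` within `r / 3` of `b`, the ball of radius `2r / 3` about `u` stays inside the ball of
  -- radius `r` about `b` and still contains the ball of radius `r / 3` about `b`.
  refine ⟨r / 3, by positivity, max (2 * K / (2 * r / 3)) (4 * K / (2 * r / 3) ^ 2),
    by positivity, ?_⟩
  filter_upwards [h] with s hs u hu
  have hsub : Metric.ball u (2 * r / 3) ⊆ Metric.ball b r := by
    refine Metric.ball_subset_ball' ?_
    have := Metric.mem_ball.1 hu
    linarith
  obtain ⟨h1, h2⟩ := taylor_estimate (by positivity : 0 < 2 * r / 3) (hs.1.mono hsub)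
    fun x hx => hs.2 x (hsub hx)
  refine ⟨h1.trans (le_max_left _ _), hs.1.differentiableAt (Metric.isOpen_ball.mem_nhds
    (Metric.ball_subset_ball (by linarith) hu)), fun x hx => ?_⟩
  have hxu : x ∈ Metric.ball u (2 * r / 3) := by
    rw [Metric.mem_ball] at *
    linarith [dist_triangle_right x u b]
  obtain ⟨h3, h4⟩ := h2 x hxu
  refine ⟨h3.trans ?_, h4.trans ?_⟩
  · gcongr; exact le_max_left _ _
  · gcongr; exact le_max_right _ _

theorem tendsto_path (hf : PathRegularAt f t b) :
    ∀ᶠ x in 𝓝 b, Tendsto (fun s => f s x) (𝓝[Icc 0 1] t) (𝓝 (f t x)) :=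
  hf.path.mono fun _ hx => hx.continuousWithinAt

/-- The Lipschitz constants of the `f s` are uniform in `s`, which upgrades continuity in `s` at the
single point `b` to joint continuity. -/
theorem tendsto (hf : PathRegularAt f t b) :
    Tendsto (fun p : ℝ × E => f p.1 p.2) (pathNhds t b) (𝓝 (f t b)) := by
  obtain ⟨r, hr, C, hC, h⟩ := hf.exists_taylor
  have h1 : Tendsto (fun p : ℝ × E => f p.1 b) (pathNhds t b) (𝓝 (f t b)) :=
    hf.tendsto_path.self_of_nhds.comp tendsto_fst
  have h2 : Tendsto (fun p : ℝ × E => f p.1 p.2 - f p.1 b) (pathNhds t b) (𝓝 0) := by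
    have h3 : Tendsto (fun p : ℝ × E => C * ‖p.2 - b‖) (pathNhds t b) (𝓝 0) := by
      have : Tendsto (fun x : E => C * ‖x - b‖) (𝓝 b) (𝓝 (C * ‖b - b‖)) :=
        Continuous.tendsto (by fun_prop) b
      simp only [sub_self, norm_zero, mul_zero] at this
      exact this.comp tendsto_snd
    refine squeeze_zero_norm' ?_ h3
    refine eventually_pathNhds_iff.2 ⟨r, hr, h.mono fun s hs x hx => ?_⟩
    exact ((hs b (Metric.mem_ball_self hr)).2.2 x hx).1
  simpa using h2.add h1

/-- Difference quotients approximate the derivative with an error uniform in `s`, and each quotient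
converges as `s → t`. The convergence is obtained direction by direction, which is all the chain
rule uses. -/
theorem tendsto_fderiv (hf : PathRegularAt f t b) (ht : t ∈ Icc (0 : ℝ) 1) (v : E) :
    Tendsto (fun s => fderiv ℂ (f s) b v) (𝓝[Icc 0 1] t) (𝓝 (fderiv ℂ (f t) b v)) := by
  obtain ⟨r, hr, C, hC, h⟩ := hf.exists_taylor
  rw [Metric.tendsto_nhds]
  intro ε hε
  -- The step `d` is fixed before `s` moves: the two Taylor errors then cost less than `ε / 4` each,
  -- and the difference of the two quotients less than `ε / 2` for `s` near `t`.
  have h0 : ∀ᶠ d : ℝ in 𝓝[>] 0, b + (d : ℂ) • v ∈ Metric.ball b r ∧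
      C * d * ‖v‖ ^ 2 < ε / 4 ∧
      Tendsto (fun s => f s (b + (d : ℂ) • v)) (𝓝[Icc 0 1] t) (𝓝 (f t (b + (d : ℂ) • v))) := by
    have hc : Tendsto (fun d : ℝ => b + (d : ℂ) • v) (𝓝[>] 0) (𝓝 b) := by
      have : Tendsto (fun d : ℝ => b + (d : ℂ) • v) (𝓝 0) (𝓝 (b + ((0 : ℝ) : ℂ) • v)) :=
        Continuous.tendsto (by fun_prop) 0
      simp only [Complex.ofReal_zero, zero_smul, add_zero] at this
      exact this.mono_left nhdsWithin_le_nhds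
    have hc' : Tendsto (fun d : ℝ => C * d * ‖v‖ ^ 2) (𝓝[>] 0) (𝓝 0) := by
      have : Tendsto (fun d : ℝ => C * d * ‖v‖ ^ 2) (𝓝 0) (𝓝 (C * 0 * ‖v‖ ^ 2)) :=
        Continuous.tendsto (by fun_prop) 0
      simp only [mul_zero, zero_mul] at this
      exact this.mono_left nhdsWithin_le_nhds
    exact (hc.eventually (Metric.ball_mem_nhds b hr)).and
      ((hc'.eventually (gt_mem_nhds (by positivity))).and (hc.eventually hf.tendsto_path))
  obtain ⟨d, ⟨hd1, hd2, hd3⟩, hd0⟩ := (h0.and self_mem_nhdsWithin).exists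
  have hd0 : 0 < d := hd0
  have hq := Metric.tendsto_nhds.1 (hd3.sub hf.tendsto_path.self_of_nhds) (d * (ε / 2))
    (by positivity)
  filter_upwards [hq, h] with s hs1 hs2
  have e1 := ((hs2 b (Metric.mem_ball_self hr)).2.2 _ hd1).2
  have e2 := (((h.self_of_nhdsWithin ht) b (Metric.mem_ball_self hr)).2.2 _ hd1).2
  rw [dist_eq_norm] at hs1 ⊢
  simp only [add_sub_cancel_left, map_smul, norm_smul, Complex.norm_real, Real.norm_eq_abs,
    abs_of_pos hd0] at e1 e2
  set p := f s (b + (d : ℂ) • v) - f s b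
  set q := f t (b + (d : ℂ) • v) - f t b
  have key : (d : ℂ) • (fderiv ℂ (f s) b v - fderiv ℂ (f t) b v) =
      (p - q) - (p - (d : ℂ) • fderiv ℂ (f s) b v) + (q - (d : ℂ) • fderiv ℂ (f t) b v) := by
    rw [smul_sub]; abel
  have key2 : d * ‖fderiv ℂ (f s) b v - fderiv ℂ (f t) b v‖ < d * ε := by
    have : d * ‖fderiv ℂ (f s) b v - fderiv ℂ (f t) b v‖ =
        ‖(d : ℂ) • (fderiv ℂ (f s) b v - fderiv ℂ (f t) b v)‖ := by
      rw [norm_smul, Complex.norm_real, Real.norm_eq_abs, abs_of_pos hd0]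
    rw [this, key]
    have hA := norm_add_le ((p - q) - (p - (d : ℂ) • fderiv ℂ (f s) b v))
      (q - (d : ℂ) • fderiv ℂ (f t) b v)
    have hB := norm_sub_le (p - q) (p - (d : ℂ) • fderiv ℂ (f s) b v)
    have hC' : C * (d * ‖v‖) ^ 2 < d * (ε / 4) := by
      calc C * (d * ‖v‖) ^ 2 = d * (C * d * ‖v‖ ^ 2) := by ring
        _ < _ := by gcongr
    linarith
  exact lt_of_mul_lt_mul_left key2 hd0.le

/-- The chain rule for a family of maps along a differentiable curve. -/
theorem hasDerivWithinAt_comp {c : ℝ → E} {v : E} (hf : PathRegularAt f t (c t))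
    (ht : t ∈ Icc (0 : ℝ) 1) (hc : HasDerivWithinAt c v (Icc 0 1) t) :
    HasDerivWithinAt (fun s => f s (c s))
      (fderiv ℂ (f t) (c t) v + derivWithin (fun s => f s (c t)) (Icc 0 1) t) (Icc 0 1) t := by
  obtain ⟨r, hr, C, hC, h⟩ := hf.exists_taylor
  have hu : c t ∈ Metric.ball (c t) r := Metric.mem_ball_self hr
  have hpath := hf.path.self_of_nhds.hasDerivWithinAt
  have hcc : Tendsto c (𝓝[Icc 0 1] t) (𝓝 (c t)) := hc.continuousWithinAt
  rw [hasDerivWithinAt_iff_isLittleO] at hpath hc ⊢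
  have hO : (fun s => c s - c t) =O[𝓝[Icc 0 1] t] fun s => s - t := by
    have h2 : (fun s => (s - t) • v) =O[𝓝[Icc 0 1] t] fun s => s - t :=
      Asymptotics.isBigO_of_le' (c := ‖v‖) _ fun s => by rw [norm_smul, mul_comm]
    refine (hc.isBigO.add h2).congr_left fun s => ?_
    abel
  have hst : Tendsto (fun s : ℝ => s - t) (𝓝[Icc 0 1] t) (𝓝 0) := by
    have : Tendsto (fun s : ℝ => s - t) (𝓝 t) (𝓝 (t - t)) := Continuous.tendsto (by fun_prop) t
    rw [sub_self] at this
    exact this.mono_left nhdsWithin_le_nhds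
  -- The error in the chain rule is a sum of four terms: the quadratic Taylor remainder of `f s`
  -- (`t1`), the derivative of `f s` applied to the remainder of `c` (`t2`), the change of the
  -- derivative in the direction `v` (`t3`), and the remainder of `s ↦ f s (c t)` (`hpath`).
  have t1 : (fun s => f s (c s) - f s (c t) - fderiv ℂ (f s) (c t) (c s - c t))
      =o[𝓝[Icc 0 1] t] fun s => s - t := by
    have h1 : (fun s => f s (c s) - f s (c t) - fderiv ℂ (f s) (c t) (c s - c t))
        =O[𝓝[Icc 0 1] t] fun s => ‖c s - c t‖ ^ 2 := by
      refine Asymptotics.IsBigO.of_bound C ?_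
      filter_upwards [h, hcc.eventually (Metric.ball_mem_nhds _ hr)] with s hs hs'
      simpa using ((hs _ hu).2.2 _ hs').2
    refine h1.trans_isLittleO ((hO.norm_left.pow 2).trans_isLittleO ?_)
    simp only [pow_two]
    have := (Asymptotics.isLittleO_one_iff ℝ).2 hst
    simpa using this.mul_isBigO (Asymptotics.isBigO_refl (fun s : ℝ => s - t) _)
  have t2 : (fun s => fderiv ℂ (f s) (c t) (c s - c t - (s - t) • v))
      =o[𝓝[Icc 0 1] t] fun s => s - t := by
    refine Asymptotics.IsBigO.trans_isLittleO ?_ hc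
    refine Asymptotics.IsBigO.of_bound C ?_
    filter_upwards [h] with s hs
    refine ((fderiv ℂ (f s) (c t)).le_opNorm _).trans ?_
    gcongr
    exact (hs _ hu).1
  have t3 : (fun s => (s - t) • (fderiv ℂ (f s) (c t) v - fderiv ℂ (f t) (c t) v))
      =o[𝓝[Icc 0 1] t] fun s => s - t := by
    have h1 : Tendsto (fun s => fderiv ℂ (f s) (c t) v - fderiv ℂ (f t) (c t) v)
        (𝓝[Icc 0 1] t) (𝓝 0) := by
      simpa using (hf.tendsto_fderiv ht v).sub_const (fderiv ℂ (f t) (c t) v)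
    have := (Asymptotics.isBigO_refl (fun s : ℝ => s - t) (𝓝[Icc 0 1] t)).smul_isLittleO
      ((Asymptotics.isLittleO_one_iff ℝ).2 h1)
    simpa using this
  refine ((t1.add t2).add (t3.add hpath)).congr_left fun s => ?_
  have e : fderiv ℂ (f s) (c t) (c s - c t - (s - t) • v) =
      fderiv ℂ (f s) (c t) (c s - c t) - (s - t) • fderiv ℂ (f s) (c t) v := by
    rw [map_sub, ← Complex.coe_smul (s - t) v, map_smul, Complex.coe_smul]
  rw [e, smul_sub, smul_add]
  abel

theorem congr {g : ℝ → E → F} (hf : PathRegularAt f t b) (ht : t ∈ Icc (0 : ℝ) 1)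
    (h : ∀ᶠ p in pathNhds t b, g p.1 p.2 = f p.1 p.2) : PathRegularAt g t b := by
  obtain ⟨K, hK⟩ := hf.bounded
  refine ⟨?_, ⟨K, ?_⟩, ?_⟩
  · obtain ⟨r, hr, h⟩ := eventually_pathNhds_iff.1 h
    obtain ⟨r', hr', h'⟩ := eventually_pathNhds_iff.1 hf.differentiableAt
    refine eventually_pathNhds_iff.2 ⟨min r r', by positivity, ?_⟩
    filter_upwards [h, h'] with s hs hs' x hx
    refine (hs' x (Metric.ball_subset_ball (min_le_right _ _) hx)).congr_of_eventuallyEq ?_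
    filter_upwards [Metric.isOpen_ball.mem_nhds (Metric.ball_subset_ball (min_le_left _ _) hx)]
      with y hy using hs y hy
  · filter_upwards [h, hK] with p hp hp'
    rwa [hp]
  · filter_upwards [hf.path, eventually_of_pathNhds ht h] with x hx hx'
    exact hx.congr_of_eventuallyEq hx'.2 hx'.1

/-- Differentiability in the parameter is the chain rule along the curve `s ↦ f s x`, for each fixed
`x` near `b`. -/
theorem comp {g : ℝ → F → G} (hg : PathRegularAt g t (f t b)) (hf : PathRegularAt f t b)
    (ht : t ∈ Icc (0 : ℝ) 1) : PathRegularAt (fun s x => g s (f s x)) t b := by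
  have hT : Tendsto (fun p : ℝ × E => (p.1, f p.1 p.2)) (pathNhds t b) (pathNhds t (f t b)) :=
    tendsto_fst.prodMk hf.tendsto
  obtain ⟨K, hK⟩ := hg.bounded
  refine ⟨?_, ⟨K, hT.eventually hK⟩, ?_⟩
  · filter_upwards [hT.eventually hg.differentiableAt, hf.differentiableAt] with p h1 h2
    exact h1.comp p.2 h2
  · have hcont : Tendsto (fun x => f t x) (𝓝 b) (𝓝 (f t b)) :=
      ((eventually_of_pathNhds ht hf.differentiableAt).self_of_nhds.1).continuousAt
    filter_upwards [hcont.eventually hg.eventually_nhds, hf.path] with x h1 h2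
    exact (h1.hasDerivWithinAt_comp (c := fun s => f s x) ht
      h2.hasDerivWithinAt).differentiableWithinAt

theorem of_differentiable {g : E → F} (hg : ∀ᶠ x in 𝓝 b, DifferentiableAt ℂ g x) :
    PathRegularAt (fun _ => g) t b := by
  refine ⟨eventually_pathNhds_of_nhds hg, ⟨‖g b‖ + 1, ?_⟩,
    Eventually.of_forall fun x => differentiableWithinAt_const _⟩
  have : ∀ᶠ x in 𝓝 b, ‖g x‖ < ‖g b‖ + 1 :=
    hg.self_of_nhds.continuousAt.norm.eventually (gt_mem_nhds (by simp))
  exact eventually_pathNhds_of_nhds (this.mono fun _ h => h.le)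

theorem differentiableAt_self (hf : PathRegularAt f t b) (ht : t ∈ Icc (0 : ℝ) 1) :
    DifferentiableAt ℂ (f t) b :=
  (eventually_of_pathNhds ht hf.differentiableAt).self_of_nhds.1

end PathRegularAt

/-! ### Products and inverses of regular families in a Banach algebra. -/

section Algebra

variable {B : Type*} [NormedRing B] [NormedAlgebra ℂ B] {f g : ℝ → E → B} {t : ℝ} {b : E}

theorem PathRegularAt.mul (hf : PathRegularAt f t b) (hg : PathRegularAt g t b) :
    PathRegularAt (fun s x => f s x * g s x) t b := by
  obtain ⟨K, hK⟩ := hf.bounded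
  obtain ⟨K', hK'⟩ := hg.bounded
  refine ⟨?_, ⟨K * K', ?_⟩, ?_⟩
  · filter_upwards [hf.differentiableAt, hg.differentiableAt] with p h1 h2 using h1.mul h2
  · filter_upwards [hK, hK'] with p h1 h2
    exact (norm_mul_le _ _).trans (mul_le_mul h1 h2 (norm_nonneg _) ((norm_nonneg _).trans h1))
  · filter_upwards [hf.path, hg.path] with x h1 h2 using h1.mul h2

theorem PathRegularAt.const_add (a : B) (hf : PathRegularAt f t b) :
    PathRegularAt (fun s x => a + f s x) t b := by
  obtain ⟨K, hK⟩ := hf.bounded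
  refine ⟨?_, ⟨‖a‖ + K, ?_⟩, ?_⟩
  · filter_upwards [hf.differentiableAt] with p h1 using h1.const_add a
  · filter_upwards [hK] with p h1
    exact (norm_add_le _ _).trans (by gcongr)
  · filter_upwards [hf.path] with x h1 using h1.const_add a

theorem PathRegularAt.neg (hf : PathRegularAt f t b) :
    PathRegularAt (fun s x => -f s x) t b := by
  obtain ⟨K, hK⟩ := hf.bounded
  refine ⟨hf.differentiableAt.mono fun p h => h.neg, ⟨K, hK.mono fun p h => by rwa [norm_neg]⟩,
    hf.path.mono fun x h => h.neg⟩

variable [CompleteSpace B]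

theorem pathRegularAt_inverse {a : B} (ha : IsUnit a) :
    PathRegularAt (fun _ => (Ring.inverse : B → B)) t a :=
  .of_differentiable ((Units.isOpen (R := B)).mem_nhds ha |> fun h =>
    mem_of_superset h fun _ hx => differentiableAt_inverse hx)

theorem PathRegularAt.inverse (hf : PathRegularAt f t b) (ht : t ∈ Icc (0 : ℝ) 1)
    (hu : IsUnit (f t b)) : PathRegularAt (fun s x => Ring.inverse (f s x)) t b :=
  (pathRegularAt_inverse hu).comp hf ht

theorem PathRegularAt.eventually_isUnit (hf : PathRegularAt f t b) (hu : IsUnit (f t b)) :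
    ∀ᶠ p in pathNhds t b, IsUnit (f p.1 p.2) :=
  hf.tendsto.eventually ((Units.isOpen (R := B)).mem_nhds hu)

theorem pathRegularAt_id {b : E} : PathRegularAt (fun _ x => x : ℝ → E → E) t b :=
  .of_differentiable (Eventually.of_forall fun _ => differentiableAt_id)

end Algebra

end PathRegular

/-! ### Uniform local inversion of the maps `u ↦ u f(u)`. -/

section InverseFunction

variable {B : Type*} [NormedRing B]

/-- Multiplying `u f(u) - v f(v) = (u - v) f(u) + v (f(u) - f(v))` by `f(u)⁻¹` expresses `u - v`
through the left side, up to an error which a small `v` makes at most half of `‖u - v‖`. This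
quantitative injectivity is the source of uniqueness, continuity and parameter differentiability of
the inverse. -/
theorem dist_le_of_id_mul {f : B → B} {u v : B} {K C : ℝ} (hu : IsUnit (f u))
    (hK : ‖Ring.inverse (f u)‖ ≤ K) (hC : ‖f u - f v‖ ≤ C * ‖u - v‖)
    (h : ‖v‖ * C * K ≤ 1 / 2) :
    ‖u - v‖ ≤ 2 * K * ‖u * f u - v * f v‖ := by
  have key : u - v = (u * f u - v * f v) * Ring.inverse (f u) -
      v * (f u - f v) * Ring.inverse (f u) := by
    have h1 : u = u * (f u * Ring.inverse (f u)) := by rw [Ring.mul_inverse_cancel _ hu, mul_one]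
    have h2 : v = v * (f u * Ring.inverse (f u)) := by rw [Ring.mul_inverse_cancel _ hu, mul_one]
    conv_lhs => rw [h1, h2]
    noncomm_ring
  have hK0 := (norm_nonneg _).trans hK
  have e1 : ‖(u * f u - v * f v) * Ring.inverse (f u)‖ ≤ ‖u * f u - v * f v‖ * K :=
    (norm_mul_le _ _).trans (by gcongr)
  have e2 : ‖v * (f u - f v) * Ring.inverse (f u)‖ ≤ ‖v‖ * (C * ‖u - v‖) * K := by
    have e5 : ‖v * (f u - f v)‖ ≤ ‖v‖ * (C * ‖u - v‖) := (norm_mul_le _ _).trans (by gcongr)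
    exact (norm_mul_le _ _).trans (mul_le_mul e5 hK (norm_nonneg _) ((norm_nonneg _).trans e5))
  have e3 : ‖v‖ * (C * ‖u - v‖) * K ≤ 1 / 2 * ‖u - v‖ := by
    calc _ = ‖v‖ * C * K * ‖u - v‖ := by ring
      _ ≤ _ := by gcongr
  have e4 := norm_sub_le ((u * f u - v * f v) * Ring.inverse (f u))
    (v * (f u - f v) * Ring.inverse (f u))
  rw [← key] at e4
  linarith

variable [CompleteSpace B]

/-- The equation `u f(u) = w` is the fixed point equation of `u ↦ w f(u)⁻¹`. The first bound on `w`
keeps this map inside the ball, the second makes it a contraction with factor `1 / 2`. -/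
theorem exists_id_mul_eq {f : B → B} {w : B} {K C ρ : ℝ} (hρ : 0 < ρ) (hC0 : 0 < C) (hK0 : 0 < K)
    (hu : ∀ u ∈ Metric.closedBall (0 : B) ρ, IsUnit (f u) ∧ ‖Ring.inverse (f u)‖ ≤ K)
    (hC : ∀ u ∈ Metric.closedBall (0 : B) ρ, ∀ v ∈ Metric.closedBall (0 : B) ρ,
      ‖Ring.inverse (f u) - Ring.inverse (f v)‖ ≤ C * ‖u - v‖)
    (hw : ‖w‖ < ρ / (2 * K)) (hw' : ‖w‖ < 1 / (2 * C)) :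
    ∃ u ∈ Metric.ball (0 : B) ρ, u * f u = w := by
  set φ : B → B := fun u => w * Ring.inverse (f u)
  have hφ : ∀ u ∈ Metric.closedBall (0 : B) ρ, ‖φ u‖ < ρ := by
    intro u hu'
    calc ‖φ u‖ ≤ ‖w‖ * K := (norm_mul_le _ _).trans (by gcongr; exact (hu u hu').2)
      _ ≤ ρ / (2 * K) * K := by gcongr
      _ = ρ / 2 := by field_simp
      _ < ρ := by linarith
  have hmaps : MapsTo φ (Metric.closedBall 0 ρ) (Metric.closedBall 0 ρ) := fun u hu' =>
    mem_closedBall_zero_iff.2 (hφ u hu').le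
  have hcontr : ContractingWith (1 / 2 : NNReal)
      (hmaps.restrict φ (Metric.closedBall 0 ρ) (Metric.closedBall 0 ρ)) := by
    refine ⟨by norm_num, LipschitzWith.of_dist_le_mul fun x y => ?_⟩
    rw [Subtype.dist_eq, Subtype.dist_eq, dist_eq_norm, dist_eq_norm]
    change ‖φ x - φ y‖ ≤ _
    simp only [φ]
    rw [← mul_sub]
    calc _ ≤ ‖w‖ * (C * ‖(x : B) - y‖) :=
          (norm_mul_le _ _).trans (by gcongr; exact hC x x.2 y y.2)
      _ ≤ 1 / (2 * C) * (C * ‖(x : B) - y‖) := by gcongr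
      _ = _ := by push_cast; field_simp
  obtain ⟨u, hu1, hu2, -⟩ := hcontr.exists_fixedPoint' Metric.isClosed_closedBall.isComplete hmaps
    (Metric.mem_closedBall_self hρ.le) (edist_ne_top _ _)
  refine ⟨u, mem_ball_zero_iff.2 ?_, ?_⟩
  · have := hφ u hu1
    rwa [hu2] at this
  · have h1 : w * Ring.inverse (f u) = u := hu2
    calc u * f u = w * Ring.inverse (f u) * f u := by rw [h1]
      _ = w := by rw [mul_assoc, Ring.inverse_mul_cancel _ (hu u hu1).1, mul_one]

variable [NormedAlgebra ℂ B]

/-- The derivative `h ↦ h f(u) + u f'(u)h` is right multiplication by the unit `f(u)` composed with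
a perturbation of the identity of norm less than `1`, so a Neumann series inverts it. -/
theorem isUnit_fderiv_id_mul {f : B → B} {u : B} {K C : ℝ} (hf : DifferentiableAt ℂ f u)
    (hu : IsUnit (f u)) (hK : ‖Ring.inverse (f u)‖ ≤ K) (hC : ‖fderiv ℂ f u‖ ≤ C)
    (h : ‖u‖ * C * K < 1) :
    IsUnit (fderiv ℂ (fun x => x * f x) u) := by
  set L := fderiv ℂ (fun x => x * f x) u
  have hL : ∀ h, L h = h * f u + u * fderiv ℂ f u h := by
    intro h
    have := ((hasFDerivAt_id (𝕜 := ℂ) u).mul' hf.hasFDerivAt).fderiv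
    simp only [L]
    change (fderiv ℂ (fun x => id x * f x) u) h = _
    rw [show (fun x => id x * f x) = id * f from rfl, this]
    simp [add_comm]
  set M : B →L[ℂ] B := (ContinuousLinearMap.mul ℂ B).flip (f u)
  set N : B →L[ℂ] B := (ContinuousLinearMap.mul ℂ B).flip (Ring.inverse (f u))
  set D : B →L[ℂ] B := (ContinuousLinearMap.mul ℂ B u).comp (fderiv ℂ f u)
  have hMN : M * N = 1 := by
    ext h; simp [M, N, mul_assoc, Ring.inverse_mul_cancel _ hu]
  have hNM : N * M = 1 := by
    ext h; simp [M, N, mul_assoc, Ring.mul_inverse_cancel _ hu]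
  have hM : IsUnit M := ⟨⟨M, N, hMN, hNM⟩, rfl⟩
  have hND : ‖-(N * D)‖ < 1 := by
    rw [norm_neg]
    refine lt_of_le_of_lt (ContinuousLinearMap.opNorm_le_bound _ (M := ‖u‖ * C * K) ?_ ?_) h
    · have := (norm_nonneg _).trans hK
      have := (norm_nonneg _).trans hC
      positivity
    · intro x
      have h1 : (N * D) x = u * fderiv ℂ f u x * Ring.inverse (f u) := by simp [N, D]
      rw [h1]
      have h2 : ‖fderiv ℂ f u x‖ ≤ C * ‖x‖ :=
        ((fderiv ℂ f u).le_opNorm x).trans (by gcongr)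
      calc _ ≤ ‖u‖ * ‖fderiv ℂ f u x‖ * ‖Ring.inverse (f u)‖ :=
            (norm_mul_le _ _).trans (by gcongr; exact norm_mul_le _ _)
        _ ≤ ‖u‖ * (C * ‖x‖) * K := by
            have := (norm_nonneg _).trans hK
            have := (norm_nonneg _).trans h2
            gcongr
        _ = _ := by ring
  have h1 : L = M * (1 - -(N * D)) := by
    rw [sub_neg_eq_add, mul_add, mul_one, ← mul_assoc, hMN, one_mul]
    ext x
    rw [hL]; simp [M, D]
  rw [h1]
  exact hM.mul (isUnit_one_sub_of_norm_lt_one hND)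

/-- The local inverses of the maps `u ↦ u f_s(u)` form a regular family if `f_t(0)` is
invertible. -/
theorem PathRegularAt.exists_inverse_id_mul {f : ℝ → B → B} {t : ℝ} (hf : PathRegularAt f t 0)
    (ht : t ∈ Icc (0 : ℝ) 1) (hu : IsUnit (f t 0)) :
    ∃ g : ℝ → B → B, PathRegularAt g t 0 ∧ (∀ᶠ s in 𝓝[Icc 0 1] t, g s 0 = 0) ∧
      (∀ᶠ p in pathNhds t (0 : B), g p.1 p.2 * f p.1 (g p.1 p.2) = p.2) ∧
      ∀ᶠ p in pathNhds t (0 : B), g p.1 (p.2 * f p.1 p.2) = p.2 := by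
  have hj := hf.inverse ht hu
  obtain ⟨r₁, hr₁, C₁, hC₁, h1⟩ := hf.exists_taylor
  obtain ⟨r₂, hr₂, C₂, hC₂, h2⟩ := hj.exists_taylor
  obtain ⟨r₃, hr₃, K, hK, h3, -⟩ := hj.exists_ball
  obtain ⟨r₄, hr₄, h4⟩ := eventually_pathNhds_iff.1 (hf.eventually_isUnit hu)
  obtain ⟨r₅, hr₅, h5⟩ := Metric.eventually_nhds_iff_ball.1
    (pathRegularAt_id.mul hf).eventually_nhds
  -- The last condition on `ρ` serves twice, for injectivity and for invertibility of the
  -- derivative. The others place the closed ball in the domains of all the uniform estimates.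
  obtain ⟨ρ, hρ, hρ'⟩ : ∃ ρ > 0, ρ < r₁ ∧ ρ < r₂ ∧ ρ < r₃ ∧ ρ < r₄ ∧ ρ < r₅ ∧
      ρ * C₁ * K < 1 / 2 := by
    have : ∀ᶠ ρ : ℝ in 𝓝[>] 0, ρ < r₁ ∧ ρ < r₂ ∧ ρ < r₃ ∧ ρ < r₄ ∧ ρ < r₅ ∧
        ρ * C₁ * K < 1 / 2 := by
      have hlt : ∀ r : ℝ, 0 < r → ∀ᶠ ρ : ℝ in 𝓝[>] 0, ρ < r := fun r hr =>
        nhdsWithin_le_nhds (gt_mem_nhds hr)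
      have hlast : ∀ᶠ ρ : ℝ in 𝓝[>] 0, ρ * C₁ * K < 1 / 2 := by
        have : Tendsto (fun ρ : ℝ => ρ * C₁ * K) (𝓝 0) (𝓝 (0 * C₁ * K)) :=
          Continuous.tendsto (by fun_prop) 0
        rw [zero_mul, zero_mul] at this
        exact nhdsWithin_le_nhds (this.eventually (gt_mem_nhds (by norm_num)))
      filter_upwards [hlt r₁ hr₁, hlt r₂ hr₂, hlt r₃ hr₃, hlt r₄ hr₄, hlt r₅ hr₅, hlast]
        with ρ a1 a2 a3 a4 a5 a6 using ⟨a1, a2, a3, a4, a5, a6⟩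
    obtain ⟨ρ, h, h'⟩ := (this.and self_mem_nhdsWithin).exists
    exact ⟨ρ, h', h⟩
  obtain ⟨l₁, l₂, l₃, l₄, l₅, l₆⟩ := hρ'
  have hsub : ∀ {r u}, ρ < r → u ∈ Metric.closedBall (0 : B) ρ → u ∈ Metric.ball (0 : B) r :=
    fun h hu => Metric.closedBall_subset_ball h hu
  set δ : ℝ := min (ρ / (2 * K)) (1 / (2 * C₂))
  have hδ : 0 < δ := by positivity
  have hnorm : ∀ u ∈ Metric.closedBall (0 : B) ρ, ‖u‖ * C₁ * K < 1 / 2 := fun u hu => by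
    refine lt_of_le_of_lt ?_ l₆
    gcongr
    exact mem_closedBall_zero_iff.1 hu
  have good : ∀ᶠ s in 𝓝[Icc 0 1] t,
      (∀ u ∈ Metric.closedBall (0 : B) ρ, ∀ v ∈ Metric.closedBall (0 : B) ρ,
        ‖u - v‖ ≤ 2 * K * ‖u * f s u - v * f s v‖) ∧
      (∀ w ∈ Metric.ball (0 : B) δ, ∃ u ∈ Metric.ball (0 : B) ρ, u * f s u = w) ∧
      ∀ u ∈ Metric.ball (0 : B) ρ, DifferentiableAt ℂ (fun x => x * f s x) u ∧
        IsUnit (fderiv ℂ (fun x => x * f s x) u) := by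
    filter_upwards [h1, h2, h3, h4] with s h1 h2 h3 h4
    refine ⟨fun u hu v hv => ?_, fun w hw => ?_, fun u hu => ?_⟩
    · exact dist_le_of_id_mul (h4 u (hsub l₄ hu)) (h3.2 u (hsub l₃ hu))
        ((h1 v (hsub l₁ hv)).2.2 u (hsub l₁ hu)).1 (hnorm v hv).le
    · refine exists_id_mul_eq hρ hC₂ hK (fun u hu => ⟨h4 u (hsub l₄ hu), h3.2 u (hsub l₃ hu)⟩)
        (fun u hu v hv => ((h2 v (hsub l₂ hv)).2.2 u (hsub l₂ hu)).1) ?_ ?_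
      · exact (mem_ball_zero_iff.1 hw).trans_le (min_le_left _ _)
      · exact (mem_ball_zero_iff.1 hw).trans_le (min_le_right _ _)
    · have hu' := Metric.ball_subset_closedBall hu
      have hd := (h1 u (hsub l₁ hu')).2.1
      exact ⟨differentiableAt_id.mul hd, isUnit_fderiv_id_mul hd (h4 u (hsub l₄ hu'))
        (h3.2 u (hsub l₃ hu')) (h1 u (hsub l₁ hu')).1 ((hnorm u hu').trans (by norm_num))⟩
  classical
  -- The preimage is unique in the ball of radius `ρ` for `s` near `t`. The default `0` is never met
  -- when `w` lies in the ball of radius `δ` and `s` is near `t`.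
  set g : ℝ → B → B := fun s w =>
    if h : ∃ u ∈ Metric.ball (0 : B) ρ, u * f s u = w then h.choose else 0
  have hg : ∀ s w, (∃ u ∈ Metric.ball (0 : B) ρ, u * f s u = w) →
      g s w ∈ Metric.ball (0 : B) ρ ∧ g s w * f s (g s w) = w := by
    intro s w h
    simp only [g, dif_pos h]
    exact h.choose_spec
  have hginv : ∀ᶠ s in 𝓝[Icc 0 1] t, ∀ u ∈ Metric.ball (0 : B) ρ, g s (u * f s u) = u := by
    filter_upwards [good] with s hs u hu
    obtain ⟨h1, h2⟩ := hg s (u * f s u) ⟨u, hu, rfl⟩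
    have := hs.1 _ (Metric.ball_subset_closedBall h1) u (Metric.ball_subset_closedBall hu)
    rw [h2, sub_self, norm_zero, mul_zero] at this
    exact sub_eq_zero.1 (norm_le_zero_iff.1 this)
  have hright : ∀ᶠ s in 𝓝[Icc 0 1] t, ∀ w ∈ Metric.ball (0 : B) δ,
      g s w ∈ Metric.ball (0 : B) ρ ∧ g s w * f s (g s w) = w := by
    filter_upwards [good] with s hs w hw using hg s w (hs.2.1 w hw)
  refine ⟨g, ?_, ?_, ?_, ?_⟩
  · refine .of_ball (r := δ) (K := ρ) hδ ?_ ?_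
    · filter_upwards [good, hright] with s hs hr
      refine ⟨fun w hw => DifferentiableAt.differentiableWithinAt ?_, fun w hw =>
        (mem_ball_zero_iff.1 (hr w hw).1).le⟩
      obtain ⟨hd, hU⟩ := hs.2.2 _ (hr w hw).1
      have hwn : ∀ᶠ y in 𝓝 w, y ∈ Metric.ball (0 : B) δ := Metric.isOpen_ball.mem_nhds hw
      -- Continuity of `g s` comes from the injectivity estimate. With the invertible derivative of
      -- the forward map, this already gives differentiability of the inverse.
      refine (HasFDerivAt.of_local_left_inverse (f := fun x => x * f s x)
        (f' := ContinuousLinearEquiv.ofUnit hU.unit) ?_ ?_ ?_).differentiableAt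
      · rw [ContinuousAt, tendsto_iff_norm_sub_tendsto_zero]
        have h0 : Tendsto (fun y => 2 * K * ‖y - w‖) (𝓝 w) (𝓝 0) := by
          have : Tendsto (fun y => 2 * K * ‖y - w‖) (𝓝 w) (𝓝 (2 * K * ‖w - w‖)) :=
            Continuous.tendsto (by fun_prop) w
          simpa using this
        refine squeeze_zero' (Eventually.of_forall fun _ => norm_nonneg _) ?_ h0
        filter_upwards [hwn] with y hy
        have := hs.1 _ (Metric.ball_subset_closedBall (hr y hy).1) _
          (Metric.ball_subset_closedBall (hr w hw).1)
        rwa [(hr y hy).2, (hr w hw).2] at this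
      · exact hd.hasFDerivAt
      · filter_upwards [hwn] with y hy using (hr y hy).2
    · filter_upwards [Metric.ball_mem_nhds (0 : B) hδ] with w hw
      have hut := (hright.self_of_nhdsWithin ht w hw)
      set u := g t w
      have hreg : PathRegularAt (fun s x => x * f s x) t u :=
        h5 u (hsub l₅ (Metric.ball_subset_closedBall hut.1))
      obtain ⟨U, hU⟩ := ((good.self_of_nhdsWithin ht).2.2 u hut.1).2
      -- Implicit differentiation: `v` is the velocity for which the straight curve `c` solves `c
      -- f_s(c) = w` to first order at `t`. The injectivity estimate converts the residual `o(s -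
      -- t)` into `g s w - c s = o(s - t)`.
      set d := derivWithin (fun s => u * f s u) (Icc 0 1) t
      set v : B := (↑U⁻¹ : B →L[ℂ] B) (-d)
      have hv : fderiv ℂ (fun x => x * f t x) u v = -d := by
        rw [← hU]
        have : ((U : B →L[ℂ] B) * (↑U⁻¹ : B →L[ℂ] B)) (-d) = -d := by
          rw [Units.mul_inv]; rfl
        exact this
      set c : ℝ → B := fun s => u + (s - t) • v
      have hct : c t = u := by simp [c]
      have hc : HasDerivWithinAt c v (Icc 0 1) t := by
        have := (((hasDerivWithinAt_id t (Icc (0 : ℝ) 1)).sub_const t).smul_const v).const_add u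
        simpa [c] using this
      have hcomp := PathRegularAt.hasDerivWithinAt_comp (c := c) (by rw [hct]; exact hreg) ht hc
      rw [hct, hv, neg_add_cancel] at hcomp
      have hcu : Tendsto c (𝓝[Icc 0 1] t) (𝓝 u) := by
        have := hc.continuousWithinAt.tendsto
        rwa [hct] at this
      have hgc : (fun s => g s w - c s) =o[𝓝[Icc 0 1] t] fun s => s - t := by
        rw [hasDerivWithinAt_iff_isLittleO] at hcomp
        refine Asymptotics.IsBigO.trans_isLittleO ?_ hcomp
        refine Asymptotics.IsBigO.of_bound (2 * K) ?_
        filter_upwards [good, hright, hcu.eventually (Metric.isOpen_ball.mem_nhds hut.1)]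
          with s hs hr hcs
        have := hs.1 _ (Metric.ball_subset_closedBall (hr w hw).1) _
          (Metric.ball_subset_closedBall hcs)
        rw [(hr w hw).2] at this
        refine this.trans_eq ?_
        rw [smul_zero, sub_zero, hct, hut.2, norm_sub_rev]
      have hD : HasDerivWithinAt (fun s => g s w - c s) 0 (Icc 0 1) t := by
        rw [hasDerivWithinAt_iff_isLittleO]
        refine hgc.congr_left fun s => ?_
        simp [hct, u]
      have := (hD.add hc).differentiableWithinAt
      refine this.congr (fun s _ => ?_) ?_ <;> simp
  · filter_upwards [hginv] with s hs
    have := hs 0 (Metric.mem_ball_self hρ)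
    rwa [zero_mul] at this
  · exact eventually_pathNhds_iff.2 ⟨δ, hδ, hright.mono fun s hs w hw => (hs w hw).2⟩
  · exact eventually_pathNhds_iff.2 ⟨ρ, hρ, hginv⟩

end InverseFunction

/-! ### Uniqueness of holomorphic maps on Banach spaces -/

section Uniqueness

variable {E F : Type*} [NormedAddCommGroup E] [NormedSpace ℂ E] [NormedAddCommGroup F]
  [NormedSpace ℂ F] [CompleteSpace F]

/-- A complex line meets the ball in a convex, hence connected, open subset of `ℂ`, where the
one-variable identity theorem applies. -/
theorem eq_of_eventuallyEq_line {f g : E → F} {r : ℝ} {a v : E} {z₀ : ℂ}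
    (hf : DifferentiableOn ℂ f (Metric.ball 0 r)) (hg : DifferentiableOn ℂ g (Metric.ball 0 r))
    (h₀ : a + z₀ • v ∈ Metric.ball (0 : E) r)
    (h : ∀ᶠ z in 𝓝 z₀, f (a + z • v) = g (a + z • v)) {z : ℂ}
    (hz : a + z • v ∈ Metric.ball (0 : E) r) : f (a + z • v) = g (a + z • v) := by
  set D : Set ℂ := {z | a + z • v ∈ Metric.ball (0 : E) r}
  have hline : Differentiable ℂ fun z : ℂ => a + z • v := by fun_prop
  have hD : IsOpen D := Metric.isOpen_ball.preimage hline.continuous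
  have hconv : Convex ℝ D := by
    intro x hx y hy p q hp hq hpq
    have := (convex_ball (0 : E) r) hx hy hp hq hpq
    change a + (p • x + q • y) • v ∈ Metric.ball (0 : E) r
    convert this using 1
    rw [smul_add, smul_add, add_smul, smul_assoc, smul_assoc]
    calc a + (p • x • v + q • y • v) = (p + q) • a + (p • x • v + q • y • v) := by
          rw [hpq, one_smul]
      _ = _ := by rw [add_smul]; abel
  have hfD : AnalyticOnNhd ℂ (fun z => f (a + z • v)) D :=
    (hf.comp hline.differentiableOn fun _ hz => hz).analyticOnNhd hD
  have hgD : AnalyticOnNhd ℂ (fun z => g (a + z • v)) D :=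
    (hg.comp hline.differentiableOn fun _ hz => hz).analyticOnNhd hD
  exact hfD.eqOn_of_preconnected_of_eventuallyEq hgD hconv.isPreconnected h₀ h hz

theorem eqOn_ball_of_eventuallyEq {f g : E → F} {r : ℝ}
    (hf : DifferentiableOn ℂ f (Metric.ball 0 r)) (hg : DifferentiableOn ℂ g (Metric.ball 0 r))
    (h : ∀ᶠ x in 𝓝 0, f x = g x) {w : E} (hw : w ∈ Metric.ball (0 : E) r) : f w = g w := by
  have hr : 0 < r := Metric.pos_of_mem_ball hw
  have hline : Tendsto (fun z : ℂ => (0 : E) + z • w) (𝓝 0) (𝓝 0) := by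
    have : Tendsto (fun z : ℂ => (0 : E) + z • w) (𝓝 0) (𝓝 ((0 : E) + (0 : ℂ) • w)) :=
      Continuous.tendsto (by fun_prop) 0
    simpa using this
  have := eq_of_eventuallyEq_line (a := 0) (v := w) (z₀ := 0) (z := 1) hf hg (by simpa using hr)
    (hline.eventually h) (by simpa using hw)
  simpa using this

/-- Units need not be dense, but on the line `z ↦ b + z • 1` every point with `‖z‖ > ‖b‖` is
invertible. Agreement near such a point propagates along the line to `z = 0`. This permits
cancelling a factor `b` from identities between holomorphic functions of `b`. -/
theorem eventuallyEq_of_eq_on_units {B : Type*} [NormedRing B] [NormedAlgebra ℂ B]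
    [CompleteSpace B] {f g : B → F} (hf : ∀ᶠ x in 𝓝 0, DifferentiableAt ℂ f x)
    (hg : ∀ᶠ x in 𝓝 0, DifferentiableAt ℂ g x) (h : ∀ᶠ x in 𝓝 0, IsUnit x → f x = g x) :
    ∀ᶠ x in 𝓝 0, f x = g x := by
  obtain ⟨r, hr, hall⟩ := Metric.eventually_nhds_iff_ball.1 (hf.and (hg.and h))
  -- This `c` satisfies `c ‖1‖ ≤ r / 2`. For `‖b‖ < min c (r / 2)` the point `b + c • 1` is
  -- therefore in the ball, and nearby parameters `z` still satisfy `‖z‖ > ‖b‖`.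
  set c : ℝ := r / (2 * (‖(1 : B)‖ + 1))
  have hc : 0 < c := by positivity
  filter_upwards [Metric.ball_mem_nhds (0 : B) (lt_min hc (half_pos hr))] with b hb
  rw [mem_ball_zero_iff, lt_min_iff] at hb
  have hfd : DifferentiableOn ℂ f (Metric.ball 0 r) := fun x hx =>
    (hall x hx).1.differentiableWithinAt
  have hgd : DifferentiableOn ℂ g (Metric.ball 0 r) := fun x hx =>
    (hall x hx).2.1.differentiableWithinAt
  have h₀ : b + (c : ℂ) • (1 : B) ∈ Metric.ball (0 : B) r := by
    rw [mem_ball_zero_iff]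
    have h1 : ‖(c : ℂ) • (1 : B)‖ ≤ r / 2 := by
      rw [norm_smul, Complex.norm_real, Real.norm_eq_abs, abs_of_pos hc]
      calc c * ‖(1 : B)‖ ≤ c * (‖(1 : B)‖ + 1) := by gcongr; linarith
        _ = r / 2 := by simp only [c]; field_simp
    linarith [norm_add_le b ((c : ℂ) • (1 : B))]
  have hev : ∀ᶠ z : ℂ in 𝓝 (c : ℂ), f (b + z • (1 : B)) = g (b + z • (1 : B)) := by
    have hcont : Continuous fun z : ℂ => b + z • (1 : B) := by fun_prop
    have h1 : ∀ᶠ z : ℂ in 𝓝 (c : ℂ), b + z • (1 : B) ∈ Metric.ball (0 : B) r :=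
      hcont.continuousAt.eventually (Metric.isOpen_ball.mem_nhds h₀)
    have h2 : ∀ᶠ z : ℂ in 𝓝 (c : ℂ), ‖b‖ < ‖z‖ := by
      refine continuous_norm.continuousAt.eventually (lt_mem_nhds ?_)
      simpa [abs_of_pos hc] using hb.1
    filter_upwards [h1, h2] with z hz1 hz2
    refine (hall _ hz1).2.2 ?_
    have hz0 : z ≠ 0 := by
      rintro rfl
      rw [norm_zero] at hz2
      exact absurd hz2 (norm_nonneg b).not_gt
    have : b + z • (1 : B) = algebraMap ℂ B z * (1 - -(z⁻¹ • b)) := by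
      rw [← Algebra.smul_def, sub_neg_eq_add, smul_add, smul_inv_smul₀ hz0, add_comm]
    rw [this]
    refine ((isUnit_iff_ne_zero.2 hz0).map (algebraMap ℂ B)).mul
      (isUnit_one_sub_of_norm_lt_one ?_)
    rw [norm_neg, norm_smul, norm_inv, inv_mul_lt_iff₀ (norm_pos_iff.2 hz0), mul_one]
    exact hz2
  have := eq_of_eventuallyEq_line (z := 0) hfd hgd h₀ hev
    (by simpa using hb.2.trans (half_lt_self hr))
  simpa using this

/-- A series of homogeneous terms converges wherever its sum extends holomorphically. -/
theorem hasSum_of_eventually_hasSum {p : ℕ → E → F} {H : E → F} {r : ℝ}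
    (hp : ∀ n (z : ℂ) x, p n (z • x) = z ^ n • p n x)
    (hH : DifferentiableOn ℂ H (Metric.ball 0 r))
    (h : ∀ᶠ x in 𝓝 0, HasSum (fun n => p n x) (H x)) {b : E} (hb : b ∈ Metric.ball (0 : E) r) :
    HasSum (fun n => p n b) (H b) := by
  rw [mem_ball_zero_iff] at hb
  -- On the line through `b` the sum becomes a power series in `z`, to be evaluated at `z = 1`. A
  -- disc of radius `R > 1` has this point in its interior.
  obtain ⟨R, hR1, hRb⟩ : ∃ R : NNReal, 1 < R ∧ R * ‖b‖ < r := by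
    have hT : Tendsto (fun R : ℝ => R * ‖b‖) (𝓝[>] 1) (𝓝 (1 * ‖b‖)) :=
      (Continuous.tendsto (by fun_prop) 1).mono_left nhdsWithin_le_nhds
    rw [one_mul] at hT
    obtain ⟨R, h1, h2⟩ := ((hT.eventually (gt_mem_nhds hb)).and self_mem_nhdsWithin).exists
    have h2 : 1 < R := h2
    exact ⟨⟨R, by linarith⟩, by exact_mod_cast h2, h1⟩
  set φ : ℂ → F := fun z => H (z • b)
  have hφ : DifferentiableOn ℂ φ (Metric.closedBall 0 R) := by
    refine hH.comp (Differentiable.differentiableOn (by fun_prop)) fun z hz => ?_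
    rw [mem_ball_zero_iff, norm_smul]
    refine lt_of_le_of_lt ?_ hRb
    gcongr
    simpa using hz
  have h1 := hφ.hasFPowerSeriesOnBall (zero_lt_one.trans hR1)
  set q : FormalMultilinearSeries ℂ ℂ F := fun n =>
    ContinuousMultilinearMap.mkPiRing ℂ (Fin n) (p n b)
  have hq : HasFPowerSeriesAt φ q 0 := by
    rw [hasFPowerSeriesAt_iff]
    have hT : Tendsto (fun z : ℂ => z • b) (𝓝 0) (𝓝 0) := by
      have : Tendsto (fun z : ℂ => z • b) (𝓝 0) (𝓝 ((0 : ℂ) • b)) :=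
        Continuous.tendsto (by fun_prop) 0
      simpa using this
    filter_upwards [hT.eventually h] with z hz
    simp only [hp] at hz
    simpa [q, φ, FormalMultilinearSeries.coeff, ContinuousMultilinearMap.mkPiRing_apply] using hz
  rw [h1.hasFPowerSeriesAt.eq_formalMultilinearSeries hq] at h1
  have h2 := h1.hasSum (y := 1) (by
    rw [Metric.mem_eball, edist_zero_right, enorm_one]
    exact_mod_cast hR1)
  simpa [q, φ, ContinuousMultilinearMap.mkPiRing_apply] using h2

/-- The quantifiers are exchanged here: a neighbourhood depending on `s` becomes one common to all
`s` near `t`, because the family `H` is holomorphic on a common ball. -/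
theorem eventually_hasSum_pathNhds {p : ℝ → ℕ → E → F} {H : ℝ → E → F} {t : ℝ}
    (hp : ∀ s n (z : ℂ) x, p s n (z • x) = z ^ n • p s n x)
    (hH : ∀ᶠ q in pathNhds t (0 : E), DifferentiableAt ℂ (H q.1) q.2)
    (h : ∀ᶠ s in 𝓝[Icc 0 1] t, ∀ᶠ x in 𝓝 0, HasSum (fun n => p s n x) (H s x)) :
    ∀ᶠ q in pathNhds t (0 : E), HasSum (fun n => p q.1 n q.2) (H q.1 q.2) := by
  obtain ⟨r, hr, hd⟩ := eventually_pathNhds_iff.1 hH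
  refine eventually_pathNhds_iff.2 ⟨r, hr, ?_⟩
  filter_upwards [hd, h] with s h1 h2 x hx
  exact hasSum_of_eventually_hasSum (hp s) (fun y hy => (h1 y hy).differentiableWithinAt) h2 hx

theorem eventually_hasSum_succ_pathNhds {p : ℝ → ℕ → E → F} {H : ℝ → E → F} {t : ℝ}
    (hp : ∀ s n (z : ℂ) x, p s n (z • x) = z ^ (n + 1) • p s n x)
    (hH : ∀ᶠ q in pathNhds t (0 : E), DifferentiableAt ℂ (H q.1) q.2)
    (h : ∀ᶠ s in 𝓝[Icc 0 1] t, ∀ᶠ x in 𝓝 0, HasSum (fun n => p s n x) (H s x)) :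
    ∀ᶠ q in pathNhds t (0 : E), HasSum (fun n => p q.1 n q.2) (H q.1 q.2) := by
  -- The `n`-th term has degree `n + 1`. Prepending a zero constant term aligns index and degree.
  set p' : ℝ → ℕ → E → F := fun s n x => n.casesOn 0 fun k => p s k x
  have key : ∀ s x a, HasSum (fun n => p' s n x) a ↔ HasSum (fun n => p s n x) a := by
    intro s x a
    rw [← hasSum_nat_add_iff' (f := fun n => p' s n x) 1]
    simp [p']
  simp only [← key] at h ⊢
  refine eventually_hasSum_pathNhds (fun s n z x => ?_) hH h
  cases n with
  | zero => simp [p']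
  | succ k => exact hp s k z x

end Uniqueness

/-! ### Moment series of exponentially bounded maps -/

section MomentSeries

variable {B : Type u} [CStarAlgebra B]

/-- The multilinear maps `(b₁, …, bₙ) ↦ μ(X b₁ X ⋯ bₙ X)`. -/
def momentSeries (μ : NCPoly B →ₗ[ℂ] B) {M : ℝ} (h : ExpBoundedBy M μ) :
    FormalMultilinearSeries ℂ B B := fun n =>
  MultilinearMap.mkContinuous
    ((μ ∘ₗ LinearMap.mulLeft ℂ (X B)).compMultilinearMap
      ((MultilinearMap.mkPiAlgebraFin ℂ n (NCPoly B)).compLinearMap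
        fun _ => LinearMap.mulRight ℂ (X B) ∘ₗ (C B).toLinearMap))
    (M ^ (n + 1)) (fun m => by
      have := h (List.ofFn m)
      rw [word, List.map_ofFn, List.map_ofFn, List.length_ofFn, List.prod_ofFn (f := _ ∘ m)] at this
      simpa [MultilinearMap.mkPiAlgebraFin_apply, Function.comp_def] using this)

theorem momentSeries_apply (μ : NCPoly B →ₗ[ℂ] B) {M : ℝ} (h : ExpBoundedBy M μ) (n : ℕ) (b : B) :
    momentSeries μ h n (fun _ => b) = μ (X B * (C B b * X B) ^ n) := by
  simp [momentSeries, MultilinearMap.mkPiAlgebraFin_apply]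

theorem norm_moment_le {μ : NCPoly B →ₗ[ℂ] B} {M : ℝ} (h : ExpBoundedBy M μ) (n : ℕ) (b : B) :
    ‖μ (X B * (C B b * X B) ^ n)‖ ≤ M * (M * ‖b‖) ^ n := by
  have := h (List.replicate n b)
  simp only [word, List.map_replicate, List.prod_replicate, List.length_replicate] at this
  refine this.trans_eq ?_
  ring

theorem hasSum_psiTilde {μ : NCPoly B →ₗ[ℂ] B} {M : ℝ} (hM : 0 < M) (h : ExpBoundedBy M μ) {b : B}
    (hb : b ∈ Metric.ball (0 : B) M⁻¹) :
    HasSum (fun n : ℕ => μ (X B * (C B b * X B) ^ n)) (psiTilde μ b) := by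
  refine Summable.hasSum (Summable.of_norm_bounded (g := fun n => M * (M * ‖b‖) ^ n) ?_
    fun n => norm_moment_le h n b)
  refine (summable_geometric_of_lt_one (by positivity) ?_).mul_left M
  rw [mem_ball_zero_iff] at hb
  calc M * ‖b‖ < M * M⁻¹ := by gcongr
    _ = 1 := mul_inv_cancel₀ hM.ne'

theorem norm_psiTilde_le {μ : NCPoly B →ₗ[ℂ] B} {M : ℝ} (hM : 0 < M) (h : ExpBoundedBy M μ) {b : B}
    (hb : b ∈ Metric.ball (0 : B) (2 * M)⁻¹) : ‖psiTilde μ b‖ ≤ 2 * M := by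
  rw [mem_ball_zero_iff] at hb
  have hb' : M * ‖b‖ ≤ 1 / 2 := by
    calc M * ‖b‖ ≤ M * (2 * M)⁻¹ := by gcongr
      _ = 1 / 2 := by field_simp
  have hg : HasSum (fun n : ℕ => M * (1 / 2 : ℝ) ^ n) (M * 2) := hasSum_geometric_two.mul_left M
  rw [mul_comm]
  refine tsum_of_norm_bounded hg fun n => (norm_moment_le h n b).trans ?_
  gcongr

/-- The bound `M ^ (n + 1)` on the `n`-linear moment map gives the power series radius at least
`M⁻¹`. -/
theorem differentiableOn_psiTilde {μ : NCPoly B →ₗ[ℂ] B} {M : ℝ} (hM : 0 < M)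
    (h : ExpBoundedBy M μ) : DifferentiableOn ℂ (psiTilde μ) (Metric.ball 0 M⁻¹) := by
  set p := momentSeries μ h
  have hrad : ENNReal.ofReal M⁻¹ ≤ p.radius := by
    refine p.le_radius_of_bound (r := Real.toNNReal M⁻¹) M fun n => ?_
    have h1 : ‖p n‖ ≤ M ^ (n + 1) := MultilinearMap.mkContinuous_norm_le _ (by positivity) _
    rw [Real.coe_toNNReal _ (by positivity)]
    calc ‖p n‖ * M⁻¹ ^ n ≤ M ^ (n + 1) * M⁻¹ ^ n := by gcongr
      _ = M := by rw [pow_succ', mul_assoc, ← mul_pow, mul_inv_cancel₀ hM.ne', one_pow, mul_one]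
  have hpos : 0 < p.radius := lt_of_lt_of_le (by simpa using hM) hrad
  have hsum : p.sum = psiTilde μ := by
    ext b
    simp only [FormalMultilinearSeries.sum, p, momentSeries_apply]
    rfl
  have := (p.hasFPowerSeriesOnBall hpos).differentiableOn
  rw [hsum] at this
  refine this.mono fun x hx => ?_
  rw [Metric.mem_eball]
  refine lt_of_lt_of_le ?_ hrad
  rw [edist_dist]
  exact ENNReal.ofReal_lt_ofReal_iff_of_nonneg dist_nonneg |>.2 hx

theorem IsRegularAtOrigin.pathRegularAt {μ : ℝ → NCPoly B →ₗ[ℂ] B} (h : IsRegularAtOrigin μ)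
    {t : ℝ} (ht : t ∈ Icc (0 : ℝ) 1) : PathRegularAt (fun s => psiTilde (μ s)) t 0 := by
  obtain ⟨M, hM, hb⟩ := h.bounded
  -- Half the radius of convergence makes the geometric ratio at most `1 / 2`, hence a bound `2 M`
  -- common to the whole path.
  refine .of_ball (r := (2 * M)⁻¹) (K := 2 * M) (by positivity) ?_ (h.differentiable t ht)
  filter_upwards [self_mem_nhdsWithin] with s hs
  refine ⟨(differentiableOn_psiTilde hM (hb s hs)).mono (Metric.ball_subset_ball ?_),
    fun x hx => norm_psiTilde_le hM (hb s hs) hx⟩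
  gcongr
  linarith

theorem psiTilde_zero (μ : NCPoly B →ₗ[ℂ] B) : psiTilde μ 0 = μ (X B) := by
  rw [psiTilde, tsum_eq_single 0]
  · simp
  · intro n hn; simp [hn]

theorem vartheta_eq_psi (μ : NCPoly B →ₗ[ℂ] B) : vartheta μ = psi μ := by
  ext b; simp only [vartheta, psi, pow_succ]

theorem hasSum_psi {μ : NCPoly B →ₗ[ℂ] B} (hμ : ∀ (b : B) p, μ (C B b * p) = b * μ p) {b a : B}
    (h : HasSum (fun n : ℕ => μ (X B * (C B b * X B) ^ n)) a) :
    HasSum (fun n : ℕ => μ ((C B b * X B) ^ (n + 1))) (b * a) := by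
  refine (h.mul_left b).congr_fun fun n => ?_
  rw [← hμ, pow_succ', mul_assoc]

/-- Regrouping `X (bX)ⁿ b = (Xb)ⁿ⁺¹` shows that `ϱ` is the same moment series multiplied by `b` on
the right. -/
theorem hasSum_varrho {μ : NCPoly B →ₗ[ℂ] B} (hμ : ∀ (b : B) p, μ (p * C B b) = μ p * b) {b a : B}
    (h : HasSum (fun n : ℕ => μ (X B * (C B b * X B) ^ n)) a) :
    HasSum (fun n : ℕ => μ (X B * C B b * (X B * C B b) ^ n)) (a * b) := by
  refine (h.mul_right b).congr_fun fun n => ?_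
  rw [← hμ, ← mul_pow_mul, mul_assoc (_ ^ n), ← pow_succ', pow_succ]

end MomentSeries

/-! ### Resolvents and expectations -/

theorem hasSum_mem_closed {A : Type*} [NormedRing A] {S : Set A} (hS : IsClosed S) (h0 : (0 : A) ∈ S)
    (hadd : ∀ x ∈ S, ∀ y ∈ S, x + y ∈ S) {f : ℕ → A} {a : A} (h : HasSum f a)
    (hf : ∀ n, f n ∈ S) : a ∈ S := by
  refine hS.mem_of_tendsto h.tendsto_sum_nat (Eventually.of_forall fun n => ?_)
  induction n with
  | zero => simpa using h0
  | succ n ih => rw [Finset.sum_range_succ]; exact hadd _ ih _ (hf n)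

namespace OVSpace

variable {A : Type v} {B : Type u} [CStarAlgebra A] [CStarAlgebra B] [PartialOrder B]
  [StarOrderedRing B] (V : OVSpace A B)

theorem E_nonneg (a : A) : 0 ≤ V.E (star a * a) := by
  simpa using V.completely_positive 1 (fun _ => a) (fun _ => 1)

/-- Positive linear maps between `C*`-algebras are bounded. As `A` carries no chosen order, the
spectral order is put on it. -/
theorem exists_norm_E_le : ∃ K : ℝ, 1 ≤ K ∧ ∀ a, ‖V.E a‖ ≤ K * ‖a‖ := by
  let _ := CStarAlgebra.spectralOrder A
  have := CStarAlgebra.spectralOrderedRing A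
  obtain ⟨K, hK⟩ := (PositiveLinearMap.mk₀ V.E fun x hx => by
    obtain ⟨c, rfl⟩ := CStarAlgebra.nonneg_iff_eq_star_mul_self.1 hx
    exact V.E_nonneg c).exists_norm_apply_le
  refine ⟨max K 1, le_max_right _ _, fun a => (hK a).trans ?_⟩
  gcongr
  exact le_max_left _ _

theorem continuous_E : Continuous V.E := by
  obtain ⟨K, -, hK⟩ := V.exists_norm_E_le
  exact (V.E.mkContinuous K hK).continuous

theorem E_star (a : A) : V.E (star a) = star (V.E a) := by
  let _ := CStarAlgebra.spectralOrder A
  have := CStarAlgebra.spectralOrderedRing A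
  exact map_star (PositiveLinearMap.mk₀ V.E fun x hx => by
    obtain ⟨c, rfl⟩ := CStarAlgebra.nonneg_iff_eq_star_mul_self.1 hx
    exact V.E_nonneg c) a

theorem norm_incl_le (b : B) : ‖V.incl b‖ ≤ ‖b‖ := NonUnitalStarAlgHom.norm_apply_le V.incl b

theorem continuous_incl : Continuous V.incl :=
  ((V.incl : B →ₐ[ℂ] A).toLinearMap.mkContinuous 1 fun b => by
    simpa using V.norm_incl_le b).continuous

theorem E_incl_mul (b : B) (a : A) : V.E (V.incl b * a) = b * V.E a := by
  simpa using V.bimodule b 1 a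

theorem E_mul_incl (a : A) (b : B) : V.E (a * V.incl b) = V.E a * b := by
  simpa using V.bimodule 1 b a

theorem E_incl (b : B) : V.E (V.incl b) = b := by
  simpa [V.unital] using V.E_incl_mul b 1

theorem dist_C_mul (a : A) (b : B) (p : NCPoly B) :
    V.dist a (C B b * p) = b * V.dist a p := by
  simp [dist, eval_C, E_incl_mul]

theorem dist_mul_C (a : A) (b : B) (p : NCPoly B) :
    V.dist a (p * C B b) = V.dist a p * b := by
  simp [dist, eval_C, E_mul_incl]

theorem dist_pow (a : A) (b : B) (n : ℕ) :
    V.dist a ((C B b * X B) ^ n) = V.E ((V.incl b * a) ^ n) := by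
  simp [dist, eval_C, eval_X]

theorem dist_X_mul_pow (a : A) (b : B) (n : ℕ) :
    V.dist a (X B * (C B b * X B) ^ n) = V.E (a * (V.incl b * a) ^ n) := by
  simp [dist, eval_C, eval_X]

theorem dist_pow' (a : A) (b : B) (n : ℕ) :
    V.dist a (X B * C B b * (X B * C B b) ^ n) = V.E ((a * V.incl b) ^ (n + 1)) := by
  simp [dist, eval_C, eval_X, pow_succ']

theorem exists_expBoundedBy (a : A) : ∃ M > 0, ExpBoundedBy M (V.dist a) := by
  obtain ⟨K, hK1, hK⟩ := V.exists_norm_E_le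
  have hK0 : 0 < K := by linarith
  -- The summand `1` keeps the constant positive when `a = 0`, and `1 ≤ K` allows the single factor
  -- `K` to be absorbed into `K ^ (n + 1)`.
  refine ⟨K * (‖a‖ + 1), by positivity, fun l => ?_⟩
  have h1 : V.dist a (word l) = V.E (a * (l.map fun b => V.incl b * a).prod) := by
    simp [dist, word, eval_X, map_list_prod, Function.comp_def, eval_C]
  have h2 : ∀ l : List B, ‖a * (l.map fun b => V.incl b * a).prod‖ ≤
      (‖a‖ + 1) ^ (l.length + 1) * (l.map fun b => ‖b‖).prod := by
    intro l
    induction l using List.reverseRecOn with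
    | nil => simp
    | append_singleton l b ih =>
      simp only [List.map_append, List.map_cons, List.map_nil, List.prod_append, List.prod_cons,
        List.prod_nil, mul_one, List.length_append, List.length_cons, List.length_nil]
      rw [← mul_assoc]
      calc _ ≤ ‖a * (l.map fun b => V.incl b * a).prod‖ * (‖b‖ * (‖a‖ + 1)) := by
            refine (norm_mul_le _ _).trans ?_
            gcongr
            refine (norm_mul_le _ _).trans ?_
            gcongr
            · exact V.norm_incl_le b
            · linarith
        _ ≤ (‖a‖ + 1) ^ (l.length + 1) * (l.map fun b => ‖b‖).prod * (‖b‖ * (‖a‖ + 1)) := by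
            gcongr
        _ = _ := by ring
  have h3 : 0 ≤ (l.map fun b => ‖b‖).prod := List.prod_nonneg (by simp)
  rw [h1]
  calc _ ≤ K * ((‖a‖ + 1) ^ (l.length + 1) * (l.map fun b => ‖b‖).prod) :=
        (hK _).trans (by gcongr; exact h2 l)
    _ ≤ K ^ (l.length + 1) * ((‖a‖ + 1) ^ (l.length + 1) * (l.map fun b => ‖b‖).prod) := by
        gcongr
        exact le_self_pow₀ hK1 (by omega)
    _ = _ := by rw [mul_pow]; ring

/-- The resolvent `(1 - b a)⁻¹`. -/
def res (a : A) (b : B) : A := Ring.inverse (1 - V.incl b * a)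

theorem eventually_norm_lt_one (a : A) : ∀ᶠ b in 𝓝 (0 : B), ‖V.incl b * a‖ < 1 := by
  have : Tendsto (fun b => ‖V.incl b * a‖) (𝓝 0) (𝓝 ‖V.incl 0 * a‖) :=
    ((V.continuous_incl.mul continuous_const).norm).tendsto 0
  simp only [map_zero, zero_mul, norm_zero] at this
  exact this.eventually (gt_mem_nhds one_pos)

theorem tendsto_res (a : A) : Tendsto (V.res a) (𝓝 0) (𝓝 1) := by
  have h1 : Tendsto (fun b => 1 - V.incl b * a) (𝓝 0) (𝓝 (1 - V.incl 0 * a)) :=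
    (continuous_const.sub (V.continuous_incl.mul continuous_const)).tendsto 0
  simp only [map_zero, zero_mul, sub_zero] at h1
  have h2 := (NormedRing.inverse_continuousAt (1 : Aˣ)).tendsto
  rw [Units.val_one, Ring.inverse_one] at h2
  exact h2.comp h1

section

variable {V} {a : A} {b : B}

theorem res_mul (h : ‖V.incl b * a‖ < 1) :
    V.res a b * (1 - V.incl b * a) = 1 :=
  Ring.inverse_mul_cancel _ (isUnit_one_sub_of_norm_lt_one h)

theorem mul_res (h : ‖V.incl b * a‖ < 1) :
    (1 - V.incl b * a) * V.res a b = 1 :=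
  Ring.mul_inverse_cancel _ (isUnit_one_sub_of_norm_lt_one h)

theorem hasSum_res (h : ‖V.incl b * a‖ < 1) :
    HasSum (fun n => (V.incl b * a) ^ n) (V.res a b) :=
  hasSum_geom_series_inverse _ h

theorem psi_dist (h : ‖V.incl b * a‖ < 1) :
    psi (V.dist a) b + 1 = V.E (V.res a b) := by
  have h1 : HasSum (fun n => V.dist a ((C B b * X B) ^ n)) (V.E (V.res a b)) := by
    simp only [dist_pow]
    exact (hasSum_res h).map V.E V.continuous_E
  have h2 := (hasSum_nat_add_iff' 1).2 h1
  simp only [Finset.range_one, Finset.sum_singleton, pow_zero] at h2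
  rw [psi, h2.tsum_eq]
  have : V.dist a 1 = 1 := by simpa [V.unital] using V.dist_pow a b 0
  rw [this]; abel

theorem psiTilde_dist (h : ‖V.incl b * a‖ < 1) :
    psiTilde (V.dist a) b = V.E (a * V.res a b) := by
  have h1 : HasSum (fun n => V.dist a (X B * (C B b * X B) ^ n)) (V.E (a * V.res a b)) := by
    simp only [dist_X_mul_pow]
    exact ((hasSum_res h).mul_left a).map V.E V.continuous_E
  exact h1.tsum_eq

end

theorem psi_dist_eq_mul (a : A) : ∀ᶠ b in 𝓝 0, psi (V.dist a) b = b * psiTilde (V.dist a) b := by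
  obtain ⟨M, hM, h⟩ := V.exists_expBoundedBy a
  filter_upwards [Metric.ball_mem_nhds (0 : B) (inv_pos.2 hM)] with b hb
  exact (hasSum_psi (V.dist_C_mul a) (hasSum_psiTilde hM h hb)).tsum_eq

/-! ### Independence of closures -/

theorem exists_approx {I : Type*} (S : I → Set A) : ∃ u : I × A → ℕ → A, ∀ p : I × A,
    p.2 ∈ closure (S p.1) → (∀ n, u p n ∈ S p.1) ∧ Tendsto (u p) atTop (𝓝 p.2) := by
  have : ∀ p : I × A, ∃ u : ℕ → A, p.2 ∈ closure (S p.1) →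
      (∀ n, u n ∈ S p.1) ∧ Tendsto u atTop (𝓝 p.2) := by
    intro p
    by_cases hp : p.2 ∈ closure (S p.1)
    · obtain ⟨u, hu⟩ := mem_closure_iff_seq_limit.1 hp
      exact ⟨u, fun _ => hu⟩
    · exact ⟨fun _ => 0, fun h => absurd h hp⟩
  choose u hu using this
  exact ⟨u, hu⟩

variable {V}

/-- Resolvents are norm limits of polynomials and lie only in the closed algebras, so independence
must pass to closures; continuity of `E` allows this. -/
theorem Free.closure {I : Type*} {S : I → Subalgebra ℂ A} (h : V.Free S) :
    V.Free fun i => (S i).topologicalClosure := by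
  refine ⟨fun i b => (S i).le_topologicalClosure (h.1 i b), fun l hl hS hc => ?_⟩
  obtain ⟨u, hu⟩ := exists_approx fun i => (S i : Set A)
  have hmem : ∀ p ∈ l, p.2 ∈ _root_.closure (S p.1 : Set A) := fun p hp => (hS p hp).1
  -- Approximants of a centred element need not be centred. Subtracting their means, which tend to
  -- `0`, does not change the limit.
  set w : I × A → ℕ → A := fun p n => u p n - V.incl (V.E (u p n))
  have hw : ∀ p ∈ l, Tendsto (w p) atTop (𝓝 p.2) := by
    intro p hp
    have h1 := (hu p (hmem p hp)).2
    have h2 := h1.sub (((V.continuous_incl.comp V.continuous_E).tendsto p.2).comp h1)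
    simpa [(hS p hp).2] using h2
  have hlim := (V.continuous_E.tendsto _).comp (tendsto_list_prod l hw)
  refine tendsto_nhds_unique hlim ?_
  refine tendsto_const_nhds.congr fun n => ?_
  have := h.2 (l.map fun p => (p.1, w p n)) (by simpa using hl) ?_
    (by simpa [Function.comp_def] using hc)
  · simpa [Function.comp_def] using this.symm
  · simp only [List.mem_map]
    rintro _ ⟨p, hp, rfl⟩
    exact ⟨sub_mem ((hu p (hmem p hp)).1 n) (h.1 _ _), by simp [w, E_incl]⟩

theorem BooleanIndep.closure {I : Type*} {S : I → NonUnitalSubalgebra ℂ A}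
    (h : V.BooleanIndep S) : V.BooleanIndep fun i => (S i).topologicalClosure := by
  intro l hl hS hc
  obtain ⟨u, hu⟩ := exists_approx fun i => (S i : Set A)
  have hmem : ∀ p ∈ l, p.2 ∈ _root_.closure (S p.1 : Set A) := hS
  have hw : ∀ p ∈ l, Tendsto (u p) atTop (𝓝 p.2) := fun p hp => (hu p (hmem p hp)).2
  have hlim := (V.continuous_E.tendsto _).comp (tendsto_list_prod l hw)
  have hlim' := tendsto_list_prod l (f := fun p n => V.E (u p n)) fun p hp =>
    (V.continuous_E.tendsto _).comp (hw p hp)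
  refine tendsto_nhds_unique hlim (hlim'.congr fun n => ?_)
  have := h (l.map fun p => (p.1, u p n)) (by simpa using hl) ?_
    (by simpa [Function.comp_def] using hc)
  · simpa [Function.comp_def] using this.symm
  · simp only [List.mem_map]
    rintro _ ⟨p, hp, rfl⟩
    exact (hu p (hmem p hp)).1 n

theorem MonotoneIndep.closure {I : Type*} [LinearOrder I] {S : I → NonUnitalSubalgebra ℂ A}
    (h : V.MonotoneIndep S) : V.MonotoneIndep fun i => (S i).topologicalClosure := by
  intro l₁ l₂ i a ha hl₁ hl₂ h₁ h₂
  obtain ⟨u, hu⟩ := exists_approx fun i => (S i : Set A)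
  have hw₁ : ∀ p ∈ l₁, Tendsto (u p) atTop (𝓝 p.2) := fun p hp => (hu p (hl₁ p hp)).2
  have hw₂ : ∀ p ∈ l₂, Tendsto (u p) atTop (𝓝 p.2) := fun p hp => (hu p (hl₂ p hp)).2
  have hwa : Tendsto (u (i, a)) atTop (𝓝 a) := (hu (i, a) ha).2
  have t₁ := tendsto_list_prod l₁ hw₁
  have t₂ := tendsto_list_prod l₂ hw₂
  have hlim := (V.continuous_E.tendsto _).comp ((t₁.mul hwa).mul t₂)
  have hlim' := (V.continuous_E.tendsto _).comp
    ((t₁.mul (((V.continuous_incl.comp V.continuous_E).tendsto a).comp hwa)).mul t₂)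
  refine tendsto_nhds_unique hlim (hlim'.congr fun n => ?_)
  have := h (l₁.map fun p => (p.1, u p n)) (l₂.map fun p => (p.1, u p n)) i (u (i, a) n)
    ((hu (i, a) ha).1 n) ?_ ?_ ?_ ?_
  · simpa [Function.comp_def] using this.symm
  · simp only [List.mem_map]
    rintro _ ⟨p, hp, rfl⟩
    exact (hu p (hl₁ p hp)).1 n
  · simp only [List.mem_map]
    rintro _ ⟨p, hp, rfl⟩
    exact (hu p (hl₂ p hp)).1 n
  · intro p hp
    simp only [List.getLast?_map, Option.mem_map] at hp
    obtain ⟨q, hq, rfl⟩ := hp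
    exact h₁ q hq
  · intro p hp
    simp only [List.head?_map, Option.mem_map] at hp
    obtain ⟨q, hq, rfl⟩ := hp
    exact h₂ q hq

end OVSpace

/-! ### Alternating products -/

/-- The list `[p, q, p, q, …, p, q]` of length `2 n`. -/
def altList {α : Type*} (p q : α) : ℕ → List α
  | 0 => []
  | n + 1 => p :: q :: altList p q n

theorem mem_altList {α : Type*} {p q x : α} {n : ℕ} (h : x ∈ altList p q n) : x = p ∨ x = q := by
  induction n with
  | zero => simp [altList] at h
  | succ n ih =>
    simp only [altList, List.mem_cons] at h
    tauto

theorem prod_altList {α M : Type*} [Monoid M] (f : α → M) (p q : α) (n : ℕ) :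
    ((altList p q n).map f).prod = (f p * f q) ^ n := by
  induction n with
  | zero => simp [altList]
  | succ n ih => simp [altList, ih, pow_succ', mul_assoc]

/-- The tail `l` is meant to be empty or `[p]`. With the optional initial letter of index `q.1`,
this covers all four shapes of alternating words in the expansions below. -/
theorem isChain_altList {I A : Type*} {p q : I × A} (h : p.1 ≠ q.1) {l : List (I × A)}
    (hl : (l.map Prod.fst).IsChain (· ≠ ·)) (hl' : ∀ x ∈ l.head?, x.1 = p.1) (n : ℕ) :
    ((altList p q n ++ l).map Prod.fst).IsChain (· ≠ ·) ∧
      ((q :: (altList p q n ++ l)).map Prod.fst).IsChain (· ≠ ·) := by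
  have key : ∀ m : List (I × A), (m.map Prod.fst).IsChain (· ≠ ·) →
      (∀ x ∈ m.head?, x.1 = p.1) → ((q :: m).map Prod.fst).IsChain (· ≠ ·) := by
    intro m hm hm'
    cases m with
    | nil => simp
    | cons x m =>
      simp only [List.map_cons, List.isChain_cons_cons] at hm ⊢
      exact ⟨by rw [hm' x (by simp)]; exact h.symm, hm⟩
  have hhead : ∀ n, ∀ x ∈ (altList p q n ++ l).head?, x.1 = p.1 := by
    intro n
    cases n with
    | zero => exact hl'
    | succ n => simp [altList]
  have main : ∀ n, ((altList p q n ++ l).map Prod.fst).IsChain (· ≠ ·) := by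
    intro n
    induction n with
    | zero => exact hl
    | succ n ih =>
      have := key _ ih (hhead n)
      simp only [altList, List.cons_append, List.map_cons, List.isChain_cons_cons] at this ⊢
      exact ⟨h, this⟩
  exact ⟨main n, key _ (main n) (hhead n)⟩

namespace OVSpace

variable {A : Type v} {B : Type u} [CStarAlgebra A] [CStarAlgebra B] [PartialOrder B]
  [StarOrderedRing B] {V : OVSpace A B} {I : Type*}

theorem hasSum_E_sandwich {p y z : A} (hp : ‖p‖ < 1) :
    HasSum (fun n => V.E (y * p ^ n * z)) (V.E (y * Ring.inverse (1 - p) * z)) :=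
  (((hasSum_geom_series_inverse p hp).mul_left y).mul_right z).map V.E V.continuous_E

/-- In the geometric expansion every word except the empty one is alternating with centred letters,
so only `E 1 = 1` survives. -/
theorem Free.E_alternating {S : I → Subalgebra ℂ A} (h : V.Free S) {i j : I} (hij : i ≠ j)
    {p q y : A} (hp : p ∈ S i) (hq : q ∈ S j) (hy : y ∈ S j) (hp0 : V.E p = 0) (hq0 : V.E q = 0)
    (hy0 : V.E y = 0) (hpq : ‖p * q‖ < 1) :
    V.E ((1 + y) * Ring.inverse (1 - p * q) * (1 + p)) = 1 := by
  have hlist : ∀ l : List (I × A), l ≠ [] → (∀ x ∈ l, x = (i, p) ∨ x = (j, q) ∨ x = (j, y)) →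
      (l.map Prod.fst).IsChain (· ≠ ·) → V.E (l.map Prod.snd).prod = 0 := by
    intro l hl hm hc
    refine h.2 l hl (fun x hx => ?_) hc
    rcases hm x hx with rfl | rfl | rfl
    · exact ⟨hp, hp0⟩
    · exact ⟨hq, hq0⟩
    · exact ⟨hy, hy0⟩
  have halt : ∀ n x, x ∈ altList (i, p) (j, q) n → x = (i, p) ∨ x = (j, q) ∨ x = (j, y) :=
    fun n x hx => (mem_altList hx).imp_right Or.inl
  have hprod : ∀ n, ((altList (i, p) (j, q) n).map Prod.snd).prod = (p * q) ^ n := fun n =>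
    prod_altList Prod.snd _ _ n
  have c1 := fun n => isChain_altList (p := (i, p)) (q := (j, q)) hij (l := []) (by simp)
    (by simp) n
  have c2 := fun n => isChain_altList (p := (i, p)) (q := (j, q)) hij (l := [(i, p)]) (by simp)
    (by simp) n
  have e1 : ∀ n, n ≠ 0 → V.E ((p * q) ^ n) = 0 := by
    intro n hn
    have := hlist (altList (i, p) (j, q) n ++ []) (by cases n <;> simp_all [altList])
      (by simpa using halt n) (c1 n).1
    simpa [hprod] using this
  have e2 : ∀ n, V.E ((p * q) ^ n * p) = 0 := by
    intro n
    have := hlist (altList (i, p) (j, q) n ++ [(i, p)]) (by simp)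
      (by
        intro x hx
        rcases List.mem_append.1 hx with hx | hx
        · exact halt n x hx
        · simp_all) (c2 n).1
    simpa [hprod] using this
  have e3 : ∀ n, V.E (y * (p * q) ^ n) = 0 := by
    intro n
    have := hlist ((j, y) :: (altList (i, p) (j, q) n ++ [])) (by simp)
      (by
        intro x hx
        rcases List.mem_cons.1 hx with hx | hx
        · simp [hx]
        · exact halt n x (by simpa using hx)) (c1 n).2
    simpa [hprod] using this
  have e4 : ∀ n, V.E (y * (p * q) ^ n * p) = 0 := by
    intro n
    have := hlist ((j, y) :: (altList (i, p) (j, q) n ++ [(i, p)])) (by simp)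
      (by
        intro x hx
        rcases List.mem_cons.1 hx with hx | hx
        · simp [hx]
        rcases List.mem_append.1 hx with hx | hx
        · exact halt n x hx
        · simp_all) (c2 n).2
    simpa [hprod, mul_assoc] using this
  have hs := hasSum_E_sandwich (V := V) (y := 1 + y) (z := 1 + p) hpq
  refine hs.unique ?_
  have hterm : ∀ n, V.E ((1 + y) * (p * q) ^ n * (1 + p)) = V.E ((p * q) ^ n) := by
    intro n
    have : (1 + y) * (p * q) ^ n * (1 + p) = (p * q) ^ n + (p * q) ^ n * p + y * (p * q) ^ n +
        y * (p * q) ^ n * p := by noncomm_ring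
    rw [this, map_add, map_add, map_add, e2, e3, e4]; simp
  simp only [hterm]
  have := hasSum_single (f := fun n => V.E ((p * q) ^ n)) 0 fun n hn => e1 n hn
  simpa [V.unital] using this

/-- Expectations of alternating words factor, so the geometric series in `A` turns term by term into
one in `B`. The scalar `r` stands apart because the algebras have no unit. -/
theorem BooleanIndep.E_alternating {S : I → NonUnitalSubalgebra ℂ A} (h : V.BooleanIndep S)
    {i j : I} (hij : i ≠ j) {p q y : A} (hp : p ∈ S i) (hq : q ∈ S j) (hy : y ∈ S j) (r : B)
    (hpq : ‖p * q‖ < 1) (hpq' : ‖V.E p * V.E q‖ < 1) :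
    V.E ((V.incl r + y) * Ring.inverse (1 - p * q) * (1 + p)) =
      (r + V.E y) * Ring.inverse (1 - V.E p * V.E q) * (1 + V.E p) := by
  have hlist : ∀ l : List (I × A), (∀ x ∈ l, x = (i, p) ∨ x = (j, q) ∨ x = (j, y)) →
      (l.map Prod.fst).IsChain (· ≠ ·) →
      V.E (l.map Prod.snd).prod = (l.map fun p => V.E p.2).prod := by
    intro l hm hc
    by_cases hl : l = []
    · simp [hl, V.unital]
    refine h l hl (fun x hx => ?_) hc
    rcases hm x hx with rfl | rfl | rfl
    · exact hp
    · exact hq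
    · exact hy
  have halt : ∀ n x, x ∈ altList (i, p) (j, q) n → x = (i, p) ∨ x = (j, q) ∨ x = (j, y) :=
    fun n x hx => (mem_altList hx).imp_right Or.inl
  have hprod : ∀ n, ((altList (i, p) (j, q) n).map Prod.snd).prod = (p * q) ^ n := fun n =>
    prod_altList Prod.snd _ _ n
  have hprod' : ∀ n, ((altList (i, p) (j, q) n).map fun x : I × A => V.E x.2).prod =
      (V.E p * V.E q) ^ n := fun n => prod_altList (fun x : I × A => V.E x.2) _ _ n
  have c1 := fun n => isChain_altList (p := (i, p)) (q := (j, q)) hij (l := []) (by simp)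
    (by simp) n
  have c2 := fun n => isChain_altList (p := (i, p)) (q := (j, q)) hij (l := [(i, p)]) (by simp)
    (by simp) n
  have e1 : ∀ n, V.E ((p * q) ^ n) = (V.E p * V.E q) ^ n := by
    intro n
    have := hlist (altList (i, p) (j, q) n ++ []) (by simpa using halt n) (c1 n).1
    simpa [hprod, hprod'] using this
  have e2 : ∀ n, V.E ((p * q) ^ n * p) = (V.E p * V.E q) ^ n * V.E p := by
    intro n
    have := hlist (altList (i, p) (j, q) n ++ [(i, p)])
      (by
        intro x hx
        rcases List.mem_append.1 hx with hx | hx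
        · exact halt n x hx
        · simp_all) (c2 n).1
    simpa [hprod, hprod'] using this
  have e3 : ∀ n, V.E (y * (p * q) ^ n) = V.E y * (V.E p * V.E q) ^ n := by
    intro n
    have := hlist ((j, y) :: (altList (i, p) (j, q) n ++ []))
      (by
        intro x hx
        rcases List.mem_cons.1 hx with hx | hx
        · simp [hx]
        · exact halt n x (by simpa using hx)) (c1 n).2
    simpa [hprod, hprod'] using this
  have e4 : ∀ n, V.E (y * (p * q) ^ n * p) = V.E y * (V.E p * V.E q) ^ n * V.E p := by
    intro n
    have := hlist ((j, y) :: (altList (i, p) (j, q) n ++ [(i, p)]))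
      (by
        intro x hx
        rcases List.mem_cons.1 hx with hx | hx
        · simp [hx]
        rcases List.mem_append.1 hx with hx | hx
        · exact halt n x hx
        · simp_all) (c2 n).2
    simpa [hprod, hprod', mul_assoc] using this
  have hs := hasSum_E_sandwich (V := V) (y := V.incl r + y) (z := 1 + p) hpq
  refine hs.unique ?_
  have hterm : ∀ n, V.E ((V.incl r + y) * (p * q) ^ n * (1 + p)) =
      (r + V.E y) * (V.E p * V.E q) ^ n * (1 + V.E p) := by
    intro n
    have : (V.incl r + y) * (p * q) ^ n * (1 + p) = V.incl r * (p * q) ^ n +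
        V.incl r * ((p * q) ^ n * p) + y * (p * q) ^ n + y * (p * q) ^ n * p := by noncomm_ring
    rw [this, map_add, map_add, map_add, E_incl_mul, E_incl_mul, e1, e2, e3, e4]
    noncomm_ring
  simp only [hterm]
  exact ((hasSum_geom_series_inverse _ hpq').mul_left _).mul_right _

/-- The factors `y` are replaced by their mean from left to right. After each replacement `V.incl
(V.E y) * x` is absorbed into the element of the lower algebra on its left, so the next `y` is again
a local maximum. -/
theorem MonotoneIndep.E_pow [LinearOrder I] {S : I → NonUnitalSubalgebra ℂ A}
    (h : V.MonotoneIndep S) {i j : I} (hij : i < j) {x y : A} (hx : x ∈ S i) (hy : y ∈ S j)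
    (hincl : ∀ p ∈ S i, ∀ b, p * V.incl b ∈ S i) (hincl' : ∀ b, V.incl b * x ∈ S i) (n : ℕ) :
    V.E ((y * x) ^ n) = V.E ((V.incl (V.E y) * x) ^ n) ∧
      V.E ((y * x) ^ n * y) = V.E ((V.incl (V.E y) * x) ^ n * V.incl (V.E y)) := by
  have hprod : ∀ n, ((altList (j, y) (i, x) n).map Prod.snd).prod = (y * x) ^ n := fun n =>
    prod_altList Prod.snd _ _ n
  have step : ∀ l₁ : List (I × A), (∀ p ∈ l₁, p.1 = i ∧ p.2 ∈ S i) → ∀ (n : ℕ),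
      (V.E ((l₁.map Prod.snd).prod * (y * x) ^ (n + 1)) =
        V.E ((l₁.map Prod.snd).prod * (V.incl (V.E y) * x) * (y * x) ^ n)) ∧
      (V.E ((l₁.map Prod.snd).prod * ((y * x) ^ (n + 1) * y)) =
        V.E ((l₁.map Prod.snd).prod * (V.incl (V.E y) * x) * ((y * x) ^ n * y))) ∧
      V.E ((l₁.map Prod.snd).prod * y) = V.E ((l₁.map Prod.snd).prod * V.incl (V.E y)) := by
    intro l₁ hl₁ n
    have hl₁' : ∀ p ∈ l₁, p.2 ∈ S p.1 := fun p hp => by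
      rw [(hl₁ p hp).1]; exact (hl₁ p hp).2
    have hlast : ∀ p ∈ l₁.getLast?, p.1 < j := fun p hp => by
      rw [(hl₁ p (List.mem_of_getLast? hp)).1]; exact hij
    have hmem : ∀ p ∈ altList (j, y) (i, x) n, p.2 ∈ S p.1 := by
      intro p hp
      rcases mem_altList hp with rfl | rfl
      · exact hy
      · exact hx
    refine ⟨?_, ?_, ?_⟩
    · have := h l₁ ((i, x) :: altList (j, y) (i, x) n) j y hy hl₁'
        (by
          intro p hp
          rcases List.mem_cons.1 hp with rfl | hp
          · exact hx
          · exact hmem p hp) hlast (by simpa using hij)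
      simpa [hprod, pow_succ', mul_assoc] using this
    · have := h l₁ ((i, x) :: (altList (j, y) (i, x) n ++ [(j, y)])) j y hy hl₁'
        (by
          intro p hp
          rcases List.mem_cons.1 hp with rfl | hp
          · exact hx
          rcases List.mem_append.1 hp with hp | hp
          · exact hmem p hp
          · rw [List.mem_singleton.1 hp]; exact hy) hlast (by simpa using hij)
      simpa [hprod, pow_succ', mul_assoc] using this
    · have := h l₁ [] j y hy hl₁' (by simp) hlast (by simp)
      simpa using this
  have main : ∀ n, ∀ p ∈ S i, V.E (p * (y * x) ^ n) = V.E (p * (V.incl (V.E y) * x) ^ n) ∧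
      V.E (p * ((y * x) ^ n * y)) = V.E (p * ((V.incl (V.E y) * x) ^ n * V.incl (V.E y))) := by
    intro n
    induction n with
    | zero =>
      intro p hp
      have := (step [(i, p)] (by simpa using hp) 0).2.2
      simpa using this
    | succ n ih =>
      intro p hp
      have hp' : p * (V.incl (V.E y) * x) ∈ S i := by
        rw [← mul_assoc]
        exact mul_mem (hincl p hp _) hx
      obtain ⟨s1, s2, -⟩ := step [(i, p)] (by simpa using hp) n
      simp only [List.map_cons, List.map_nil, List.prod_cons, List.prod_nil, mul_one] at s1 s2
      rw [s1, s2, (ih _ hp').1, (ih _ hp').2]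
      simp [pow_succ', mul_assoc]
  cases n with
  | zero => simp [E_incl]
  | succ n =>
    obtain ⟨s1, s2, -⟩ := step [] (by simp) n
    simp only [List.map_nil, List.prod_nil, one_mul] at s1 s2
    rw [s1, s2, (main n _ (hincl' _)).1, (main n _ (hincl' _)).2]
    simp [pow_succ', mul_assoc]

theorem MonotoneIndep.E_alternating [LinearOrder I] {S : I → NonUnitalSubalgebra ℂ A}
    (h : V.MonotoneIndep S) {i j : I} (hij : i < j) {x y : A} (hx : x ∈ S i) (hy : y ∈ S j)
    (hincl : ∀ p ∈ S i, ∀ b, p * V.incl b ∈ S i) (hincl' : ∀ b, V.incl b * x ∈ S i)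
    (hyx : ‖y * x‖ < 1) (hyx' : ‖V.incl (V.E y) * x‖ < 1) :
    V.E (Ring.inverse (1 - y * x) * (1 + y)) =
      V.E (Ring.inverse (1 - V.incl (V.E y) * x) * (1 + V.incl (V.E y))) := by
  have h1 := hasSum_E_sandwich (V := V) (y := 1) (z := 1 + y) hyx
  have h2 := hasSum_E_sandwich (V := V) (y := 1) (z := 1 + V.incl (V.E y)) hyx'
  simp only [one_mul] at h1 h2
  refine h1.unique (h2.congr_fun fun n => ?_)
  obtain ⟨e1, e2⟩ := h.E_pow hij hx hy hincl hincl' n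
  rw [mul_add, mul_add, mul_one, mul_one, map_add, map_add, e1, e2]

end OVSpace

/-! ### Resolvent identities -/

/-- The core is `P (1 - bxy) Q = r - (P - r)(y - 1)Q`, where `P - r` and `(y - 1)Q` belong to the
non-unital algebras of `x - 1` and `y - 1`. It is stated in an arbitrary ring because it is applied
twice: in `A` to the variables, and in `B` to their `η`-transforms. -/
theorem boolean_resolvent {R : Type*} [Ring R] {b x y r P Q U : R} (hP : P * (1 - b * x) = 1)
    (hQ : (1 - b * y) * Q = 1) (hQ' : Q * (1 - b * y) = 1) (hr : r * (1 - b) = 1)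
    (hr' : (1 - b) * r = 1) (hU : U * (1 - (1 - b) * (P - r) * ((y - 1) * Q)) = 1) :
    Q * U * ((1 - b) * P) * (1 - b * (x * y)) = 1 := by
  have a1 : P * (b * x) = P - 1 := by rw [mul_sub, mul_one] at hP; rw [← hP]; abel
  have a2 : b * y * Q = Q - 1 := by rw [sub_mul, one_mul] at hQ; rw [← hQ]; abel
  have a3 : r * b = r - 1 := by rw [mul_sub, mul_one] at hr; rw [← hr]; abel
  have a4 : r * (y * Q) - y * Q = r * Q - r := by
    calc r * (y * Q) - y * Q = (r - 1) * (y * Q) := by noncomm_ring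
      _ = r * (b * y * Q) := by rw [← a3]; noncomm_ring
      _ = r * Q - r := by rw [a2]; noncomm_ring
  have key : P * (1 - b * (x * y)) * Q = r - (P - r) * ((y - 1) * Q) := by
    calc P * (1 - b * (x * y)) * Q = P * Q - P * (b * x) * (y * Q) := by noncomm_ring
      _ = P * Q - P * (y * Q) + r * (y * Q) - (r * (y * Q) - y * Q) := by
          rw [a1]; noncomm_ring
      _ = _ := by rw [a4]; noncomm_ring
  calc Q * U * ((1 - b) * P) * (1 - b * (x * y))
      = Q * U * ((1 - b) * P) * (1 - b * (x * y)) * (Q * (1 - b * y)) := by rw [hQ', mul_one]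
    _ = Q * U * ((1 - b) * (P * (1 - b * (x * y)) * Q)) * (1 - b * y) := by noncomm_ring
    _ = Q * (U * ((1 - b) * r - (1 - b) * (P - r) * ((y - 1) * Q))) * (1 - b * y) := by
        rw [key]; noncomm_ring
    _ = 1 := by rw [hr', hU, mul_one, hQ']

/-- With `p = W' s P s' - 1` and `q = W' s y Q - 1`, the core is `(1 + p)(1 - s a x y) Q = 1 - p q`.
The relation between `c`, `w` and `s` removes the cross terms, and `p`, `q` will be centred when `s`
is the `S`-transform of `y`. -/
theorem free_resolvent {R : Type*} [Ring R] {a c x y s s' w W' P Q U : R}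
    (hP : P * (1 - a * x) = 1) (hQ : (1 - c * y) * Q = 1) (hQ' : Q * (1 - c * y) = 1)
    (hs : s' * s = 1) (hW' : W' * (1 + w) = 1) (hc : c = W' * w * s)
    (hU : U * (1 - (W' * s * P * s' - 1) * (W' * s * y * Q - 1)) = 1) :
    Q * U * (W' * s * P * s') * (1 - s * a * (x * y)) = 1 := by
  have a1 : P * (a * x) = P - 1 := by rw [mul_sub, mul_one] at hP; rw [← hP]; abel
  have a2 : c * y * Q = Q - 1 := by rw [sub_mul, one_mul] at hQ; rw [← hQ]; abel
  have a3 : W' * w = 1 - W' := by rw [mul_add, mul_one] at hW'; rw [← hW']; abel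
  have a4 : s * y * Q - W' * s * y * Q = Q - 1 := by
    rw [← a2, hc, a3]; noncomm_ring
  have key : W' * s * P * s' * (1 - s * a * (x * y)) * Q =
      1 - (W' * s * P * s' - 1) * (W' * s * y * Q - 1) := by
    calc W' * s * P * s' * (1 - s * a * (x * y)) * Q
        = W' * s * P * s' * Q - W' * s * (P * ((s' * s) * (a * x))) * (y * Q) := by noncomm_ring
      _ = W' * s * P * s' * (Q - 1 + 1) - W' * s * (P - 1) * (y * Q) := by
          rw [hs, one_mul, a1]; noncomm_ring
      _ = W' * s * P * (s' * s) * y * Q - W' * s * P * s' * (W' * s * y * Q) + W' * s * P * s' -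
            W' * s * (P - 1) * (y * Q) := by
          rw [← a4]; noncomm_ring
      _ = _ := by rw [hs]; noncomm_ring
  calc Q * U * (W' * s * P * s') * (1 - s * a * (x * y))
      = Q * U * (W' * s * P * s') * (1 - s * a * (x * y)) * (Q * (1 - c * y)) := by
        rw [hQ', mul_one]
    _ = Q * U * (W' * s * P * s' * (1 - s * a * (x * y)) * Q) * (1 - c * y) := by noncomm_ring
    _ = Q * (U * (1 - (W' * s * P * s' - 1) * (W' * s * y * Q - 1))) * (1 - c * y) := by
        rw [key]; noncomm_ring
    _ = 1 := by rw [hU, mul_one, hQ']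

theorem inverse_eq_of_mul_eq_one {R : Type*} [Ring R] {a b : R} (hb : IsUnit b) (h : a * b = 1) :
    Ring.inverse b = a := by
  calc Ring.inverse b = a * b * Ring.inverse b := by rw [h, one_mul]
    _ = a := by rw [mul_assoc, Ring.mul_inverse_cancel _ hb, mul_one]

theorem isUnit_of_tendsto_one {R α : Type*} [NormedRing R] [CompleteSpace R] {l : Filter α}
    {f : α → R} (h : Tendsto f l (𝓝 1)) : ∀ᶠ x in l, IsUnit (f x) :=
  h.eventually ((Units.isOpen (R := R)).mem_nhds isUnit_one)

theorem norm_lt_one_of_tendsto_zero {R α : Type*} [NormedRing R] {l : Filter α}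
    {f : α → R} (h : Tendsto f l (𝓝 0)) : ∀ᶠ x in l, ‖f x‖ < 1 := by
  have := h.norm
  rw [norm_zero] at this
  exact this.eventually (gt_mem_nhds one_pos)

/-! ### Closed bimodule algebras and the moment series of products of independent variables. -/

namespace OVSpace

variable {A : Type v} {B : Type u} [CStarAlgebra A] [CStarAlgebra B] [PartialOrder B]
  [StarOrderedRing B] (V : OVSpace A B)

theorem mem_bimoduleAlg (a : A) : a ∈ V.bimoduleAlg a :=
  NonUnitalAlgebra.subset_adjoin ℂ ⟨1, 1, by simp⟩

theorem incl_mul_mem {a m : A} (b : B) (hm : m ∈ V.bimoduleAlg a) :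
    V.incl b * m ∈ V.bimoduleAlg a := by
  induction hm using NonUnitalAlgebra.adjoin_induction with
  | mem z hz =>
    obtain ⟨c, d, rfl⟩ := hz
    exact NonUnitalAlgebra.subset_adjoin ℂ ⟨b * c, d, by simp [mul_assoc]⟩
  | add x y _ _ hx hy => rw [mul_add]; exact add_mem hx hy
  | zero => rw [mul_zero]; exact zero_mem _
  | mul x y _ hy hx _ => rw [← mul_assoc]; exact mul_mem hx hy
  | smul r x _ hx => rw [mul_smul_comm]; exact SMulMemClass.smul_mem r hx

theorem mul_incl_mem {a m : A} (b : B) (hm : m ∈ V.bimoduleAlg a) :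
    m * V.incl b ∈ V.bimoduleAlg a := by
  induction hm using NonUnitalAlgebra.adjoin_induction with
  | mem z hz =>
    obtain ⟨c, d, rfl⟩ := hz
    exact NonUnitalAlgebra.subset_adjoin ℂ ⟨c, d * b, by simp [mul_assoc]⟩
  | add x y _ _ hx hy => rw [add_mul]; exact add_mem hx hy
  | zero => rw [zero_mul]; exact zero_mem _
  | mul x y hx _ _ hy => rw [mul_assoc]; exact mul_mem hx hy
  | smul r x _ hx => rw [smul_mul_assoc]; exact SMulMemClass.smul_mem r hx

/-- The closure of the bimodule algebra of `a`. -/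
def closedAlg (a : A) : NonUnitalSubalgebra ℂ A := (V.bimoduleAlg a).topologicalClosure

theorem isClosed_closedAlg (a : A) : IsClosed (V.closedAlg a : Set A) :=
  (V.bimoduleAlg a).isClosed_topologicalClosure

theorem mem_closedAlg (a : A) : a ∈ V.closedAlg a :=
  (V.bimoduleAlg a).le_topologicalClosure (V.mem_bimoduleAlg a)

theorem incl_mul_mem_closedAlg {a m : A} (b : B) (hm : m ∈ V.closedAlg a) :
    V.incl b * m ∈ V.closedAlg a :=
  map_mem_closure (continuous_const_mul (V.incl b)) hm fun _ h => V.incl_mul_mem b h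

theorem mul_incl_mem_closedAlg {a m : A} (b : B) (hm : m ∈ V.closedAlg a) :
    m * V.incl b ∈ V.closedAlg a :=
  map_mem_closure (f := fun z => z * V.incl b) (continuous_mul_const (V.incl b)) hm
    fun _ h => V.mul_incl_mem b h

variable {V}

/-- Only invariance under left multiplication by `x` is required, not membership of `x`: with `a = x
- 1` the variable `x` itself contains the unit. -/
theorem res_mul_mem_closedAlg {x a m : A} {b : B} (h : ‖V.incl b * x‖ < 1)
    (hx : ∀ m ∈ V.closedAlg a, x * m ∈ V.closedAlg a) (hm : m ∈ V.closedAlg a) :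
    V.res x b * m ∈ V.closedAlg a := by
  refine hasSum_mem_closed (V.isClosed_closedAlg a) (zero_mem _) (fun _ h _ h' => add_mem h h')
    ((hasSum_res h).mul_right m) fun n => ?_
  induction n with
  | zero => simpa using hm
  | succ n ih =>
    rw [pow_succ', mul_assoc, mul_assoc]
    exact V.incl_mul_mem_closedAlg b (hx _ ih)

theorem mul_res_mem_closedAlg {x a m : A} {b : B} (h : ‖V.incl b * x‖ < 1)
    (hx : ∀ m ∈ V.closedAlg a, m * x ∈ V.closedAlg a) (hm : m ∈ V.closedAlg a) :
    m * V.res x b ∈ V.closedAlg a := by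
  refine hasSum_mem_closed (V.isClosed_closedAlg a) (zero_mem _) (fun _ h _ h' => add_mem h h')
    ((hasSum_res h).mul_left m) fun n => ?_
  induction n with
  | zero => simpa using hm
  | succ n ih =>
    rw [pow_succ, ← mul_assoc, ← mul_assoc]
    exact hx _ (V.mul_incl_mem_closedAlg b ih)

theorem res_mem_closure {x : A} {b : B} (h : ‖V.incl b * x‖ < 1) :
    V.res x b ∈ (V.unitalAlg x).topologicalClosure := by
  refine hasSum_mem_closed (V.unitalAlg x).isClosed_topologicalClosure (zero_mem _)
    (fun _ h _ h' => add_mem h h') (hasSum_res h) fun n => pow_mem (mul_mem ?_ ?_) n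
  · exact (V.unitalAlg x).le_topologicalClosure
      (Algebra.subset_adjoin (mem_insert_of_mem _ ⟨b, rfl⟩))
  · exact (V.unitalAlg x).le_topologicalClosure (Algebra.subset_adjoin (mem_insert _ _))

theorem tendsto_E_res (x : A) : Tendsto (fun b => V.E (V.res x b)) (𝓝 0) (𝓝 1) := by
  have := (V.continuous_E.tendsto _).comp (V.tendsto_res x)
  rwa [V.unital] at this

/-- The mean of the resolvent is `(1 - b η(b))⁻¹`: under `E` the variable behaves like the element
`η(b)` of `B`, which is why Boolean products multiply the `η`-transforms. -/
theorem eta_dist (x : A) : ∀ᶠ b in 𝓝 0, IsUnit (V.E (V.res x b)) ∧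
    V.E (V.res x b) * (1 - b * eta (V.dist x) b) = 1 ∧
    (1 - b * eta (V.dist x) b) * V.E (V.res x b) = 1 ∧
    eta (V.dist x) b * V.E (V.res x b) = V.E (x * V.res x b) := by
  filter_upwards [isUnit_of_tendsto_one (V.tendsto_E_res x), V.eventually_norm_lt_one x,
    V.psi_dist_eq_mul x] with b hu hb hpsi
  have h1 : eta (V.dist x) b = V.E (x * V.res x b) * Ring.inverse (V.E (V.res x b)) := by
    rw [eta, psi_dist hb, psiTilde_dist hb]
  have h2 : b * V.E (x * V.res x b) = V.E (V.res x b) - 1 := by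
    rw [← psiTilde_dist hb, ← hpsi, ← psi_dist hb]; abel
  have h3 : 1 - b * eta (V.dist x) b = Ring.inverse (V.E (V.res x b)) := by
    rw [h1, ← mul_assoc, h2, sub_mul, Ring.mul_inverse_cancel _ hu]; noncomm_ring
  refine ⟨hu, ?_, ?_, ?_⟩
  · rw [h3, Ring.mul_inverse_cancel _ hu]
  · rw [h3, Ring.inverse_mul_cancel _ hu]
  · rw [h1, mul_assoc, Ring.inverse_mul_cancel _ hu, mul_one]

/-- The moment series of a product of Boolean independent variables. -/
theorem BooleanIndep.psi_mul {x y : A}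
    (h : V.BooleanIndep ![V.bimoduleAlg (x - 1), V.bimoduleAlg (y - 1)]) :
    ∀ᶠ b in 𝓝 0, psi (V.dist (x * y)) b + 1 =
      Ring.inverse (1 - b * (eta (V.dist x) b * eta (V.dist y) b)) := by
  have hinv : Tendsto (fun b : B => Ring.inverse (1 - b)) (𝓝 0) (𝓝 1) := by
    have h1 : Tendsto (fun b : B => 1 - b) (𝓝 0) (𝓝 (1 - 0)) :=
      Continuous.tendsto (by fun_prop) 0
    have h2 := (NormedRing.inverse_continuousAt (1 : Bˣ)).tendsto
    rw [Units.val_one, Ring.inverse_one] at h2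
    rw [sub_zero] at h1
    exact h2.comp h1
  have hinv' : Tendsto (fun b : B => V.incl (Ring.inverse (1 - b))) (𝓝 0) (𝓝 1) := by
    have := (V.continuous_incl.tendsto 1).comp hinv
    rwa [map_one] at this
  have hsub' : Tendsto (fun b : B => V.incl (1 - b)) (𝓝 0) (𝓝 1) := by
    have : Tendsto (fun b : B => V.incl (1 - b)) (𝓝 0) (𝓝 (V.incl (1 - 0))) :=
      (V.continuous_incl.comp (continuous_const.sub continuous_id)).tendsto 0
    simpa using this
  -- Subtracting the resolvent of the unit leaves an element generated by `x - 1`; the factor `1 -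
  -- b` normalises so that `(1 - b) V.res x b = 1 + p b`.
  set p : B → A := fun b => V.incl (1 - b) * (V.res x b - V.incl (Ring.inverse (1 - b)))
  set q : B → A := fun b => (y - 1) * V.res y b
  have hp : Tendsto p (𝓝 0) (𝓝 0) := by
    have := hsub'.mul ((V.tendsto_res x).sub hinv')
    rwa [sub_self, mul_zero] at this
  have hq : Tendsto q (𝓝 0) (𝓝 (y - 1)) := by
    simpa using (V.tendsto_res y).const_mul (y - 1)
  have hpE : Tendsto (fun b => V.E (p b)) (𝓝 0) (𝓝 0) := by
    have := (V.continuous_E.tendsto _).comp hp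
    rwa [map_zero] at this
  have hqE : Tendsto (fun b => V.E (q b)) (𝓝 0) (𝓝 (V.E (y - 1))) :=
    (V.continuous_E.tendsto _).comp hq
  have hpq : Tendsto (fun b => p b * q b) (𝓝 0) (𝓝 0) := by simpa using hp.mul hq
  have hpqE : Tendsto (fun b => V.E (p b) * V.E (q b)) (𝓝 0) (𝓝 0) := by simpa using hpE.mul hqE
  filter_upwards [norm_lt_one_of_tendsto_zero hpq, norm_lt_one_of_tendsto_zero hpqE,
    V.eventually_norm_lt_one x, V.eventually_norm_lt_one y, V.eventually_norm_lt_one (x * y),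
    norm_lt_one_of_tendsto_zero (tendsto_id (x := 𝓝 (0 : B))), eta_dist x, eta_dist y]
    with b l1 l2 l3 l4 l5 l6 ex ey
  obtain ⟨ux, ex1, ex2, ex3⟩ := ex
  obtain ⟨uy, ey1, ey2, ey3⟩ := ey
  have ub : IsUnit (1 - b) := isUnit_one_sub_of_norm_lt_one l6
  set r := Ring.inverse (1 - b)
  have hr : r * (1 - b) = 1 := Ring.inverse_mul_cancel _ ub
  have hr' : (1 - b) * r = 1 := Ring.mul_inverse_cancel _ ub
  have hrA : V.incl r * (1 - V.incl b) = 1 := by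
    rw [← map_one V.incl, ← map_sub, ← map_mul, hr]
  have hrA' : (1 - V.incl b) * V.incl r = 1 := by
    rw [← map_one V.incl, ← map_sub, ← map_mul, hr']
  have hincl : V.incl (1 - b) = 1 - V.incl b := by rw [map_sub, map_one]
  have hpb : p b = (1 - V.incl b) * (V.res x b - V.incl r) := by simp only [p, hincl, r]
  have hpmem : p b ∈ V.closedAlg (x - 1) := by
    have e1 : V.res x b - V.incl r = V.res x b * (V.incl b * (x - 1) * V.incl r) := by
      calc V.res x b - V.incl r = V.res x b * ((1 - V.incl b) * V.incl r) -
            (V.res x b * (1 - V.incl b * x)) * V.incl r := by rw [hrA', res_mul l3]; simp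
        _ = _ := by noncomm_ring
    have : p b = V.incl (1 - b) * (V.res x b * (V.incl b * (x - 1) * V.incl r)) := by
      rw [← e1]
    rw [this]
    refine V.incl_mul_mem_closedAlg _ (res_mul_mem_closedAlg l3 (fun m hm => ?_)
      (V.mul_incl_mem_closedAlg _ (V.incl_mul_mem_closedAlg _ (V.mem_closedAlg _))))
    have : x * m = (x - 1) * m + m := by noncomm_ring
    rw [this]
    exact add_mem (mul_mem (V.mem_closedAlg _) hm) hm
  have hqmem : q b ∈ V.closedAlg (y - 1) := by
    refine mul_res_mem_closedAlg l4 (fun m hm => ?_) (V.mem_closedAlg _)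
    have : m * y = m * (y - 1) + m := by noncomm_ring
    rw [this]
    exact add_mem (mul_mem hm (V.mem_closedAlg _)) hm
  have hEp : V.E (p b) = (1 - b) * (V.E (V.res x b) - r) := by
    simp only [p]
    rw [E_incl_mul, map_sub, E_incl]
  have hEq : V.E (q b) = (eta (V.dist y) b - 1) * V.E (V.res y b) := by
    simp only [q]
    rw [sub_mul, one_mul, map_sub, sub_mul, one_mul, ey3]
  -- This is the outer factor `r + y` of the alternating expansion: a scalar plus an element of the
  -- algebra of `y - 1`.
  have hQ : V.res y b = V.incl r + V.incl (r * b) * q b := by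
    have : (1 - V.incl b) * V.res y b = 1 + V.incl b * q b := by
      simp only [q]
      calc _ = (1 - V.incl b * y) * V.res y b + V.incl b * ((y - 1) * V.res y b) := by
            noncomm_ring
        _ = _ := by rw [mul_res l4]
    calc V.res y b = V.incl r * ((1 - V.incl b) * V.res y b) := by
          rw [← mul_assoc, hrA, one_mul]
      _ = _ := by rw [this, map_mul]; noncomm_ring
  have hP : (1 - V.incl b) * V.res x b = 1 + p b := by
    rw [hpb, mul_sub, hrA']; abel
  set U := Ring.inverse (1 - p b * q b)
  have hU : U * (1 - p b * q b) = 1 :=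
    Ring.inverse_mul_cancel _ (isUnit_one_sub_of_norm_lt_one l1)
  have hres : V.res (x * y) b = V.res y b * U * ((1 - V.incl b) * V.res x b) := by
    refine inverse_eq_of_mul_eq_one (isUnit_one_sub_of_norm_lt_one l5) ?_
    refine boolean_resolvent (res_mul l3) (mul_res l4) (res_mul l4) hrA hrA' ?_
    rw [← hpb]
    exact hU
  have hmain := (BooleanIndep.closure h).E_alternating (i := 0) (j := 1) (by simp)
    (show p b ∈ (![V.bimoduleAlg (x - 1), V.bimoduleAlg (y - 1)] 0).topologicalClosure from hpmem)
    (show q b ∈ (![V.bimoduleAlg (x - 1), V.bimoduleAlg (y - 1)] 1).topologicalClosure from hqmem)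
    (show V.incl (r * b) * q b ∈
      (![V.bimoduleAlg (x - 1), V.bimoduleAlg (y - 1)] 1).topologicalClosure from
      V.incl_mul_mem_closedAlg _ hqmem) r l1 l2
  rw [← hQ, ← hP, ← hres, ← psi_dist l5] at hmain
  rw [hmain]
  have hQE : V.E (V.res y b) = r + V.E (V.incl (r * b) * q b) := by
    conv_lhs => rw [hQ]
    rw [map_add, E_incl]
  have hPE : (1 - b) * V.E (V.res x b) = 1 + V.E (p b) := by
    rw [hEp, mul_sub, hr']; abel
  rw [← hQE, ← hPE]
  have hUE := Ring.inverse_mul_cancel _ (isUnit_one_sub_of_norm_lt_one l2)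
  -- The same identity, now in `B` with the `η`-transforms as variables, identifies the factored
  -- expectation as the inverse of `1 - b η_x(b) η_y(b)`.
  have hleft := boolean_resolvent (U := Ring.inverse (1 - V.E (p b) * V.E (q b))) ex1 ey2 ey1 hr hr'
    (by rw [← hEp, ← hEq]; exact hUE)
  refine (inverse_eq_of_mul_eq_one ?_ hleft).symm
  have hunit : IsUnit (V.E (V.res y b) * Ring.inverse (1 - V.E (p b) * V.E (q b)) *
      ((1 - b) * V.E (V.res x b))) := by
    refine (uy.mul (IsUnit.ringInverse ?_)).mul (ub.mul ux)
    exact isUnit_one_sub_of_norm_lt_one l2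
  obtain ⟨u, hu⟩ := hunit
  rw [← hu] at hleft
  exact ⟨u⁻¹, (Units.inv_eq_of_mul_eq_one_right hleft)⟩

/-- The moment series of a product of monotone independent variables. -/
theorem MonotoneIndep.psi_mul {x y : A}
    (h : V.MonotoneIndep ![V.bimoduleAlg (x - 1), V.bimoduleAlg y]) :
    ∀ᶠ b in 𝓝 0, psi (V.dist (y * x)) b = psi (V.dist x) (kappa (V.dist y) b) := by
  set q : B → A := fun b => V.res y b - 1
  have hq : Tendsto q (𝓝 0) (𝓝 0) := by simpa using (V.tendsto_res y).sub_const 1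
  have hqE : Tendsto (fun b => V.E (q b)) (𝓝 0) (𝓝 0) := by
    have := (V.continuous_E.tendsto _).comp hq
    rwa [map_zero] at this
  have hqx : Tendsto (fun b => q b * (x - 1)) (𝓝 0) (𝓝 0) := by
    simpa using hq.mul_const (x - 1)
  have hqEx : Tendsto (fun b => V.incl (V.E (q b)) * (x - 1)) (𝓝 0) (𝓝 0) := by
    have := ((V.continuous_incl.tendsto _).comp hqE).mul_const (x - 1)
    simpa using this
  have hk : ∀ᶠ b in 𝓝 0, kappa (V.dist y) b = Ring.inverse (1 + V.E (q b)) * V.E (q b) := by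
    filter_upwards [V.eventually_norm_lt_one y] with b hb
    have : vartheta (V.dist y) b = V.E (q b) := by
      rw [vartheta_eq_psi, eq_sub_of_add_eq (psi_dist hb), map_sub, V.unital]
    rw [kappa, this]
  have hkT : Tendsto (kappa (V.dist y)) (𝓝 0) (𝓝 0) := by
    have h2 := (NormedRing.inverse_continuousAt (1 : Bˣ)).tendsto
    rw [Units.val_one, Ring.inverse_one] at h2
    have h1 : Tendsto (fun b => 1 + V.E (q b)) (𝓝 0) (𝓝 1) := by simpa using hqE.const_add 1
    have := (h2.comp h1).mul hqE
    rw [mul_zero] at this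
    exact this.congr' (hk.mono fun b hb => hb.symm)
  have h1T : Tendsto (fun b => 1 + V.E (q b)) (𝓝 0) (𝓝 1) := by simpa using hqE.const_add 1
  filter_upwards [norm_lt_one_of_tendsto_zero hqx, norm_lt_one_of_tendsto_zero hqEx,
    V.eventually_norm_lt_one y, V.eventually_norm_lt_one (y * x), hk,
    hkT.eventually (V.eventually_norm_lt_one x), isUnit_of_tendsto_one h1T]
    with b l1 l2 l3 l4 hkb l5 hu
  rw [eq_sub_of_add_eq (psi_dist l4), eq_sub_of_add_eq (psi_dist l5)]
  have hqmem : q b ∈ V.closedAlg y := by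
    have : q b = V.res y b * (V.incl b * y) := by
      have := res_mul l3
      rw [mul_sub, mul_one] at this
      simp only [q]
      rw [← this]; abel
    rw [this]
    exact res_mul_mem_closedAlg l3 (fun m hm => mul_mem (V.mem_closedAlg _) hm)
      (V.incl_mul_mem_closedAlg _ (V.mem_closedAlg _))
  have hmain := (MonotoneIndep.closure h).E_alternating (i := 0) (j := 1) (by simp)
    (show x - 1 ∈ (![V.bimoduleAlg (x - 1), V.bimoduleAlg y] 0).topologicalClosure from
      V.mem_closedAlg _)
    (show q b ∈ (![V.bimoduleAlg (x - 1), V.bimoduleAlg y] 1).topologicalClosure from hqmem)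
    (fun p hp b => V.mul_incl_mem_closedAlg (a := x - 1) b hp)
    (fun b => V.incl_mul_mem_closedAlg (a := x - 1) b (V.mem_closedAlg _)) l1 l2
  have e1 : V.res (y * x) b = Ring.inverse (1 - q b * (x - 1)) * (1 + q b) := by
    refine inverse_eq_of_mul_eq_one (isUnit_one_sub_of_norm_lt_one l4) ?_
    -- Writing the resolvent of `y` as `1 + q` exposes the letters `q` and `x - 1` of the two
    -- algebras.
    have : (1 + q b) * (1 - V.incl b * (y * x)) = 1 - q b * (x - 1) := by
      have h3 := res_mul l3
      rw [mul_sub, mul_one, sub_eq_iff_eq_add] at h3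
      have h4 : V.res y b * (V.incl b * y) = V.res y b - 1 := by
        rw [eq_sub_iff_add_eq, add_comm]; exact h3.symm
      simp only [q]
      calc _ = V.res y b - V.res y b * (V.incl b * y) * x := by noncomm_ring
        _ = _ := by rw [h4]; noncomm_ring
    rw [mul_assoc, this, Ring.inverse_mul_cancel _ (isUnit_one_sub_of_norm_lt_one l1)]
  have e2 : V.res x (kappa (V.dist y) b) =
      Ring.inverse (1 - V.incl (V.E (q b)) * (x - 1)) * (1 + V.incl (V.E (q b))) := by
    refine inverse_eq_of_mul_eq_one (isUnit_one_sub_of_norm_lt_one l5) ?_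
    -- `κ` is characterised by `(1 + E q) κ = E q`. Hence replacing `q` by its mean in the
    -- factorisation produces precisely the resolvent of `x` at `κ`.
    have : (1 + V.incl (V.E (q b))) * (1 - V.incl (kappa (V.dist y) b) * x) =
        1 - V.incl (V.E (q b)) * (x - 1) := by
      have h3 : (1 + V.incl (V.E (q b))) * V.incl (kappa (V.dist y) b) = V.incl (V.E (q b)) := by
        rw [hkb, ← map_one V.incl, ← map_add, ← map_mul, Ring.mul_inverse_cancel_left _ _ hu]
      calc _ = 1 + V.incl (V.E (q b)) -
            (1 + V.incl (V.E (q b))) * V.incl (kappa (V.dist y) b) * x := by noncomm_ring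
        _ = _ := by rw [h3]; noncomm_ring
    rw [mul_assoc, this, Ring.inverse_mul_cancel _ (isUnit_one_sub_of_norm_lt_one l2)]
  rw [e1, e2, hmain]

/-- The moment series of a product of free variables at `s(w) a(w)`, where `a(w)` and `s(w)` are
given by the moment series of the factors. -/
theorem Free.psi_mul {x y : A} (h : V.Free ![V.unitalAlg x, V.unitalAlg y]) {s a c : B → B}
    {s₀ : B} (hs₀ : IsUnit s₀) (hs : Tendsto s (𝓝 0) (𝓝 s₀)) (ha : Tendsto a (𝓝 0) (𝓝 0))
    (hc : Tendsto c (𝓝 0) (𝓝 0))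
    (hx : ∀ᶠ w in 𝓝 0, s w * psi (V.dist x) (a w) = w * s w)
    (hy : ∀ᶠ w in 𝓝 0, s w * psiTilde (V.dist y) (c w) = 1 + w)
    (hc' : ∀ᶠ w in 𝓝 0, psi (V.dist y) (c w) = w)
    (hcs : ∀ᶠ w in 𝓝 0, (1 + w) * c w = w * s w) :
    ∀ᶠ w in 𝓝 0, psi (V.dist (x * y)) (s w * a w) = w := by
  have hW : Tendsto (fun w : B => 1 + w) (𝓝 0) (𝓝 1) := by
    have : Tendsto (fun w : B => 1 + w) (𝓝 0) (𝓝 (1 + 0)) := Continuous.tendsto (by fun_prop) 0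
    rwa [add_zero] at this
  have hW' : Tendsto (fun w : B => Ring.inverse (1 + w)) (𝓝 0) (𝓝 1) := by
    have h2 := (NormedRing.inverse_continuousAt (1 : Bˣ)).tendsto
    rw [Units.val_one, Ring.inverse_one] at h2
    exact h2.comp hW
  have hs' : Tendsto (fun w : B => Ring.inverse (s w)) (𝓝 0) (𝓝 (Ring.inverse s₀)) := by
    obtain ⟨u, rfl⟩ := hs₀
    exact (NormedRing.inverse_continuousAt u).tendsto.comp hs
  have hi : ∀ {f : B → B} {l : B}, Tendsto f (𝓝 0) (𝓝 l) →
      Tendsto (fun w => V.incl (f w)) (𝓝 0) (𝓝 (V.incl l)) := fun hf =>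
    (V.continuous_incl.tendsto _).comp hf
  -- Both `p` and `q` are centred: the mean of the resolvent of `x` at `a` is `1 + s⁻¹ w s = s⁻¹ (1
  -- + w) s`, and the mean of `y V.res y c` is `s⁻¹ (1 + w)`.
  set p : B → A := fun w => V.incl (Ring.inverse (1 + w)) * V.incl (s w) * V.res x (a w) *
    V.incl (Ring.inverse (s w)) - 1
  set q : B → A := fun w => V.incl (Ring.inverse (1 + w)) * V.incl (s w) * y * V.res y (c w) - 1
  have hp : Tendsto p (𝓝 0) (𝓝 0) := by
    have := ((((hi hW').mul (hi hs)).mul ((V.tendsto_res x).comp ha)).mul (hi hs')).sub_const 1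
    rw [map_one, one_mul, mul_one, ← map_mul, Ring.mul_inverse_cancel _ hs₀, map_one,
      sub_self] at this
    exact this
  have hq : Tendsto q (𝓝 0) (𝓝 (V.incl s₀ * y - 1)) := by
    have := ((((hi hW').mul (hi hs)).mul_const y).mul ((V.tendsto_res y).comp hc)).sub_const 1
    rw [map_one, one_mul, mul_one] at this
    exact this
  have hpq : Tendsto (fun w => p w * q w) (𝓝 0) (𝓝 0) := by simpa using hp.mul hq
  have hsa : Tendsto (fun w => s w * a w) (𝓝 0) (𝓝 0) := by simpa using hs.mul ha
  filter_upwards [norm_lt_one_of_tendsto_zero hpq, isUnit_of_tendsto_one hW,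
    hs.eventually ((Units.isOpen (R := B)).mem_nhds hs₀),
    ha.eventually (V.eventually_norm_lt_one x), hc.eventually (V.eventually_norm_lt_one y),
    hsa.eventually (V.eventually_norm_lt_one (x * y)), hx, hy, hc', hcs]
    with w l1 uW us la lc lsa hx hy hc' hcs
  have us : IsUnit (s w) := us
  set W' := Ring.inverse (1 + w)
  set s' := Ring.inverse (s w)
  have hWW : W' * (1 + w) = 1 := Ring.inverse_mul_cancel _ uW
  have hss : s' * s w = 1 := Ring.inverse_mul_cancel _ us
  have hss' : s w * s' = 1 := Ring.mul_inverse_cancel _ us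
  have hiW : V.incl W' * (1 + V.incl w) = 1 := by
    rw [← map_one V.incl, ← map_add, ← map_mul, hWW]
  have his : V.incl s' * V.incl (s w) = 1 := by rw [← map_mul, hss, map_one]
  have hcw : c w = W' * w * s w := by rw [mul_assoc, ← hcs, ← mul_assoc, hWW, one_mul]
  set U := Ring.inverse (1 - p w * q w)
  have hU : U * (1 - p w * q w) = 1 :=
    Ring.inverse_mul_cancel _ (isUnit_one_sub_of_norm_lt_one l1)
  have hres : V.res (x * y) (s w * a w) = V.res y (c w) * U *
      (V.incl W' * V.incl (s w) * V.res x (a w) * V.incl s') := by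
    refine inverse_eq_of_mul_eq_one (isUnit_one_sub_of_norm_lt_one lsa) ?_
    rw [map_mul]
    refine free_resolvent (w := V.incl w) (res_mul la) (mul_res lc) (res_mul lc) his hiW ?_ hU
    rw [hcw, map_mul, map_mul]
  -- The resolvent of `y` at `c` has mean `1 + w`, so `z` is its normalised centred part and
  -- supplies the left factor `1 + z` of the alternating expansion.
  set z : A := V.incl W' * V.res y (c w) - 1
  have hz : V.res y (c w) = V.incl (1 + w) * (1 + z) := by
    have : V.incl (1 + w) * V.incl W' = 1 := by
      rw [← map_mul, Ring.mul_inverse_cancel _ uW, map_one]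
    simp only [z]
    rw [add_sub_cancel, ← mul_assoc, this, one_mul]
  have hinclx : ∀ b, V.incl b ∈ (V.unitalAlg x).topologicalClosure := fun b =>
    (V.unitalAlg x).le_topologicalClosure (Algebra.subset_adjoin (mem_insert_of_mem _ ⟨b, rfl⟩))
  have hincly : ∀ b, V.incl b ∈ (V.unitalAlg y).topologicalClosure := fun b =>
    (V.unitalAlg y).le_topologicalClosure (Algebra.subset_adjoin (mem_insert_of_mem _ ⟨b, rfl⟩))
  have hymem : y ∈ (V.unitalAlg y).topologicalClosure :=
    (V.unitalAlg y).le_topologicalClosure (Algebra.subset_adjoin (mem_insert _ _))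
  have hpmem : p w ∈ (V.unitalAlg x).topologicalClosure :=
    sub_mem (mul_mem (mul_mem (mul_mem (hinclx _) (hinclx _)) (res_mem_closure la)) (hinclx _))
      (one_mem _)
  have hqmem : q w ∈ (V.unitalAlg y).topologicalClosure :=
    sub_mem (mul_mem (mul_mem (mul_mem (hincly _) (hincly _)) hymem) (res_mem_closure lc))
      (one_mem _)
  have hzmem : z ∈ (V.unitalAlg y).topologicalClosure :=
    sub_mem (mul_mem (hincly _) (res_mem_closure lc)) (one_mem _)
  have hEp : V.E (p w) = 0 := by
    simp only [p]
    rw [map_sub, E_mul_incl, mul_assoc, E_incl_mul, E_incl_mul, ← psi_dist la, V.unital,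
      mul_add, hx, mul_one]
    have : w * s w + s w = (1 + w) * s w := by noncomm_ring
    change W' * _ * s' - 1 = 0
    rw [this, ← mul_assoc, hWW, one_mul, hss', sub_self]
  have hEq : V.E (q w) = 0 := by
    simp only [q]
    rw [map_sub, mul_assoc, mul_assoc, E_incl_mul, E_incl_mul, ← psiTilde_dist lc, V.unital, hy]
    change W' * _ - 1 = 0
    rw [hWW, sub_self]
  have hEz : V.E z = 0 := by
    simp only [z]
    rw [map_sub, E_incl_mul, ← psi_dist lc, hc', V.unital, add_comm, hWW, sub_self]
  have hmain := (Free.closure h).E_alternating (i := 0) (j := 1) (by simp)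
    (show p w ∈ (![V.unitalAlg x, V.unitalAlg y] 0).topologicalClosure from hpmem)
    (show q w ∈ (![V.unitalAlg x, V.unitalAlg y] 1).topologicalClosure from hqmem)
    (show z ∈ (![V.unitalAlg x, V.unitalAlg y] 1).topologicalClosure from hzmem) hEp hEq hEz l1
  have hfin : V.E (V.res (x * y) (s w * a w)) = 1 + w := by
    have h1 : V.incl W' * V.incl (s w) * V.res x (a w) * V.incl s' = 1 + p w := by
      simp only [p]; abel
    rw [hres, h1, hz]
    have h2 : V.incl (1 + w) * (1 + z) * U * (1 + p w) =
        V.incl (1 + w) * ((1 + z) * U * (1 + p w)) := by noncomm_ring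
    rw [h2, E_incl_mul, hmain, mul_one]
  rw [eq_sub_of_add_eq (psi_dist lsa), hfin]
  abel

/-- Taking adjoints reverses words and exchanges `xy` with `yx`, so the `ρ`-statement for `xy` is
reduced to the `κ`-statement for `yx`. -/
theorem varrho_dist (a : A) (b : B) :
    varrho (V.dist a) b = star (vartheta (V.dist (star a)) (star b)) := by
  rw [varrho, vartheta, tsum_star]
  refine tsum_congr fun n => ?_
  rw [dist_pow', ← pow_succ, dist_pow, ← E_star]
  congr 1
  simp [star_pow, map_star]

theorem rho_dist (a : A) (b : B) :
    rho (V.dist a) b = star (kappa (V.dist (star a)) (star b)) := by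
  rw [rho, kappa, varrho_dist, star_mul, ← Ring.inverse_star, star_add, star_one]

end OVSpace

/-! ### Transforms of regular paths -/

section Families

variable {B : Type u} [CStarAlgebra B]

/-- An exponentially bounded `B`-bimodule map. -/
structure IsTame (μ : NCPoly B →ₗ[ℂ] B) : Prop where
  left : ∀ (b : B) p, μ (C B b * p) = b * μ p
  right : ∀ (b : B) p, μ (p * C B b) = μ p * b
  bounded : ∃ M > 0, ExpBoundedBy M μ

theorem IsTame.eventually {μ : NCPoly B →ₗ[ℂ] B} (h : IsTame μ) : ∀ᶠ b in 𝓝 (0 : B),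
    HasSum (fun n : ℕ => μ (X B * (C B b * X B) ^ n)) (psiTilde μ b) ∧
      psi μ b = b * psiTilde μ b ∧ varrho μ b = psiTilde μ b * b ∧
      DifferentiableAt ℂ (psiTilde μ) b := by
  obtain ⟨M, hM, hb⟩ := h.bounded
  filter_upwards [Metric.ball_mem_nhds (0 : B) (inv_pos.2 hM)] with b hbM
  have hs := hasSum_psiTilde hM hb hbM
  exact ⟨hs, (hasSum_psi h.left hs).tsum_eq, (hasSum_varrho h.right hs).tsum_eq,
    (differentiableOn_psiTilde hM hb).differentiableAt (Metric.isOpen_ball.mem_nhds hbM)⟩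

theorem OVSpace.isTame_dist {A : Type v} [CStarAlgebra A] [PartialOrder B] [StarOrderedRing B]
    (V : OVSpace A B) (a : A) : IsTame (V.dist a) :=
  ⟨V.dist_C_mul a, V.dist_mul_C a, V.exists_expBoundedBy a⟩

theorem IsDifferentiablePath.isTame [PartialOrder B] [StarOrderedRing B]
    {μ : ℝ → NCPoly B →ₗ[ℂ] B} (h : IsDifferentiablePath μ) {s : ℝ} (hs : s ∈ Icc (0 : ℝ) 1) :
    IsTame (μ s) := by
  obtain ⟨hd, hb⟩ := h.bounded s hs
  exact ⟨fun b p => by simpa using hd.bimodule b 1 p, fun b p => by simpa using hd.bimodule 1 b p,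
    hb⟩

theorem moment_smul (μ : NCPoly B →ₗ[ℂ] B) (n : ℕ) (z : ℂ) (b : B) :
    μ (X B * (C B (z • b) * X B) ^ n) = z ^ n • μ (X B * (C B b * X B) ^ n) := by
  rw [map_smul, smul_mul_assoc, smul_pow, mul_smul_comm, map_smul]

theorem eventually_pathNhds_curry {E : Type*} [NormedAddCommGroup E] {t : ℝ} {b : E}
    {P : ℝ × E → Prop} (h : ∀ᶠ p in pathNhds t b, P p) :
    ∀ᶠ s in 𝓝[Icc 0 1] t, ∀ᶠ x in 𝓝 b, P (s, x) := h.curry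

theorem PathRegularAt.tendsto_prodMk {E F : Type*} [NormedAddCommGroup E] [NormedSpace ℂ E]
    [NormedAddCommGroup F] [NormedSpace ℂ F] {f : ℝ → E → F} {t : ℝ} {b : E} {c : F}
    (hf : PathRegularAt f t b) (hc : f t b = c) :
    Tendsto (fun p : ℝ × E => (p.1, f p.1 p.2)) (pathNhds t b) (pathNhds t c) :=
  tendsto_fst.prodMk (hc ▸ hf.tendsto)

theorem hasDerivWithinAt_ringInverse {f : ℝ → B} {f' : B} {S : Set ℝ} {t : ℝ}
    (h : HasDerivWithinAt f f' S t) (hu : IsUnit (f t)) :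
    HasDerivWithinAt (fun s => Ring.inverse (f s))
      (-(Ring.inverse (f t) * f' * Ring.inverse (f t))) S t := by
  obtain ⟨u, hu⟩ := hu
  have h1 := hasFDerivAt_ringInverse (𝕜 := ℝ) u
  rw [hu] at h1
  have := h1.comp_hasDerivWithinAt t h
  rw [← hu, Ring.inverse_unit]
  simpa [Function.comp_def, ContinuousLinearMap.mulLeftRight_apply] using this

/-- A path of distributions with a regular family of moment series. -/
structure IsTamePath (μ : ℝ → NCPoly B →ₗ[ℂ] B) (t : ℝ) : Prop where
  mem : t ∈ Icc (0 : ℝ) 1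
  regular : PathRegularAt (fun s => psiTilde (μ s)) t 0
  psi_eq : ∀ᶠ p in pathNhds t (0 : B), psi (μ p.1) p.2 = p.2 * psiTilde (μ p.1) p.2
  varrho_eq : ∀ᶠ p in pathNhds t (0 : B), varrho (μ p.1) p.2 = psiTilde (μ p.1) p.2 * p.2

theorem IsDifferentiablePath.isTamePath [PartialOrder B] [StarOrderedRing B]
    {μ : ℝ → NCPoly B →ₗ[ℂ] B} (h : IsDifferentiablePath μ) (h₀ : IsRegularAtOrigin μ) {t : ℝ}
    (ht : t ∈ Icc (0 : ℝ) 1) : IsTamePath μ t := by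
  obtain ⟨M, hM, hb⟩ := h₀.bounded
  refine ⟨ht, h₀.pathRegularAt ht, ?_, ?_⟩
  · refine eventually_pathNhds_iff.2 ⟨M⁻¹, inv_pos.2 hM, ?_⟩
    filter_upwards [self_mem_nhdsWithin] with s hs b hbM
    exact (hasSum_psi (h.isTame hs).left (hasSum_psiTilde hM (hb s hs) hbM)).tsum_eq
  · refine eventually_pathNhds_iff.2 ⟨M⁻¹, inv_pos.2 hM, ?_⟩
    filter_upwards [self_mem_nhdsWithin] with s hs b hbM
    exact (hasSum_varrho (h.isTame hs).right (hasSum_psiTilde hM (hb s hs) hbM)).tsum_eq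

namespace IsTamePath

variable {μ : ℝ → NCPoly B →ₗ[ℂ] B} {t : ℝ}

theorem psi_regular (h : IsTamePath μ t) : PathRegularAt (fun s => psi (μ s)) t 0 :=
  (pathRegularAt_id.mul h.regular).congr h.mem h.psi_eq

theorem varrho_regular (h : IsTamePath μ t) : PathRegularAt (fun s => varrho (μ s)) t 0 :=
  (h.regular.mul pathRegularAt_id).congr h.mem h.varrho_eq

theorem psi_zero (h : IsTamePath μ t) : psi (μ t) 0 = 0 := by
  simpa using (eventually_of_pathNhds h.mem h.psi_eq).self_of_nhds.1

theorem varrho_zero (h : IsTamePath μ t) : varrho (μ t) 0 = 0 := by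
  simpa using (eventually_of_pathNhds h.mem h.varrho_eq).self_of_nhds.1

theorem eta_regular (h : IsTamePath μ t) : PathRegularAt (fun s => eta (μ s)) t 0 := by
  have h1 := (h.psi_regular.const_add 1).inverse h.mem (by simp [h.psi_zero])
  refine (h.regular.mul h1).congr h.mem (Eventually.of_forall fun p => ?_)
  rw [eta, add_comm]

theorem kappa_regular (h : IsTamePath μ t) : PathRegularAt (fun s => kappa (μ s)) t 0 := by
  have h1 := (h.psi_regular.const_add 1).inverse h.mem (by simp [h.psi_zero])
  refine (h1.mul h.psi_regular).congr h.mem (Eventually.of_forall fun p => ?_)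
  rw [kappa, vartheta_eq_psi]

theorem kappa_zero (h : IsTamePath μ t) : kappa (μ t) 0 = 0 := by
  rw [kappa, vartheta_eq_psi, h.psi_zero, mul_zero]

theorem rho_regular (h : IsTamePath μ t) : PathRegularAt (fun s => rho (μ s)) t 0 :=
  h.varrho_regular.mul ((h.varrho_regular.const_add 1).inverse h.mem (by simp [h.varrho_zero]))

theorem rho_zero (h : IsTamePath μ t) : rho (μ t) 0 = 0 := by
  rw [rho, h.varrho_zero, zero_mul]

end IsTamePath

/-! ### Derivatives of the transforms of convolutions -/

theorem eventually_hasDerivWithinAt_mul {K L T : ℝ → B → B} {t : ℝ} (ht : t ∈ Icc (0 : ℝ) 1)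
    (hK : PathRegularAt K t 0) (hL : PathRegularAt L t 0)
    (hT : ∀ᶠ p in pathNhds t (0 : B), T p.1 p.2 = K p.1 p.2 * L p.1 p.2) :
    ∀ᶠ b in 𝓝 (0 : B), PathDifferentiableAt K t b ∧ PathDifferentiableAt L t b ∧
      HasDerivWithinAt (fun r => T r b) (K t b * pathDeriv L t b + pathDeriv K t b * L t b)
        (Icc 0 1) t := by
  filter_upwards [hK.path, hL.path, eventually_of_pathNhds ht hT] with b h1 h2 h3
  refine ⟨h1, h2, ?_⟩
  have := h1.hasDerivWithinAt.mul h2.hasDerivWithinAt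
  rw [add_comm] at this
  exact this.congr_of_eventuallyEq h3.2 h3.1

theorem eventually_hasDerivWithinAt_comp {K L T : ℝ → B → B} {t : ℝ} (ht : t ∈ Icc (0 : ℝ) 1)
    (hK : PathRegularAt K t 0) (hL : PathRegularAt L t 0) (h0 : L t 0 = 0)
    (hT : ∀ᶠ p in pathNhds t (0 : B), T p.1 p.2 = K p.1 (L p.1 p.2)) :
    ∀ᶠ b in 𝓝 (0 : B), PathDifferentiableAt L t b ∧ PathDifferentiableAt K t (L t b) ∧
      DifferentiableAt ℂ (K t) (L t b) ∧
      HasDerivWithinAt (fun r => T r b)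
        (fderiv ℂ (K t) (L t b) (pathDeriv L t b) + pathDeriv K t (L t b)) (Icc 0 1) t := by
  have hcont : Tendsto (L t) (𝓝 0) (𝓝 0) := by
    have := (hL.differentiableAt_self ht).continuousAt.tendsto
    rwa [h0] at this
  filter_upwards [hL.path, hcont.eventually hK.eventually_nhds, eventually_of_pathNhds ht hT]
    with b h1 h2 h3
  refine ⟨h1, h2.path.self_of_nhds, h2.differentiableAt_self ht, ?_⟩
  exact (PathRegularAt.hasDerivWithinAt_comp (c := fun s => L s b) h2 ht
    h1.hasDerivWithinAt).congr_of_eventuallyEq h3.2 h3.1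

variable [PartialOrder B] [StarOrderedRing B]

/-- With `e = η_μ η_ν`, the candidate for the moment series of `τ` is `e (1 - b e)⁻¹`. It is regular
along the path, so its expansion holds on a neighbourhood uniform in the parameter, and `η_τ` is
computed from it. -/
theorem eta_boolean {μ ν τ : ℝ → NCPoly B →ₗ[ℂ] B} {t : ℝ} (hμ : IsTamePath μ t)
    (hν : IsTamePath ν t) (hτ : ∀ s ∈ Icc (0 : ℝ) 1, IsBooleanConv.{u, v} (μ s) (ν s) (τ s)) :
    ∀ᶠ p in pathNhds t (0 : B), eta (τ p.1) p.2 = eta (μ p.1) p.2 * eta (ν p.1) p.2 := by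
  set e : ℝ → B → B := fun s b => eta (μ s) b * eta (ν s) b
  have he : PathRegularAt e t 0 := hμ.eta_regular.mul hν.eta_regular
  have hN : PathRegularAt (fun s b => 1 + -(b * e s b)) t 0 :=
    ((pathRegularAt_id.mul he).neg).const_add 1
  have hN0 : IsUnit (1 + -((0 : B) * e t 0)) := by simp
  have hH : PathRegularAt (fun s b => e s b * Ring.inverse (1 + -(b * e s b))) t 0 :=
    he.mul (hN.inverse hμ.mem hN0)
  have htiny : ∀ᶠ s in 𝓝[Icc 0 1] t, ∀ᶠ b in 𝓝 (0 : B),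
      HasSum (fun n : ℕ => τ s (X B * (C B b * X B) ^ n))
        (e s b * Ring.inverse (1 + -(b * e s b))) := by
    filter_upwards [self_mem_nhdsWithin, eventually_pathNhds_curry hH.differentiableAt,
      eventually_pathNhds_curry (hN.eventually_isUnit hN0)] with s hs hd hu
    obtain ⟨A, _, V, x, y, hx, hy, hxμ, hyν, hind, hτs⟩ := hτ s hs
    have htame : IsTame (τ s) := hτs ▸ V.isTame_dist _
    have hpsi := hind.psi_mul
    rw [← hτs, hxμ, hyν] at hpsi
    have heq : ∀ᶠ b in 𝓝 (0 : B), psiTilde (τ s) b =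
        e s b * Ring.inverse (1 + -(b * e s b)) := by
      -- The resolvent formula determines only `b ψ̃(b)`. The factor `b` cancels for invertible `b`,
      -- and the identity theorem covers the rest.
      refine eventuallyEq_of_eq_on_units (htame.eventually.mono fun b h => h.2.2.2) hd ?_
      filter_upwards [hpsi, htame.eventually, hu] with b h1 h2 h3 hb
      rw [h2.2.1, sub_eq_add_neg] at h1
      change _ = Ring.inverse (1 + -(b * e s b)) at h1
      refine hb.mul_left_cancel ?_
      rw [eq_sub_of_add_eq h1]
      have h4 := Ring.mul_inverse_cancel _ h3
      simp only [add_mul, neg_mul, one_mul] at h4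
      rw [← sub_eq_add_neg, sub_eq_iff_eq_add] at h4
      rw [mul_assoc b] at h4
      exact sub_eq_of_eq_add' h4
    filter_upwards [heq, htame.eventually] with b h1 h2
    rw [← h1]
    exact h2.1
  have hsum := eventually_hasSum_pathNhds (fun s n z b => moment_smul (τ s) n z b)
    hH.differentiableAt htiny
  filter_upwards [hsum, hN.eventually_isUnit hN0,
    eventually_pathNhds_of_nhdsWithin (b := (0 : B)) (self_mem_nhdsWithin (s := Icc 0 1))]
    with p h1 h2 hs
  obtain ⟨A, _, V, x, y, hx, hy, hxμ, hyν, hind, hτs⟩ := hτ p.1 hs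
  have htame : IsTame (τ p.1) := hτs ▸ V.isTame_dist _
  have h3 : psi (τ p.1) p.2 = _ := (hasSum_psi htame.left h1).tsum_eq
  have h4 : psiTilde (τ p.1) p.2 = _ := h1.tsum_eq
  change _ = e p.1 p.2
  rw [eta, h3, h4]
  obtain ⟨u, hu⟩ := h2
  rw [← hu, Ring.inverse_unit]
  have h5 : p.2 * (e p.1 p.2 * ↑u⁻¹) + 1 = ↑u⁻¹ := by
    have : (↑u : B) * ↑u⁻¹ = 1 := Units.mul_inv u
    rw [← this, ← mul_assoc, ← add_mul, hu]
    simp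
  rw [h5, Ring.inverse_unit, inv_inv, mul_assoc, Units.inv_mul, mul_one]

/-- Once `ψ_τ = ψ_μ ∘ κ_ν` is known uniformly in the parameter, the claim is immediate, since `κ` is
one fixed algebraic function of `ψ`. -/
theorem kappa_monotone {μ ν τ : ℝ → NCPoly B →ₗ[ℂ] B} {t : ℝ} (hμ : IsTamePath μ t)
    (hν : IsTamePath ν t)
    (hτ : ∀ s ∈ Icc (0 : ℝ) 1, IsMonotoneConvRev.{u, v} (μ s) (ν s) (τ s)) :
    ∀ᶠ p in pathNhds t (0 : B), kappa (τ p.1) p.2 = kappa (μ p.1) (kappa (ν p.1) p.2) := by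
  have hH : PathRegularAt (fun s b => psi (μ s) (kappa (ν s) b)) t 0 :=
    PathRegularAt.comp (by rw [hν.kappa_zero]; exact hμ.psi_regular) hν.kappa_regular hμ.mem
  have hsum := eventually_hasSum_succ_pathNhds (t := t)
    (p := fun s n b => τ s ((C B b * X B) ^ (n + 1)))
    (H := fun s b => psi (μ s) (kappa (ν s) b))
    (fun s n z b => by rw [map_smul, smul_mul_assoc, smul_pow, map_smul])
    hH.differentiableAt (by
      filter_upwards [self_mem_nhdsWithin] with s hs
      obtain ⟨A, _, V, x, y, hx, hy, hxμ, hyν, hind, hτs⟩ := hτ s hs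
      have htame : IsTame (τ s) := hτs ▸ V.isTame_dist _
      have hpsi := hind.psi_mul
      rw [← hτs, hxμ, hyν] at hpsi
      filter_upwards [hpsi, htame.eventually] with b h1 h2
      rw [← h1, h2.2.1]
      exact hasSum_psi htame.left h2.1)
  filter_upwards [hsum] with p hp
  have : psi (τ p.1) p.2 = _ := hp.tsum_eq
  rw [kappa, kappa, vartheta_eq_psi, vartheta_eq_psi, this]

theorem rho_monotone {μ ν τ : ℝ → NCPoly B →ₗ[ℂ] B} {t : ℝ} (hμ : IsTamePath μ t)
    (hν : IsTamePath ν t)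
    (hτ : ∀ s ∈ Icc (0 : ℝ) 1, IsMonotoneConv.{u, v} (μ s) (ν s) (τ s)) :
    ∀ᶠ p in pathNhds t (0 : B), rho (τ p.1) p.2 = rho (μ p.1) (rho (ν p.1) p.2) := by
  have hH : PathRegularAt (fun s b => varrho (μ s) (rho (ν s) b)) t 0 :=
    PathRegularAt.comp (by rw [hν.rho_zero]; exact hμ.varrho_regular) hν.rho_regular hμ.mem
  have hsum := eventually_hasSum_succ_pathNhds (t := t)
    (p := fun s n b => τ s (X B * C B b * (X B * C B b) ^ n))
    (H := fun s b => varrho (μ s) (rho (ν s) b))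
    (fun s n z b => by
      rw [← pow_succ', ← pow_succ', map_smul, mul_smul_comm, smul_pow, map_smul])
    hH.differentiableAt (by
      filter_upwards [self_mem_nhdsWithin] with s hs
      obtain ⟨A, _, V, x, y, hx, hy, hxμ, hyν, hind, hτs⟩ := hτ s hs
      have htame : IsTame (τ s) := hτs ▸ V.isTame_dist _
      have hstar : Tendsto (star : B → B) (𝓝 0) (𝓝 0) := by
        have := (continuous_star (R := B)).tendsto 0
        rwa [star_zero] at this
      filter_upwards [hstar.eventually hind.psi_mul, htame.eventually] with b h1 h2
      have h3 : varrho (τ s) b = varrho (μ s) (rho (ν s) b) := by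
        rw [hτs, V.varrho_dist, star_mul, hx.star_eq, hy.star_eq, vartheta_eq_psi, h1, ← hxμ, ← hyν,
          V.varrho_dist, V.rho_dist, star_star, hx.star_eq, hy.star_eq, vartheta_eq_psi]
      rw [← h3, h2.2.2.1]
      exact hasSum_varrho htame.right h2.1)
  filter_upwards [hsum] with p hp
  have : varrho (τ p.1) p.2 = _ := hp.tsum_eq
  rw [rho, rho, this]

end Families

/-! ### The `S`-transform of a free convolution -/

section FreeConvolution

variable {B : Type u} [CStarAlgebra B]

/-- The inverse and the radius chosen in `psiInv` may depend on `w`. A left inverse near `0` forces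
the chosen function to agree with `g` there, and the identity theorem carries this to the smaller of
the two balls, which contains `w`. -/
theorem psiInv_eq {μ : NCPoly B →ₗ[ℂ] B} {r : ℝ} {g : B → B} (hg : IsPsiInverse μ r g)
    (hinv : ∀ᶠ u in 𝓝 (0 : B), g (psi μ u) = u) {w : B} (hw : ‖w‖ < r) : psiInv μ w = g w := by
  have hex : ∃ p : ℝ × (B → B), IsPsiInverse μ p.1 p.2 ∧ ‖w‖ < p.1 := ⟨(r, g), hg, hw⟩
  rw [psiInv, dif_pos hex]
  obtain ⟨hg', hw'⟩ := hex.choose_spec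
  set r' := hex.choose.1
  set g' := hex.choose.2
  have hr' : 0 < r' := (norm_nonneg w).trans_lt hw'
  have hcont : Tendsto g' (𝓝 0) (𝓝 0) := by
    have := (hg'.1.differentiableAt (Metric.ball_mem_nhds 0 hr')).continuousAt.tendsto
    rwa [hg'.2.1] at this
  refine eqOn_ball_of_eventuallyEq (r := min r' r)
    (hg'.1.mono (Metric.ball_subset_ball (min_le_left _ _)))
    (hg.1.mono (Metric.ball_subset_ball (min_le_right _ _))) ?_
    (mem_ball_zero_iff.2 (lt_min hw' hw))
  filter_upwards [hcont.eventually hinv, Metric.ball_mem_nhds (0 : B) hr'] with v h1 h2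
  rw [hg'.2.2 v h2] at h1
  exact h1.symm

theorem eventually_psiInv_eq {μ : ℝ → NCPoly B →ₗ[ℂ] B} {g : ℝ → B → B} {t : ℝ}
    (hg : ∀ᶠ p in pathNhds t (0 : B), DifferentiableAt ℂ (g p.1) p.2)
    (hg0 : ∀ᶠ s in 𝓝[Icc 0 1] t, g s 0 = 0)
    (hright : ∀ᶠ p in pathNhds t (0 : B), psi (μ p.1) (g p.1 p.2) = p.2)
    (hleft : ∀ᶠ p in pathNhds t (0 : B), g p.1 (psi (μ p.1) p.2) = p.2) :
    ∀ᶠ p in pathNhds t (0 : B), psiInv (μ p.1) p.2 = g p.1 p.2 := by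
  obtain ⟨r, hr, h⟩ := eventually_pathNhds_iff.1 (hg.and hright)
  refine eventually_pathNhds_iff.2 ⟨r, hr, ?_⟩
  filter_upwards [h, hg0, eventually_pathNhds_curry hleft] with s h1 h2 h3 w hw
  exact psiInv_eq ⟨fun x hx => (h1 x hx).1.differentiableWithinAt, h2, fun x hx => (h1 x hx).2⟩ h3
    (mem_ball_zero_iff.1 hw)

/-- The inverse of the moment series along a path, and the resulting form of the `S`-transform. -/
theorem IsTamePath.exists_psiInv {μ : ℝ → NCPoly B →ₗ[ℂ] B} {t : ℝ} (h : IsTamePath μ t)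
    (hu : IsUnit (μ t (X B))) :
    ∃ g : ℝ → B → B, PathRegularAt g t 0 ∧ g t 0 = 0 ∧ (∀ᶠ s in 𝓝[Icc 0 1] t, g s 0 = 0) ∧
      (∀ᶠ p in pathNhds t (0 : B), psi (μ p.1) (g p.1 p.2) = p.2 ∧
        g p.1 p.2 * psiTilde (μ p.1) (g p.1 p.2) = p.2 ∧
        IsUnit (psiTilde (μ p.1) (g p.1 p.2)) ∧
        sTransform (μ p.1) p.2 = (1 + p.2) * Ring.inverse (psiTilde (μ p.1) (g p.1 p.2))) ∧
      PathRegularAt (fun s => sTransform (μ s)) t 0 ∧ IsUnit (sTransform (μ t) 0) ∧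
      PathRegularAt (fun s w => Ring.inverse (psiTilde (μ s) (g s w))) t 0 := by
  have hu' : IsUnit (psiTilde (μ t) 0) := by rwa [psiTilde_zero]
  obtain ⟨g, hg, hg0, hr, hl⟩ := h.regular.exists_inverse_id_mul h.mem hu'
  have hgt : g t 0 = 0 := hg0.self_of_nhdsWithin h.mem
  have hT := hg.tendsto_prodMk hgt
  have hcomp : PathRegularAt (fun s w => psiTilde (μ s) (g s w)) t 0 :=
    PathRegularAt.comp (by rw [hgt]; exact h.regular) hg h.mem
  have hcu : IsUnit (psiTilde (μ t) (g t 0)) := by rwa [hgt]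
  have hright : ∀ᶠ p in pathNhds t (0 : B), psi (μ p.1) (g p.1 p.2) = p.2 := by
    filter_upwards [hT.eventually h.psi_eq, hr] with p h1 h2
    exact h1.trans h2
  have hleft : ∀ᶠ p in pathNhds t (0 : B), g p.1 (psi (μ p.1) p.2) = p.2 := by
    filter_upwards [h.psi_eq, hl] with p h1 h2
    rw [h1, h2]
  have hS : ∀ᶠ p in pathNhds t (0 : B), sTransform (μ p.1) p.2 =
      (1 + p.2) * Ring.inverse (psiTilde (μ p.1) (g p.1 p.2)) := by
    filter_upwards [eventually_psiInv_eq hg.differentiableAt hg0 hright hleft] with p hp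
    rw [sTransform, hp]
  have hinv := hcomp.inverse h.mem hcu
  refine ⟨g, hg, hgt, hg0, ?_, ((pathRegularAt_id.const_add 1).mul hinv).congr h.mem hS, ?_, hinv⟩
  · filter_upwards [hright, hr, hcomp.eventually_isUnit hcu, hS] with p h1 h2 h3 h4
      using ⟨h1, h2, h3, h4⟩
  · rw [(eventually_of_pathNhds h.mem hS).self_of_nhds.1, add_zero, one_mul]
    exact hcu.ringInverse

variable [PartialOrder B] [StarOrderedRing B]

/-- With `c = S_ν⁻¹ w S_ν` and `a = ψ_μ⁻¹(c)`, freeness gives `ψ_τ(S_ν(w) a(w)) = w`. So `S_ν a` is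
the inverse of `ψ_τ`, and the formula for `S_τ` is read off. The work lies in making this uniform in
the parameter. -/
theorem sTransform_free {μ ν τ : ℝ → NCPoly B →ₗ[ℂ] B} {t : ℝ} (hμ : IsTamePath μ t)
    (hν : IsTamePath ν t) (hμu : IsUnit (μ t (X B))) (hνu : IsUnit (ν t (X B)))
    (hτ : ∀ s ∈ Icc (0 : ℝ) 1, IsFreeConv.{u, v} (μ s) (ν s) (τ s)) :
    ∀ᶠ p in pathNhds t (0 : B), sTransform (τ p.1) p.2 = sTransform (ν p.1) p.2 *
      sTransform (μ p.1)
        (Ring.inverse (sTransform (ν p.1) p.2) * p.2 * sTransform (ν p.1) p.2) := by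
  have ht := hμ.mem
  obtain ⟨gμ, hgμ, hgμt, hgμ0, hgμp, -, -, hJμ⟩ := hμ.exists_psiInv hμu
  obtain ⟨gν, hgν, hgνt, hgν0, hgνp, hS, hSu, -⟩ := hν.exists_psiInv hνu
  set S : ℝ → B → B := fun s => sTransform (ν s)
  have hSinv := hS.inverse ht hSu
  set c : ℝ → B → B := fun s w => Ring.inverse (S s w) * w * S s w
  have hc : PathRegularAt c t 0 := (hSinv.mul pathRegularAt_id).mul hS
  have hc0 : ∀ s, c s 0 = 0 := fun s => by simp [c]
  have hcT := hc.tendsto_prodMk (hc0 t)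
  set a : ℝ → B → B := fun s w => gμ s (c s w)
  have ha : PathRegularAt a t 0 :=
    PathRegularAt.comp (by rw [hc0]; exact hgμ) hc ht
  -- The candidate inverse of `ψ_τ` is rewritten as `S_ν(w) a(w) = w J(w)`. In this form it can be
  -- inverted by `PathRegularAt.exists_inverse_id_mul`, and its inverse `k` is the candidate for
  -- `ψ_τ`.
  set J : ℝ → B → B := fun s w => S s w * Ring.inverse (psiTilde (μ s) (a s w))
  have hJ : PathRegularAt J t 0 :=
    hS.mul (PathRegularAt.comp (g := fun s w => Ring.inverse (psiTilde (μ s) (gμ s w)))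
      (by rw [hc0]; exact hJμ) hc ht)
  have hJu : IsUnit (J t 0) := by
    refine hSu.mul (IsUnit.ringInverse ?_)
    have := (eventually_of_pathNhds ht (hcT.eventually hgμp)).self_of_nhds.1
    exact this.2.2.1
  set f : ℝ → B → B := fun s w => w * J s w
  have hf : PathRegularAt f t 0 := pathRegularAt_id.mul hJ
  have hf0 : ∀ s, f s 0 = 0 := fun s => zero_mul _
  have hfT := hf.tendsto_prodMk (hf0 t)
  obtain ⟨k, hk, hk0, hkr, hkl⟩ := hJ.exists_inverse_id_mul ht hJu
  have hkt : k t 0 = 0 := hk0.self_of_nhdsWithin ht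
  have hkT := hk.tendsto_prodMk hkt
  -- From `k(b) J(k(b)) = b` one gets `k(b) = b J(k(b))⁻¹`, so `J(k(b))⁻¹` is the regular candidate
  -- for `ψ̃_τ(b)`.
  have hH : PathRegularAt (fun s b => Ring.inverse (J s (k s b))) t 0 :=
    PathRegularAt.comp (g := fun s w => Ring.inverse (J s w))
      (by rw [hkt]; exact hJ.inverse ht hJu) hk ht
  have htiny : ∀ᶠ s in 𝓝[Icc 0 1] t, ∀ᶠ b in 𝓝 (0 : B),
      HasSum (fun n : ℕ => τ s (X B * (C B b * X B) ^ n)) (Ring.inverse (J s (k s b))) := by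
    filter_upwards [self_mem_nhdsWithin, hgμ0, hgν0, hk0,
      eventually_pathNhds_curry (hcT.eventually hgμp), eventually_pathNhds_curry hgνp,
      eventually_pathNhds_curry hS.differentiableAt,
      eventually_pathNhds_curry ha.differentiableAt,
      eventually_pathNhds_curry hgν.differentiableAt,
      eventually_pathNhds_curry hJ.differentiableAt,
      eventually_pathNhds_curry hk.differentiableAt,
      eventually_pathNhds_curry (hS.eventually_isUnit hSu),
      eventually_pathNhds_curry (hJ.eventually_isUnit hJu),
      eventually_pathNhds_curry hkr] with s hs e1 e2 e3 pμ pν dS da dν dJ dk uS uJ kr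
    obtain ⟨A, _, _, _, V, x, y, -, -, hxμ, hyν, hfree, hτs⟩ := hτ s hs
    have htame : IsTame (τ s) := hτs ▸ V.isTame_dist _
    have ta : Tendsto (a s) (𝓝 0) (𝓝 0) := by
      have := da.self_of_nhds.continuousAt.tendsto
      simpa only [a, hc0, e1] using this
    have tν : Tendsto (gν s) (𝓝 0) (𝓝 0) := by
      have := dν.self_of_nhds.continuousAt.tendsto
      rwa [e2] at this
    have tk : Tendsto (k s) (𝓝 0) (𝓝 0) := by
      have := dk.self_of_nhds.continuousAt.tendsto
      rwa [e3] at this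
    have hsa : ∀ᶠ w in 𝓝 (0 : B), S s w * a s w = f s w := by
      filter_upwards [pμ, uS] with w h1 h2
      have h3 : a s w = c s w * Ring.inverse (psiTilde (μ s) (a s w)) := by
        have := congrArg (· * Ring.inverse (psiTilde (μ s) (a s w))) h1.2.1
        rwa [Ring.mul_inverse_cancel_right _ _ h1.2.2.1] at this
      rw [h3]
      simp only [f, J, c]
      rw [← mul_assoc, ← mul_assoc, ← mul_assoc, Ring.mul_inverse_cancel _ h2, one_mul, mul_assoc]
    have hpsi : ∀ᶠ w in 𝓝 (0 : B), psi (τ s) (f s w) = w := by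
      have := hfree.psi_mul (s := S s) (a := a s) (c := gν s) (s₀ := S s 0)
        uS.self_of_nhds dS.self_of_nhds.continuousAt.tendsto ta tν ?_ ?_ ?_ ?_
      · filter_upwards [this, hsa] with w h1 h2
        rwa [h2, ← hτs] at h1
      · filter_upwards [pμ, uS] with w h1 h2
        have h3 : psi (μ s) (a s w) = c s w := h1.1
        rw [hxμ, h3]
        simp only [c]
        rw [← mul_assoc, ← mul_assoc, Ring.mul_inverse_cancel _ h2, one_mul]
      · filter_upwards [pν] with w h1
        rw [hyν]
        simp only [S]
        rw [h1.2.2.2, mul_assoc, Ring.inverse_mul_cancel _ h1.2.2.1, mul_one]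
      · filter_upwards [pν] with w h1
        rw [hyν]
        exact h1.1
      · filter_upwards [pν] with w h1
        have h3 : gν s w = w * Ring.inverse (psiTilde (ν s) (gν s w)) := by
          have := congrArg (· * Ring.inverse (psiTilde (ν s) (gν s w))) h1.2.1
          rwa [Ring.mul_inverse_cancel_right _ _ h1.2.2.1] at this
        simp only [S]
        rw [h1.2.2.2, ← mul_assoc, mul_add w, mul_one]
        conv_lhs => rw [h3]
        rw [← mul_assoc, add_mul, one_mul]
    have tf : Tendsto (f s) (𝓝 0) (𝓝 0) := by
      have : Tendsto (f s) (𝓝 0) (𝓝 (f s 0)) :=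
        (differentiableAt_id.mul dJ.self_of_nhds).continuousAt
      rwa [hf0] at this
    -- The relation `ψ_τ(w J) = w` reads `w J ψ̃_τ(w J) = w`; the left factor `w` is cancelled on
    -- invertible elements.
    have hone : ∀ᶠ w in 𝓝 (0 : B), J s w * psiTilde (τ s) (f s w) = 1 := by
      refine eventuallyEq_of_eq_on_units (g := fun _ => (1 : B)) ?_
        (Eventually.of_forall fun _ => differentiableAt_const _) ?_
      · filter_upwards [dJ, tf.eventually htame.eventually] with w h1 h2
        exact h1.mul (h2.2.2.2.comp w (differentiableAt_id.mul h1))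
      · filter_upwards [hpsi, tf.eventually htame.eventually] with w h1 h2 hw
        rw [h2.2.1] at h1
        refine hw.mul_left_cancel ?_
        rw [← mul_assoc, mul_one]
        exact h1
    filter_upwards [tk.eventually hone, tk.eventually uJ, kr, htame.eventually]
      with b h1 h2 h3 h4
    have h5 : f s (k s b) = b := h3
    rw [h5] at h1
    have h6 : psiTilde (τ s) b = Ring.inverse (J s (k s b)) := by
      have := congrArg (Ring.inverse (J s (k s b)) * ·) h1
      rwa [Ring.inverse_mul_cancel_left _ _ h2, mul_one] at this
    rw [← h6]
    exact h4.1
  have hsum := eventually_hasSum_pathNhds (fun s n z b => moment_smul (τ s) n z b)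
    hH.differentiableAt htiny
  have hτT : ∀ᶠ p in pathNhds t (0 : B), psi (τ p.1) p.2 = k p.1 p.2 ∧
      psiTilde (τ p.1) p.2 = Ring.inverse (J p.1 (k p.1 p.2)) := by
    filter_upwards [hsum, hkr, hkT.eventually (hJ.eventually_isUnit hJu),
      eventually_pathNhds_of_nhdsWithin (b := (0 : B)) (self_mem_nhdsWithin (s := Icc 0 1))]
      with p h1 h2 h3 hs
    obtain ⟨A, _, _, _, V, x, y, -, -, hxμ, hyν, hfree, hτs⟩ := hτ p.1 hs
    have htame : IsTame (τ p.1) := hτs ▸ V.isTame_dist _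
    refine ⟨?_, h1.tsum_eq⟩
    have h4 : psi (τ p.1) p.2 = _ := (hasSum_psi htame.left h1).tsum_eq
    rw [h4]
    nth_rewrite 1 [← h2]
    exact Ring.mul_inverse_cancel_right _ _ h3
  have hInv : ∀ᶠ p in pathNhds t (0 : B), psiInv (τ p.1) p.2 = f p.1 p.2 := by
    refine eventually_psiInv_eq hf.differentiableAt (Eventually.of_forall hf0) ?_ ?_
    · filter_upwards [hfT.eventually hτT, hkl] with p h1 h2
      exact h1.1.trans h2
    · filter_upwards [hτT, hkr] with p h1 h2
      rw [h1.1]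
      exact h2
  filter_upwards [hInv, hfT.eventually hτT, hkl, hJ.eventually_isUnit hJu,
    hS.eventually_isUnit hSu, hcT.eventually hgμp] with p h1 h2 h3 h4 h5 h6
  have h7 : k p.1 (f p.1 p.2) = p.2 := h3
  rw [sTransform, h1, h2.2]
  rw [h7]
  obtain ⟨u, hu⟩ := h4
  rw [← hu, Ring.inverse_unit, Ring.inverse_unit, inv_inv, hu]
  have h8 : sTransform (μ p.1) (c p.1 p.2) =
      (1 + c p.1 p.2) * Ring.inverse (psiTilde (μ p.1) (a p.1 p.2)) := h6.2.2.2
  change _ = S p.1 p.2 * sTransform (μ p.1) (c p.1 p.2)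
  rw [h8]
  simp only [J, c]
  -- Moving `1 + w` across `S_ν` turns it into `1 + c`, the prefactor of `S_μ(c)`.
  have h9 : S p.1 p.2 * (1 + Ring.inverse (S p.1 p.2) * p.2 * S p.1 p.2) =
      (1 + p.2) * S p.1 p.2 := by
    rw [mul_add, ← mul_assoc, ← mul_assoc, Ring.mul_inverse_cancel _ h5]
    noncomm_ring
  rw [← mul_assoc, ← mul_assoc, h9]

end FreeConvolution

/-! ### Differentiating the product formulas for the `S`- and `T`-transforms. -/

section FreeDerivatives

variable {B : Type u} [CStarAlgebra B]

/-- The chain rule along the moving point `L⁻¹ w L`; the noncommutative derivative of `L⁻¹` produces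
the second term of the velocity. -/
theorem eventually_hasDerivWithinAt_conj {K L : ℝ → B → B} {t : ℝ} (ht : t ∈ Icc (0 : ℝ) 1)
    (hK : PathRegularAt K t 0) (hL : PathRegularAt L t 0) (hLu : IsUnit (L t 0)) :
    ∀ᶠ w in 𝓝 (0 : B), IsUnit (L t w) ∧ PathDifferentiableAt L t w ∧
      (PathDifferentiableAt K t (Ring.inverse (L t w) * w * L t w) ∧
        DifferentiableAt ℂ (K t) (Ring.inverse (L t w) * w * L t w)) ∧
      HasDerivWithinAt (fun r => K r (Ring.inverse (L r w) * w * L r w))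
        (fderiv ℂ (K t) (Ring.inverse (L t w) * w * L t w)
          (Ring.inverse (L t w) * w * pathDeriv L t w -
            Ring.inverse (L t w) * pathDeriv L t w * Ring.inverse (L t w) * w * L t w) +
          pathDeriv K t (Ring.inverse (L t w) * w * L t w)) (Icc 0 1) t := by
  have hc : PathRegularAt (fun s w => Ring.inverse (L s w) * w * L s w) t 0 :=
    ((hL.inverse ht hLu).mul pathRegularAt_id).mul hL
  have hcont : Tendsto (fun w => Ring.inverse (L t w) * w * L t w) (𝓝 0) (𝓝 0) := by
    have := (hc.differentiableAt_self ht).continuousAt.tendsto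
    simpa using this
  filter_upwards [(eventually_of_pathNhds ht (hL.eventually_isUnit hLu)), hL.path,
    hcont.eventually hK.eventually_nhds] with w h1 h2 h3
  have hd := h2.hasDerivWithinAt
  have hder := ((hasDerivWithinAt_ringInverse hd h1.1).mul_const w).mul hd
  refine ⟨h1.1, h2, ⟨h3.path.self_of_nhds, h3.differentiableAt_self ht⟩, ?_⟩
  have := PathRegularAt.hasDerivWithinAt_comp
    (c := fun s => Ring.inverse (L s w) * w * L s w) h3 ht hder
  refine this.congr_deriv ?_
  congr 2
  rw [pathDeriv]
  noncomm_ring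

theorem eventually_hasDerivWithinAt_sTransform {μ ν τ : ℝ → NCPoly B →ₗ[ℂ] B} {t : ℝ}
    (ht : t ∈ Icc (0 : ℝ) 1) (hμ : PathRegularAt (fun s => sTransform (μ s)) t 0)
    (hν : PathRegularAt (fun s => sTransform (ν s)) t 0) (hνu : IsUnit (sTransform (ν t) 0))
    (hτ : ∀ᶠ p in pathNhds t (0 : B), sTransform (τ p.1) p.2 = sTransform (ν p.1) p.2 *
      sTransform (μ p.1)
        (Ring.inverse (sTransform (ν p.1) p.2) * p.2 * sTransform (ν p.1) p.2)) :
    ∀ᶠ w in 𝓝 (0 : B),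
        (let Sμ := fun s => sTransform (μ s)
         let Sν := fun s => sTransform (ν s)
         let s := Sν t w
         let s' := Ring.inverse s
         let ds := pathDeriv Sν t w
         let c := s' * w * s
         IsUnit s ∧ PathDifferentiableAt Sν t w ∧ PathDifferentiableAt Sμ t c ∧
         DifferentiableAt ℂ (Sμ t) c ∧
         HasDerivWithinAt (fun r => sTransform (τ r) w)
           (ds * Sμ t c + s * pathDeriv Sμ t c +
             s * fderiv ℂ (Sμ t) c (s' * w * ds - s' * ds * s' * w * s))
           (Set.Icc 0 1) t) := by
  filter_upwards [eventually_hasDerivWithinAt_conj ht hμ hν hνu, eventually_of_pathNhds ht hτ]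
    with w h1 h2
  obtain ⟨hu, hd, ⟨hd1, hd2⟩, hder⟩ := h1
  refine ⟨hu, hd, hd1, hd2, ?_⟩
  have hd' := hd.hasDerivWithinAt
  have := (hd'.mul hder).congr_of_eventuallyEq h2.2 h2.1
  refine this.congr_deriv ?_
  rw [mul_add, ← add_assoc, add_right_comm]
  rfl

theorem eventually_hasDerivWithinAt_tTransform {μ ν τ : ℝ → NCPoly B →ₗ[ℂ] B} {t : ℝ}
    (ht : t ∈ Icc (0 : ℝ) 1) (hμ : PathRegularAt (fun s => sTransform (μ s)) t 0)
    (hμu : IsUnit (sTransform (μ t) 0))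
    (hν : PathRegularAt (fun s => sTransform (ν s)) t 0) (hνu : IsUnit (sTransform (ν t) 0))
    (hτ : ∀ᶠ p in pathNhds t (0 : B), sTransform (τ p.1) p.2 = sTransform (ν p.1) p.2 *
      sTransform (μ p.1)
        (Ring.inverse (sTransform (ν p.1) p.2) * p.2 * sTransform (ν p.1) p.2)) :
    ∀ᶠ w in 𝓝 (0 : B),
        (let Tμ := fun s => tTransform (μ s)
         let Tν := fun s => tTransform (ν s)
         let y := Tν t w
         let y' := Ring.inverse y
         let dy := pathDeriv Tν t w
         let c := y * w * y'
         IsUnit y ∧ PathDifferentiableAt Tν t w ∧ PathDifferentiableAt Tμ t c ∧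
         DifferentiableAt ℂ (Tμ t) c ∧
         HasDerivWithinAt (fun r => tTransform (τ r) w)
           (Tμ t c * dy + pathDeriv Tμ t c * y +
             fderiv ℂ (Tμ t) c (dy * w * y' - y * w * y' * dy * y') * y)
           (Set.Icc 0 1) t) := by
  have hTμ : PathRegularAt (fun s => tTransform (μ s)) t 0 := hμ.inverse ht hμu
  have hTν : PathRegularAt (fun s => tTransform (ν s)) t 0 := hν.inverse ht hνu
  have hTνu : IsUnit (tTransform (ν t) 0) := hνu.ringInverse
  -- The argument `T_ν w T_ν⁻¹` is a conjugation by `L = T_ν⁻¹`, so the `S`-case lemma applies with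
  -- this `L`.
  have hL : PathRegularAt (fun s w => Ring.inverse (tTransform (ν s) w)) t 0 :=
    hTν.inverse ht hTνu
  have hc : PathRegularAt (fun s w => Ring.inverse (sTransform (ν s) w) * w * sTransform (ν s) w)
      t 0 := ((hν.inverse ht hνu).mul pathRegularAt_id).mul hν
  have hcT := hc.tendsto_prodMk (c := 0) (by simp)
  have hinvinv : ∀ᶠ p in pathNhds t (0 : B),
      Ring.inverse (tTransform (ν p.1) p.2) = sTransform (ν p.1) p.2 := by
    filter_upwards [hν.eventually_isUnit hνu] with p h
    obtain ⟨u, hu⟩ := h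
    rw [tTransform, ← hu, Ring.inverse_unit, Ring.inverse_unit, inv_inv]
  have hT : ∀ᶠ p in pathNhds t (0 : B), tTransform (τ p.1) p.2 =
      tTransform (μ p.1) (Ring.inverse (Ring.inverse (tTransform (ν p.1) p.2)) * p.2 *
        Ring.inverse (tTransform (ν p.1) p.2)) * tTransform (ν p.1) p.2 := by
    filter_upwards [hτ, hν.eventually_isUnit hνu, hinvinv,
      hcT.eventually (hμ.eventually_isUnit hμu)] with p h1 h2 h3 h4
    rw [h3, tTransform, h1]
    obtain ⟨u, hu⟩ := h2
    obtain ⟨v, hv⟩ := h4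
    change _ = sTransform (μ p.1) (Ring.inverse (sTransform (ν p.1) p.2) * p.2 *
      sTransform (ν p.1) p.2) at hv
    rw [tTransform, tTransform, ← hv, ← hu, ← Units.val_mul, Ring.inverse_unit, Ring.inverse_unit,
      Ring.inverse_unit, mul_inv_rev, Units.val_mul]
  have hLu : IsUnit (Ring.inverse (tTransform (ν t) 0)) := hTνu.ringInverse
  filter_upwards [eventually_hasDerivWithinAt_conj ht hTμ hL hLu, eventually_of_pathNhds ht hT,
    eventually_of_pathNhds ht (hTν.eventually_isUnit hTνu), hTν.path] with w h1 h2 h3 h4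
  obtain ⟨hu, hd, ⟨hd1, hd2⟩, hder⟩ := h1
  have hy : Ring.inverse (Ring.inverse (tTransform (ν t) w)) = tTransform (ν t) w := by
    obtain ⟨u, hu⟩ := h3.1
    have hu : (u : B) = tTransform (ν t) w := hu
    rw [← hu, Ring.inverse_unit, Ring.inverse_unit, inv_inv]
  have hdy := h4.hasDerivWithinAt
  have hdL : pathDeriv (fun s w => Ring.inverse (tTransform (ν s) w)) t w =
      -(Ring.inverse (tTransform (ν t) w) * pathDeriv (fun s => tTransform (ν s)) t w *
        Ring.inverse (tTransform (ν t) w)) :=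
    (hasDerivWithinAt_ringInverse hdy h3.1).derivWithin (uniqueDiffOn_Icc_zero_one t ht)
  simp only [hy] at hd1 hd2 hder
  refine ⟨h3.1, h4, hd1, hd2, ?_⟩
  have := (hder.mul hdy).congr_of_eventuallyEq h2.2 h2.1
  refine this.congr_deriv ?_
  simp only [hy, hdL]
  have hcancel : tTransform (ν t) w * Ring.inverse (tTransform (ν t) w) = 1 :=
    Ring.mul_inverse_cancel _ h3.1
  set y := tTransform (ν t) w
  set y' := Ring.inverse y
  set dy := pathDeriv (fun s => tTransform (ν s)) t w
  -- The velocity was computed in terms of the derivative of `T_ν⁻¹`; inserting that derivative and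
  -- cancelling `y y'` expresses it through that of `T_ν`.
  have e : y * w * -(y' * dy * y') - y * -(y' * dy * y') * y * w * y' =
      dy * w * y' - y * w * y' * dy * y' := by
    have h5 : y' * y = 1 := Ring.inverse_mul_cancel _ h3.1
    have : y * -(y' * dy * y') * y * w * y' = -((y * y') * dy * (y' * y) * w * y') := by
      noncomm_ring
    rw [this, hcancel, h5]
    noncomm_ring
  rw [e, add_mul]
  change _ + _ + _ * dy = _
  abel

end FreeDerivatives

end

end OVP

theorem mainTheorem4 {B : Type u} [CStarAlgebra B] [PartialOrder B] [StarOrderedRing B]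
    (μ ν : ℝ → NCPoly B →ₗ[ℂ] B)
    (hμ : IsDifferentiablePath μ) (hν : IsDifferentiablePath ν)
    (hμ₀ : IsRegularAtOrigin μ) (hν₀ : IsRegularAtOrigin ν) :
    -- free convolution
    (∀ τ : ℝ → NCPoly B →ₗ[ℂ] B,
      (∀ t ∈ Set.Icc (0 : ℝ) 1, IsUnit (μ t (NCPoly.X B)) ∧ IsUnit (ν t (NCPoly.X B))) →
      (∀ t ∈ Set.Icc (0 : ℝ) 1, IsFreeConv.{u, v} (μ t) (ν t) (τ t)) →
      ∀ t ∈ Set.Icc (0 : ℝ) 1, ∀ᶠ w in nhds (0 : B),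
        (let Sμ := fun s => sTransform (μ s)
         let Sν := fun s => sTransform (ν s)
         let s := Sν t w
         let s' := Ring.inverse s
         let ds := pathDeriv Sν t w
         let c := s' * w * s
         IsUnit s ∧ PathDifferentiableAt Sν t w ∧ PathDifferentiableAt Sμ t c ∧
         DifferentiableAt ℂ (Sμ t) c ∧
         HasDerivWithinAt (fun r => sTransform (τ r) w)
           (ds * Sμ t c + s * pathDeriv Sμ t c +
             s * fderiv ℂ (Sμ t) c (s' * w * ds - s' * ds * s' * w * s))
           (Set.Icc 0 1) t) ∧
        (let Tμ := fun s => tTransform (μ s)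
         let Tν := fun s => tTransform (ν s)
         let y := Tν t w
         let y' := Ring.inverse y
         let dy := pathDeriv Tν t w
         let c := y * w * y'
         IsUnit y ∧ PathDifferentiableAt Tν t w ∧ PathDifferentiableAt Tμ t c ∧
         DifferentiableAt ℂ (Tμ t) c ∧
         HasDerivWithinAt (fun r => tTransform (τ r) w)
           (Tμ t c * dy + pathDeriv Tμ t c * y +
             fderiv ℂ (Tμ t) c (dy * w * y' - y * w * y' * dy * y') * y)
           (Set.Icc 0 1) t)) ∧
    -- Boolean convolution
    (∀ τ : ℝ → NCPoly B →ₗ[ℂ] B,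
      (∀ t ∈ Set.Icc (0 : ℝ) 1, IsBooleanConv.{u, v} (μ t) (ν t) (τ t)) →
      ∀ t ∈ Set.Icc (0 : ℝ) 1, ∀ᶠ b in nhds (0 : B),
        PathDifferentiableAt (fun s => eta (μ s)) t b ∧
        PathDifferentiableAt (fun s => eta (ν s)) t b ∧
        HasDerivWithinAt (fun r => eta (τ r) b)
          (eta (μ t) b * pathDeriv (fun s => eta (ν s)) t b +
            pathDeriv (fun s => eta (μ s)) t b * eta (ν t) b)
          (Set.Icc 0 1) t) ∧
    -- monotone convolution, distribution of `yx`
    (∀ τ : ℝ → NCPoly B →ₗ[ℂ] B,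
      (∀ t ∈ Set.Icc (0 : ℝ) 1, IsMonotoneConvRev.{u, v} (μ t) (ν t) (τ t)) →
      ∀ t ∈ Set.Icc (0 : ℝ) 1, ∀ᶠ b in nhds (0 : B),
        PathDifferentiableAt (fun s => kappa (ν s)) t b ∧
        PathDifferentiableAt (fun s => kappa (μ s)) t (kappa (ν t) b) ∧
        DifferentiableAt ℂ (kappa (μ t)) (kappa (ν t) b) ∧
        HasDerivWithinAt (fun r => kappa (τ r) b)
          (fderiv ℂ (kappa (μ t)) (kappa (ν t) b) (pathDeriv (fun s => kappa (ν s)) t b) +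
            pathDeriv (fun s => kappa (μ s)) t (kappa (ν t) b))
          (Set.Icc 0 1) t) ∧
    -- monotone convolution, distribution of `xy`
    (∀ τ : ℝ → NCPoly B →ₗ[ℂ] B,
      (∀ t ∈ Set.Icc (0 : ℝ) 1, IsMonotoneConv.{u, v} (μ t) (ν t) (τ t)) →
      ∀ t ∈ Set.Icc (0 : ℝ) 1, ∀ᶠ b in nhds (0 : B),
        PathDifferentiableAt (fun s => rho (ν s)) t b ∧
        PathDifferentiableAt (fun s => rho (μ s)) t (rho (ν t) b) ∧
        DifferentiableAt ℂ (rho (μ t)) (rho (ν t) b) ∧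
        HasDerivWithinAt (fun r => rho (τ r) b)
          (fderiv ℂ (rho (μ t)) (rho (ν t) b) (pathDeriv (fun s => rho (ν s)) t b) +
            pathDeriv (fun s => rho (μ s)) t (rho (ν t) b))
          (Set.Icc 0 1) t) := by
  refine ⟨fun τ hu hτ t ht => ?_, fun τ hτ t ht => ?_, fun τ hτ t ht => ?_, fun τ hτ t ht => ?_⟩
  · have hμt := hμ.isTamePath hμ₀ ht
    have hνt := hν.isTamePath hν₀ ht
    obtain ⟨-, -, -, -, -, hSμ, hSμu, -⟩ := hμt.exists_psiInv (hu t ht).1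
    obtain ⟨-, -, -, -, -, hSν, hSνu, -⟩ := hνt.exists_psiInv (hu t ht).2
    have hfree := sTransform_free hμt hνt (hu t ht).1 (hu t ht).2 hτ
    exact (eventually_hasDerivWithinAt_sTransform ht hSμ hSν hSνu hfree).and
      (eventually_hasDerivWithinAt_tTransform ht hSμ hSμu hSν hSνu hfree)
  · have hμt := hμ.isTamePath hμ₀ ht
    have hνt := hν.isTamePath hν₀ ht
    exact eventually_hasDerivWithinAt_mul ht hμt.eta_regular hνt.eta_regular
      (eta_boolean hμt hνt hτ)
  · have hμt := hμ.isTamePath hμ₀ ht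
    have hνt := hν.isTamePath hν₀ ht
    exact eventually_hasDerivWithinAt_comp ht hμt.kappa_regular hνt.kappa_regular
      hνt.kappa_zero (kappa_monotone hμt hνt hτ)
  · have hμt := hμ.isTamePath hμ₀ ht
    have hνt := hν.isTamePath hν₀ ht
    exact eventually_hasDerivWithinAt_comp ht hμt.rho_regular hνt.rho_regular
      hνt.rho_zero (rho_monotone hμt hνt hτ)
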